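/- Let $B_m$ be the braid group on $m$ strands, numbered $0,\dots,m-1$, with Artin generators $s_0,\dots,s_{m-2}$, where in $s_j$ the strands in positions $j$ and $j+1$ cross once, the strand moving to the left passing over the other; $bb'$ means $b$ followed by $b'$. A tree-braid-tree diagram $(T_+,br,T_-)$ consists of two finite rooted binary trees with the same number $n$ of carets (leaves numbered $0,\dots,n$ from left to right) and a braid $br\in B_{n+1}$ joining the leaves of $T_+$ to those of $T_-$. Splitting a strand replaces it by two parallel strands and attaches a caret to each of the two leaves it joins; the inverse operation is called reduction. The braided Thompson group $BV$ is the set of diagrams modulo the equivalence relation generated by splittings and reductions, with product $[(A,b,C)]\,[(C,b',E)]=[(A,bb',E)]$. Each class has a unique representative with the least number of carets, the reduced diagram $(T_+(g),br(g),T_-(g))$ of $g$; $N(g)$ is its number of carets. Left edges of a tree are labelled $0$ and right edges $1$, and a branch of a tree is the binary word labelling the path from the root to a leaf. Let $T_n$ be the all-right tree with $n$ carets, and let $X=\{x_0,x_1,\sigma_1,\tau_1\}$, where $x_0=(T,\mathrm{Id},T_2)$ with $T$ having the branches $00,01,1$; $x_1=(T',\mathrm{Id},T_3)$ with $T'$ having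 the branches $0,100,101,11$; $\sigma_1=(T_2,s_0,T_2)$; $\tau_1=(T_1,s_0,T_1)$. Let $|g|$ be the word length of $g\in BV$ with respect to the generating set $X$, and $\|w\|$ the length of a word $w$ over $X\cup X^{-1}$. There exist real constants $\delta,D>0$ and positive integers $M,Q$ such that for every $g\in BV$ with $N(g)\ge 3$, writing $v=x_0^{Q|g|}x_1^{-1}x_0^{-Q|g|+1}$, the following holds. (1) There is a path in the Cayley graph $\mathrm{Cay}(BV,X)$ from $g$ to $v$ of length at most $D|g|$ all of whose vertices $h$ satisfy $|h|>\delta|g|$. (2) There is a word $w$ over $X\cup X^{-1}$ with $\|w\|<D|g|$ and $gw=v$ in $BV$, such that $|gw'|>\delta|g|$ for every prefix $w'$ of $w$. Moreover, $w$ can be taken of the form $w\equiv w_1w_2w_3w_4w_5$, where, with $g_1=gw_1$ and $g_3=gw_1w_2w_3$: - $w_1\equiv x_0^2x_1^{-1}x_0^{-1}$ if $0$ is a branch of $T_-(g)$, and $w_1$ is empty otherwise; - $w_2\equiv x_0^{-M(N(g_1)+1)}\,x_1\,x_0^{M(N(g_1)+1)}$; - $w_3$ is a word of minimal length representing the element $(T_-(g_1),\,s_{k-1}\cdots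 s_1s_0,\,T_+(g_1))$, where the strand of $br(g_1)$ that starts at the leaf $0$ of $T_+(g_1)$ ends at the leaf $k$ of $T_-(g_1)$ (so the braid is trivial if $k=0$, and otherwise its $k$-th strand passes over the strands $k-1,\dots,0$); - $w_4\equiv x_0^{Q|g|}x_1^{-1}x_0^{-Q|g|+1}$, and $g_3$ commutes with the element $v$ that $w_4$ represents; - $w_5$ is a word of minimal length representing $g_3^{-1}$. -/

import Mathlib

namespace BraidedThompson

/-- Artin's relations among the generators `σ_0, …, σ_{m-2}` of the braid group on `m` strands. -/
def artinRels (m : ℕ) : Set (FreeGroup {k : ℕ // k + 1 < m}) :=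
  {r | ∃ k l : {k : ℕ // k + 1 < m}, k.1 + 2 ≤ l.1 ∧
      r = FreeGroup.of k * FreeGroup.of l * (FreeGroup.of l * FreeGroup.of k)⁻¹} ∪
  {r | ∃ k l : {k : ℕ // k + 1 < m}, k.1 + 1 = l.1 ∧
      r = FreeGroup.of k * FreeGroup.of l * FreeGroup.of k *
        (FreeGroup.of l * FreeGroup.of k * FreeGroup.of l)⁻¹}

/-- The braid group on `m` strands (numbered `0, …, m-1`). A product `b₁ * b₂` is the braid `b₁`
followed by the braid `b₂`. -/
abbrev BraidGroup (m : ℕ) : Type := PresentedGroup (artinRels m)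

/-- The Artin generator `σ_k`, in which the strands in positions `k` and `k + 1` cross once, the
strand moving to the left passing over the other; by convention `1` if `k + 1 ≥ m`. -/
def artin (m k : ℕ) : BraidGroup m :=
  if h : k + 1 < m then PresentedGroup.of ⟨k, h⟩ else 1

theorem artin_comm {m k l : ℕ} (h : k + 2 ≤ l) :
    artin m k * artin m l = artin m l * artin m k := by
  unfold artin
  by_cases hl : l + 1 < m
  · have hk : k + 1 < m := by omega
    rw [dif_pos hl, dif_pos hk]
    exact PresentedGroup.mk_eq_mk_of_mul_inv_mem (rels := artinRels m)
      (x := FreeGroup.of ⟨k, hk⟩ * FreeGroup.of ⟨l, hl⟩)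
      (y := FreeGroup.of ⟨l, hl⟩ * FreeGroup.of ⟨k, hk⟩) (Or.inl ⟨_, _, h, rfl⟩)
  · rw [dif_neg hl]; simp

theorem artin_braid {m k : ℕ} (h : k + 2 < m) :
    artin m k * artin m (k + 1) * artin m k =
      artin m (k + 1) * artin m k * artin m (k + 1) := by
  unfold artin
  have hk : k + 1 < m := by omega
  have hl : k + 1 + 1 < m := by omega
  rw [dif_pos hl, dif_pos hk]
  exact PresentedGroup.mk_eq_mk_of_mul_inv_mem (rels := artinRels m)
    (x := FreeGroup.of ⟨k, hk⟩ * FreeGroup.of ⟨k + 1, hl⟩ * FreeGroup.of ⟨k, hk⟩)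
    (y := FreeGroup.of ⟨k + 1, hl⟩ * FreeGroup.of ⟨k, hk⟩ * FreeGroup.of ⟨k + 1, hl⟩)
    (Or.inr ⟨_, _, rfl, rfl⟩)

/-- The braid obtained from `σ_k` by splitting the strand that starts in position `i` into two
parallel strands. -/
def splitArtin (m k i : ℕ) : BraidGroup (m + 1) :=
  if i < k then artin (m + 1) (k + 1)
  else if i = k then artin (m + 1) (k + 1) * artin (m + 1) k
  else if i = k + 1 then artin (m + 1) k * artin (m + 1) (k + 1)
  else artin (m + 1) k

theorem splitArtin_of_lt {m k i : ℕ} (h : i < k) :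
    splitArtin m k i = artin (m + 1) (k + 1) := if_pos h

theorem splitArtin_self (m k : ℕ) :
    splitArtin m k k = artin (m + 1) (k + 1) * artin (m + 1) k := by
  rw [splitArtin, if_neg (lt_irrefl k), if_pos rfl]

theorem splitArtin_succ (m k : ℕ) :
    splitArtin m k (k + 1) = artin (m + 1) k * artin (m + 1) (k + 1) := by
  rw [splitArtin, if_neg (by omega), if_neg (by omega), if_pos rfl]

theorem splitArtin_of_gt {m k i : ℕ} (h : k + 1 < i) :
    splitArtin m k i = artin (m + 1) k := by
  rw [splitArtin, if_neg (by omega), if_neg (by omega), if_neg (by omega)]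

/-- The value on `σ_k` of the homomorphism that records the underlying permutation of a braid
together with all its splittings. -/
def splitGen (m k : ℕ) : (ℕ → BraidGroup (m + 1)) ⋊[mulAutArrow] Equiv.Perm ℕ :=
  ⟨splitArtin m k, Equiv.swap k (k + 1)⟩

theorem splitGen_mul (m k l : ℕ) : splitGen m k * splitGen m l =
    ⟨fun i => splitArtin m k i * splitArtin m l (Equiv.swap k (k + 1) i),
      Equiv.swap k (k + 1) * Equiv.swap l (l + 1)⟩ := rfl

theorem swap_far {k l : ℕ} (h : k + 2 ≤ l) :
    Equiv.swap k (k + 1) * Equiv.swap l (l + 1) = Equiv.swap l (l + 1) * Equiv.swap k (k + 1) := by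
  ext i
  simp only [Equiv.Perm.mul_apply, Equiv.swap_apply_def]
  split_ifs <;> omega

theorem swap_near (k : ℕ) :
    Equiv.swap k (k + 1) * Equiv.swap (k + 1) (k + 1 + 1) * Equiv.swap k (k + 1) =
      Equiv.swap (k + 1) (k + 1 + 1) * Equiv.swap k (k + 1) *
        Equiv.swap (k + 1) (k + 1 + 1) := by
  ext i
  simp only [Equiv.Perm.mul_apply, Equiv.swap_apply_def]
  split_ifs <;> omega

theorem splitGen_comm {m k l : ℕ} (h : k + 2 ≤ l) :
    splitGen m k * splitGen m l = splitGen m l * splitGen m k := by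
  rw [splitGen_mul, splitGen_mul]
  refine SemidirectProduct.ext (funext fun i => ?_) (swap_far h)
  have e1 : Commute (artin (m + 1) k) (artin (m + 1) l) := artin_comm h
  have e2 : Commute (artin (m + 1) k) (artin (m + 1) (l + 1)) := artin_comm (by omega)
  have e3 : Commute (artin (m + 1) (k + 1)) (artin (m + 1) (l + 1)) := artin_comm (by omega)
  have sk : ∀ j, j ≠ k → j ≠ k + 1 → Equiv.swap k (k + 1) j = j := fun j =>
    Equiv.swap_apply_of_ne_of_ne
  have sl : ∀ j, j ≠ l → j ≠ l + 1 → Equiv.swap l (l + 1) j = j := fun j =>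
    Equiv.swap_apply_of_ne_of_ne
  show splitArtin m k i * splitArtin m l (Equiv.swap k (k + 1) i) =
    splitArtin m l i * splitArtin m k (Equiv.swap l (l + 1) i)
  rcases (by omega : i < k ∨ i = k ∨ i = k + 1 ∨ (k + 1 < i ∧ i < l) ∨ i = l ∨ i = l + 1 ∨
    l + 1 < i) with hi | rfl | rfl | ⟨hi, hi2⟩ | rfl | rfl | hi
  · rw [sk i (by omega) (by omega), sl i (by omega) (by omega), splitArtin_of_lt hi,
      splitArtin_of_lt (by omega)]
    exact e3
  · rw [Equiv.swap_apply_left, sl i (by omega) (by omega), splitArtin_self,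
      splitArtin_of_lt (by omega), splitArtin_of_lt (by omega)]
    exact e3.mul_left e2
  · rw [Equiv.swap_apply_right, sl _ (by omega) (by omega), splitArtin_succ,
      splitArtin_of_lt (by omega), splitArtin_of_lt (by omega)]
    exact e2.mul_left e3
  · rw [sk i (by omega) (by omega), sl i (by omega) (by omega), splitArtin_of_gt hi,
      splitArtin_of_lt hi2]
    exact e2
  · rw [sk i (by omega) (by omega), Equiv.swap_apply_left, splitArtin_self,
      splitArtin_of_gt (by omega), splitArtin_of_gt (by omega)]
    exact e2.mul_right e1
  · rw [sk _ (by omega) (by omega), Equiv.swap_apply_right, splitArtin_succ,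
      splitArtin_of_gt (by omega), splitArtin_of_gt (by omega)]
    exact e1.mul_right e2
  · rw [sk i (by omega) (by omega), sl i (by omega) (by omega), splitArtin_of_gt (by omega),
      splitArtin_of_gt hi]
    exact e1

theorem braid_aux {G : Type*} [Group G] {a b c : G} (hac : a * c = c * a)
    (hab : a * b * a = b * a * b) (hbc : b * c * b = c * b * c) :
    b * a * (c * b) * a = c * (b * a) * (c * b) ∧
    a * b * c * (b * a) = c * b * a * (b * c) ∧
    a * (b * c) * (a * b) = b * c * (a * b) * c := by
  refine ⟨?_, ?_, ?_⟩
  · calc b * a * (c * b) * a = b * (a * c) * b * a := by group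
      _ = b * c * (a * b * a) := by rw [hac]; group
      _ = b * c * b * a * b := by rw [hab]; group
      _ = c * b * (c * a) * b := by rw [hbc]; group
      _ = c * (b * a) * (c * b) := by rw [← hac]; group
  · calc a * b * c * (b * a) = a * (b * c * b) * a := by group
      _ = (a * c) * b * (c * a) := by rw [hbc]; group
      _ = c * (a * b * a) * c := by rw [← hac]; nth_rewrite 1 [hac]; group
      _ = c * b * a * (b * c) := by rw [hab]; group
  · calc a * (b * c) * (a * b) = a * b * (c * a) * b := by group
      _ = (a * b * a) * c * b := by rw [← hac]; group
      _ = b * a * (b * c * b) := by rw [hab]; group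
      _ = b * (a * c) * b * c := by rw [hbc]; group
      _ = b * c * (a * b) * c := by rw [hac]; group

theorem splitGen_braid {m k : ℕ} (h : k + 2 < m) :
    splitGen m k * splitGen m (k + 1) * splitGen m k =
      splitGen m (k + 1) * splitGen m k * splitGen m (k + 1) := by
  refine SemidirectProduct.ext (funext fun i => ?_) (swap_near k)
  change splitArtin m k i * splitArtin m (k + 1) (Equiv.swap k (k + 1) i) *
      splitArtin m k (Equiv.swap (k + 1) (k + 1 + 1) (Equiv.swap k (k + 1) i)) =
    splitArtin m (k + 1) i * splitArtin m k (Equiv.swap (k + 1) (k + 1 + 1) i) *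
      splitArtin m (k + 1) (Equiv.swap k (k + 1) (Equiv.swap (k + 1) (k + 1 + 1) i))
  have b1 := artin_braid (m := m + 1) (k := k) (by omega)
  have b2 := artin_braid (m := m + 1) (k := k + 1) (by omega)
  obtain ⟨r1, r2, r3⟩ := braid_aux (artin_comm (m := m + 1) (le_refl (k + 2))) b1 b2
  have s1 : ∀ j, j ≠ k → j ≠ k + 1 → Equiv.swap k (k + 1) j = j := fun j =>
    Equiv.swap_apply_of_ne_of_ne
  have s2 : ∀ j, j ≠ k + 1 → j ≠ k + 1 + 1 → Equiv.swap (k + 1) (k + 1 + 1) j = j := fun j =>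
    Equiv.swap_apply_of_ne_of_ne
  have s3 : Equiv.swap (k + 1) (k + 1 + 1) k = k := s2 _ (by omega) (by omega)
  have s4 : Equiv.swap k (k + 1) (k + 1 + 1) = k + 1 + 1 := s1 _ (by omega) (by omega)
  rcases (by omega : i < k ∨ i = k ∨ i = k + 1 ∨ i = k + 1 + 1 ∨ k + 1 + 1 < i) with
    hi | rfl | rfl | rfl | hi
  · rw [s1 i (by omega) (by omega), s2 i (by omega) (by omega), s1 i (by omega) (by omega),
      splitArtin_of_lt hi, splitArtin_of_lt (by omega)]
    exact b2
  · rw [s3, Equiv.swap_apply_left, Equiv.swap_apply_left, splitArtin_self, splitArtin_self,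
      splitArtin_of_gt (by omega), splitArtin_of_lt (by omega)]
    exact r1
  · rw [Equiv.swap_apply_right, Equiv.swap_apply_left, s3, s4, splitArtin_self, splitArtin_succ,
      splitArtin_of_lt (by omega), splitArtin_self, splitArtin_of_gt (by omega), splitArtin_succ]
    exact r2
  · rw [Equiv.swap_apply_right, s4, Equiv.swap_apply_right, Equiv.swap_apply_right,
      splitArtin_of_gt (by omega), splitArtin_succ, splitArtin_succ, splitArtin_of_lt (by omega)]
    exact r3
  · rw [s1 i (by omega) (by omega), s2 i (by omega) (by omega), s1 i (by omega) (by omega),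
      splitArtin_of_gt (by omega), splitArtin_of_gt hi]
    exact b1

/-- The homomorphism sending a braid to its splittings and its underlying permutation. -/
def splitHom (m : ℕ) : BraidGroup m →* (ℕ → BraidGroup (m + 1)) ⋊[mulAutArrow] Equiv.Perm ℕ :=
  PresentedGroup.toGroup (f := fun k => splitGen m k.1) (by
    rintro r (⟨k, l, h, rfl⟩ | ⟨k, l, h, rfl⟩)
    · simp only [map_mul, map_inv, FreeGroup.lift_apply_of]
      rw [splitGen_comm h, mul_inv_cancel]
    · simp only [map_mul, map_inv, FreeGroup.lift_apply_of, ← h]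
      rw [splitGen_braid (by have := l.2; omega), mul_inv_cancel])

/-- The position in which the strand of `b` that starts in position `i` ends. -/
def strandEnd {m : ℕ} (b : BraidGroup m) (i : ℕ) : ℕ := (splitHom m b).right⁻¹ i

/-- The braid obtained from `b` by splitting the strand that starts in position `i` into two
parallel strands. It is determined by its values on the Artin generators and by
`split (b * c) i = split b i * split c (strandEnd b i)`. -/
def split {m : ℕ} (b : BraidGroup m) (i : ℕ) : BraidGroup (m + 1) := (splitHom m b).left i

theorem strandEnd_one {m : ℕ} (i : ℕ) : strandEnd (1 : BraidGroup m) i = i := by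
  simp [strandEnd]

theorem strandEnd_mul {m : ℕ} (b c : BraidGroup m) (i : ℕ) :
    strandEnd (b * c) i = strandEnd c (strandEnd b i) := by
  simp [strandEnd]

theorem split_one {m : ℕ} (i : ℕ) : split (1 : BraidGroup m) i = 1 := by
  simp [split]

theorem split_mul {m : ℕ} (b c : BraidGroup m) (i : ℕ) :
    split (b * c) i = split b i * split c (strandEnd b i) := by
  simp only [split, strandEnd, map_mul, SemidirectProduct.mul_left]
  rfl

theorem strandEnd_inv_left {m : ℕ} (b : BraidGroup m) (i : ℕ) :
    strandEnd b⁻¹ (strandEnd b i) = i := by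
  rw [← strandEnd_mul, mul_inv_cancel, strandEnd_one]

theorem strandEnd_inv_right {m : ℕ} (b : BraidGroup m) (i : ℕ) :
    strandEnd b (strandEnd b⁻¹ i) = i := by
  rw [← strandEnd_mul, inv_mul_cancel, strandEnd_one]

theorem strandEnd_injective {m : ℕ} (b : BraidGroup m) : Function.Injective (strandEnd b) :=
  Function.LeftInverse.injective (strandEnd_inv_left b)

theorem split_inv {m : ℕ} (b : BraidGroup m) (i : ℕ) :
    split b⁻¹ (strandEnd b i) = (split b i)⁻¹ := by
  have h := split_mul b b⁻¹ i
  rw [mul_inv_cancel, split_one] at h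
  exact eq_inv_of_mul_eq_one_right h.symm

theorem splitHom_artin {m k : ℕ} (h : k + 1 < m) : splitHom m (artin m k) = splitGen m k := by
  rw [artin, dif_pos h]
  exact PresentedGroup.toGroup.of _

theorem strandEnd_artin {m k : ℕ} (h : k + 1 < m) (i : ℕ) :
    strandEnd (artin m k) i = if i = k then k + 1 else if i = k + 1 then k else i := by
  rw [strandEnd, splitHom_artin h, splitGen, Equiv.swap_inv, Equiv.swap_apply_def]

theorem split_artin {m k : ℕ} (h : k + 1 < m) (i : ℕ) :
    split (artin m k) i = splitArtin m k i := by
  rw [split, splitHom_artin h, splitGen]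

theorem braid_induction {m : ℕ} {P : BraidGroup m → Prop} (one : P 1)
    (gen : ∀ k, k + 1 < m → P (artin m k)) (mul : ∀ b c, P b → P c → P (b * c))
    (inv : ∀ b, P b → P b⁻¹) (b : BraidGroup m) : P b := by
  let H : Subgroup (BraidGroup m) :=
    { carrier := {b | P b}, one_mem' := one, mul_mem' := mul _ _, inv_mem' := inv _ }
  refine PresentedGroup.generated_by _ H (fun k => ?_) b
  have h := gen k.1 k.2
  rw [artin, dif_pos k.2] at h
  exact h

theorem strandEnd_lt {m : ℕ} (b : BraidGroup m) : ∀ i, strandEnd b i < m ↔ i < m := by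
  induction b using braid_induction with
  | one => intro i; rw [strandEnd_one]
  | gen k hk => intro i; rw [strandEnd_artin hk]; split_ifs <;> omega
  | mul b c hb hc => intro i; rw [strandEnd_mul, hc, hb]
  | inv b hb => intro i; rw [← hb, strandEnd_inv_right]

/-- The position after splitting in position `a` of the object that was in position `e`; the copy
that is added gets position `a + 1`. -/
def skip (a e : ℕ) : ℕ := if e ≤ a then e else e + 1

theorem strandEnd_split {m : ℕ} (b : BraidGroup m) : ∀ i,
    strandEnd (split b i) (i + 1) = strandEnd b i + 1 ∧
    ∀ l, strandEnd (split b i) (skip i l) = skip (strandEnd b i) (strandEnd b l) := by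
  induction b using braid_induction with
  | one => intro i; simp [split_one, strandEnd_one]
  | gen k hk =>
    intro i
    have h1 : k + 1 < m + 1 := by omega
    have h2 : k + 1 + 1 < m + 1 := by omega
    rw [split_artin hk, splitArtin]
    constructor
    · split_ifs <;> simp only [strandEnd_mul, strandEnd_artin, h1, h2, hk] <;> grind
    · intro l
      rw [strandEnd_artin hk, strandEnd_artin hk]
      have hs : ∀ a e, skip a e = if e ≤ a then e else e + 1 := fun _ _ => rfl
      split_ifs <;> simp only [strandEnd_mul, strandEnd_artin h1, strandEnd_artin h2] <;> grind
  | mul b c hb hc =>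
    intro i
    simp only [split_mul, strandEnd_mul, (hb i).1, (hc _).1, (hb i).2, (hc _).2, implies_true,
      and_self]
  | inv b hb =>
    intro i
    obtain ⟨h1, h2⟩ := hb (strandEnd b⁻¹ i)
    have h3 := split_inv b (strandEnd b⁻¹ i)
    rw [strandEnd_inv_right] at h1 h2 h3
    rw [h3]
    refine ⟨?_, fun l => ?_⟩
    · rw [← h1, strandEnd_inv_left]
    · have h4 := h2 (strandEnd b⁻¹ l)
      rw [strandEnd_inv_right] at h4
      rw [← h4, strandEnd_inv_left]

theorem split_split {m : ℕ} (b : BraidGroup m) : ∀ i j, i ≠ j →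
    split (split b i) (skip i j) = split (split b j) (skip j i) := by
  induction b using braid_induction with
  | one => intro i j _; simp [split_one]
  | gen k hk =>
    have h1 : k + 1 < m + 1 := by omega
    have h2 : k + 1 + 1 < m + 1 := by omega
    have key : ∀ i j, i < j →
        split (split (artin m k) i) (skip i j) = split (split (artin m k) j) (skip j i) := by
      intro i j hij
      have e : Commute (artin (m + 1 + 1) k) (artin (m + 1 + 1) (k + 1 + 1)) :=
        artin_comm (le_refl (k + 2))
      rw [skip, skip, if_neg (by omega), if_pos (by omega), split_artin hk, split_artin hk]
      have f1 : strandEnd (artin (m + 1) (k + 1)) k = k := by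
        rw [strandEnd_artin h2, if_neg (by omega), if_neg (by omega)]
      have f2 : strandEnd (artin (m + 1) (k + 1)) (k + 1) = k + 1 + 1 := by
        rw [strandEnd_artin h2, if_pos rfl]
      have f3 : strandEnd (artin (m + 1) (k + 1)) (k + 1 + 1) = k + 1 := by
        rw [strandEnd_artin h2, if_neg (by omega), if_pos rfl]
      have f4 : strandEnd (artin (m + 1) k) k = k + 1 := by
        rw [strandEnd_artin h1, if_pos rfl]
      have f5 : strandEnd (artin (m + 1) k) (k + 1) = k := by
        rw [strandEnd_artin h1, if_neg (by omega), if_pos rfl]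
      have f6 : ∀ l, l < k ∨ k + 1 < l → strandEnd (artin (m + 1) k) l = l := by
        intro l hl
        rw [strandEnd_artin h1, if_neg (by omega), if_neg (by omega)]
      have f7 : ∀ l, l < k + 1 ∨ k + 1 + 1 < l → strandEnd (artin (m + 1) (k + 1)) l = l := by
        intro l hl
        rw [strandEnd_artin h2, if_neg (by omega), if_neg (by omega)]
      have g1 : ∀ l, l < k → split (artin (m + 1) k) l = artin (m + 1 + 1) (k + 1) := by
        intro l hl
        rw [split_artin h1, splitArtin_of_lt hl]
      have g2 : ∀ l, k + 1 < l → split (artin (m + 1) k) l = artin (m + 1 + 1) k := by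
        intro l hl
        rw [split_artin h1, splitArtin_of_gt hl]
      have g3 : ∀ l, l < k + 1 →
          split (artin (m + 1) (k + 1)) l = artin (m + 1 + 1) (k + 1 + 1) := by
        intro l hl
        rw [split_artin h2, splitArtin_of_lt hl]
      have g4 : ∀ l, k + 1 + 1 < l →
          split (artin (m + 1) (k + 1)) l = artin (m + 1 + 1) (k + 1) := by
        intro l hl
        rw [split_artin h2, splitArtin_of_gt hl]
      rcases (by omega : i < k ∨ i = k ∨ i = k + 1 ∨ k + 1 < i) with hi | rfl | rfl | hi
      · rw [splitArtin_of_lt hi]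
        rcases (by omega : j < k ∨ j = k ∨ j = k + 1 ∨ k + 1 < j) with hj | rfl | rfl | hj
        · rw [splitArtin_of_lt hj, g3 _ (by omega), g3 _ (by omega)]
        · rw [splitArtin_self, split_artin h2, splitArtin_self, split_mul, f7 _ (by omega),
            g3 _ (by omega), g1 _ hi]
        · rw [splitArtin_succ, split_artin h2, splitArtin_succ, split_mul, f6 _ (by omega),
            g3 _ (by omega), g1 _ hi]
        · rw [splitArtin_of_gt hj, g4 _ (by omega), g1 _ hi]
      · rw [splitArtin_self, split_mul]
        rcases (by omega : j = i + 1 ∨ i + 1 < j) with rfl | hj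
        · rw [splitArtin_succ, split_mul, f3, f4, split_artin h2, split_artin h1, split_artin h1,
            split_artin h2, splitArtin_succ, splitArtin_succ, splitArtin_self, splitArtin_self]
          calc _ = artin (m + 1 + 1) (i + 1) *
                (artin (m + 1 + 1) (i + 1 + 1) * artin (m + 1 + 1) i) *
                artin (m + 1 + 1) (i + 1) := by simp only [mul_assoc]
            _ = _ := by rw [← e.eq]; simp only [mul_assoc]
        · rw [splitArtin_of_gt hj, f7 _ (by omega), g4 _ (by omega), g2 _ (by omega),
            split_artin h1, splitArtin_self]
      · rw [splitArtin_succ, split_mul, splitArtin_of_gt hij, f6 _ (by omega), g4 _ (by omega),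
          g2 _ (by omega), split_artin h1, splitArtin_succ]
      · rw [splitArtin_of_gt hi, splitArtin_of_gt (by omega), g2 _ (by omega), g2 _ hi]
    intro i j hij
    rcases lt_or_gt_of_ne hij with h | h
    · exact key i j h
    · exact (key j i h).symm
  | mul b c hb hc =>
    intro i j hij
    rw [split_mul, split_mul, split_mul, split_mul, hb i j hij, (strandEnd_split b i).2,
      (strandEnd_split b j).2, hc _ _ fun h => hij (strandEnd_injective b h)]
  | inv b hb =>
    intro i j hij
    have h := hb (strandEnd b⁻¹ i) (strandEnd b⁻¹ j) fun h => hij (strandEnd_injective _ h)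
    have h3 := split_inv b (strandEnd b⁻¹ i)
    have h4 := split_inv b (strandEnd b⁻¹ j)
    have h5 := split_inv (split b (strandEnd b⁻¹ i)) (skip (strandEnd b⁻¹ i) (strandEnd b⁻¹ j))
    have h6 := split_inv (split b (strandEnd b⁻¹ j)) (skip (strandEnd b⁻¹ j) (strandEnd b⁻¹ i))
    rw [(strandEnd_split b _).2] at h5 h6
    rw [strandEnd_inv_right] at h3 h4 h5 h6
    rw [strandEnd_inv_right] at h5 h6
    rw [h3, h4, h5, h6, h]


open BinaryTree

/-- Attach a caret to the leaf number `i` of a tree (leaves are numbered `0, 1, …` from left to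
right). -/
def addCaret : BinaryTree Unit → ℕ → BinaryTree Unit
  | .nil, _ => .node () .nil .nil
  | .node _ l r, i =>
    if i < l.numLeaves then .node () (addCaret l i) r
    else .node () l (addCaret r (i - l.numLeaves))

theorem numNodes_addCaret (t : BinaryTree Unit) : ∀ i,
    (addCaret t i).numNodes = t.numNodes + 1 := by
  induction t with
  | nil => intro i; rfl
  | node v l r hl hr =>
    intro i
    simp only [addCaret]
    split_ifs
    · simp only [numNodes, hl]; omega
    · simp only [numNodes, hr]; omega

theorem numLeaves_addCaret (t : BinaryTree Unit) (i : ℕ) :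
    (addCaret t i).numLeaves = t.numLeaves + 1 := by
  rw [numLeaves_eq_numNodes_succ, numLeaves_eq_numNodes_succ, numNodes_addCaret]

theorem addCaret_addCaret (t : BinaryTree Unit) : ∀ i j, i ≠ j → i < t.numLeaves →
    j < t.numLeaves →
    addCaret (addCaret t i) (skip i j) = addCaret (addCaret t j) (skip j i) := by
  have key : ∀ (t : BinaryTree Unit) (i j : ℕ), i < j → j < t.numLeaves →
      addCaret (addCaret t i) (j + 1) = addCaret (addCaret t j) i := by
    intro t
    induction t with
    | nil => intro i j h1 h2; simp at h2; omega
    | node v l r hl hr =>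
      intro i j h1 h2
      simp only [numLeaves] at h2
      by_cases hi : i < l.numLeaves
      · by_cases hj : j < l.numLeaves
        · have e1 : j + 1 < (addCaret l i).numLeaves := by rw [numLeaves_addCaret]; omega
          have e2 : i < (addCaret l j).numLeaves := by rw [numLeaves_addCaret]; omega
          simp only [addCaret, hi, hj, e1, e2, if_true, hl i j h1 hj]
        · have e1 : ¬ j + 1 < (addCaret l i).numLeaves := by rw [numLeaves_addCaret]; omega
          have e2 : j + 1 - (addCaret l i).numLeaves = j - l.numLeaves := by
            rw [numLeaves_addCaret]; omega
          simp only [addCaret, hi, hj, e1, e2, if_true, if_false]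
      · have hj : ¬ j < l.numLeaves := by omega
        have e1 : ¬ j + 1 < l.numLeaves := by omega
        have e2 : j + 1 - l.numLeaves = j - l.numLeaves + 1 := by omega
        simp only [addCaret, hi, hj, e1, e2, if_false,
          hr (i - l.numLeaves) (j - l.numLeaves) (by omega) (by omega)]
  intro i j hij hi hj
  rcases lt_or_gt_of_ne hij with h | h
  · rw [skip, skip, if_neg (by omega), if_pos (by omega), key t i j h hj]
  · rw [skip, skip, if_pos (by omega), if_neg (by omega), key t j i h hi]

/-- `IsTop t s`: the tree `t` is a rooted subtree of `s`, that is, `s` is obtained from `t` by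
attaching carets. -/
def IsTop : BinaryTree Unit → BinaryTree Unit → Prop
  | .nil, _ => True
  | .node _ _ _, .nil => False
  | .node _ a b, .node _ c d => IsTop a c ∧ IsTop b d

theorem IsTop.refl (t : BinaryTree Unit) : IsTop t t := by
  induction t with
  | nil => trivial
  | node v l r hl hr => exact ⟨hl, hr⟩

theorem IsTop.trans {t : BinaryTree Unit} : ∀ {s u}, IsTop t s → IsTop s u → IsTop t u := by
  induction t with
  | nil => intros; trivial
  | node v l r hl hr =>
    intro s u h1 h2
    cases s with
    | nil => exact h1.elim
    | node w a b =>
      cases u with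
      | nil => exact h2.elim
      | node x c d => exact ⟨hl h1.1 h2.1, hr h1.2 h2.2⟩

theorem IsTop.numNodes_le {t : BinaryTree Unit} : ∀ {s}, IsTop t s → t.numNodes ≤ s.numNodes := by
  induction t with
  | nil => intro s _; simp
  | node v l r hl hr =>
    intro s h
    cases s with
    | nil => exact h.elim
    | node w a b =>
      have := hl h.1
      have := hr h.2
      simp only [numNodes]; omega

theorem isTop_addCaret (t : BinaryTree Unit) : ∀ i, IsTop t (addCaret t i) := by
  induction t with
  | nil => intro i; trivial
  | node v l r hl hr =>
    intro i
    simp only [addCaret]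
    split_ifs
    · exact ⟨hl _, IsTop.refl _⟩
    · exact ⟨IsTop.refl _, hr _⟩

theorem exists_isTop_isTop (t : BinaryTree Unit) : ∀ s, ∃ u, IsTop t u ∧ IsTop s u := by
  induction t with
  | nil => intro s; exact ⟨s, trivial, IsTop.refl s⟩
  | node v l r hl hr =>
    intro s
    cases s with
    | nil => exact ⟨_, IsTop.refl _, trivial⟩
    | node w a b =>
      obtain ⟨u1, h1, h2⟩ := hl a
      obtain ⟨u2, h3, h4⟩ := hr b
      exact ⟨.node () u1 u2, ⟨h1, h3⟩, ⟨h2, h4⟩⟩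

theorem exists_addCaret_isTop (t : BinaryTree Unit) : ∀ {s}, IsTop t s → t ≠ s →
    ∃ i < t.numLeaves, IsTop (addCaret t i) s := by
  induction t with
  | nil =>
    intro s _ hne
    cases s with
    | nil => exact absurd rfl hne
    | node w a b => exact ⟨0, by simp, trivial, trivial⟩
  | node v l r hl hr =>
    intro s h hne
    cases s with
    | nil => exact h.elim
    | node w a b =>
      by_cases hla : l = a
      · have hrb : r ≠ b := by rintro rfl; exact hne (by rw [hla])
        obtain ⟨i, hi, h2⟩ := hr h.2 hrb
        refine ⟨l.numLeaves + i, by simp only [numLeaves]; omega, ?_⟩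
        have e : ¬ l.numLeaves + i < l.numLeaves := by omega
        simp only [addCaret, e, if_false, Nat.add_sub_cancel_left]
        exact ⟨h.1, h2⟩
      · obtain ⟨i, hi, h2⟩ := hl h.1 hla
        refine ⟨i, by simp only [numLeaves]; omega, ?_⟩
        simp only [addCaret, hi, if_true]
        exact ⟨h2, h.2⟩

theorem isTop_addCaret_addCaret (t : BinaryTree Unit) : ∀ {s i j}, i ≠ j → i < t.numLeaves →
    j < t.numLeaves → IsTop (addCaret t i) s → IsTop (addCaret t j) s →
    IsTop (addCaret (addCaret t i) (skip i j)) s := by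
  have key : ∀ (t : BinaryTree Unit) {s i j}, i < j → j < t.numLeaves →
      IsTop (addCaret t i) s → IsTop (addCaret t j) s →
      IsTop (addCaret (addCaret t i) (j + 1)) s := by
    intro t
    induction t with
    | nil => intro s i j h1 h2; simp at h2; omega
    | node v l r hl hr =>
      intro s i j h1 h2 h3 h4
      simp only [numLeaves] at h2
      by_cases hi : i < l.numLeaves
      · by_cases hj : j < l.numLeaves
        · have e1 : j + 1 < (addCaret l i).numLeaves := by rw [numLeaves_addCaret]; omega
          simp only [addCaret, hi, hj, e1, if_true] at h3 h4 ⊢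
          cases s with
          | nil => exact h3.elim
          | node w a b => exact ⟨hl h1 hj h3.1 h4.1, h3.2⟩
        · have e1 : ¬ j + 1 < (addCaret l i).numLeaves := by rw [numLeaves_addCaret]; omega
          have e2 : j + 1 - (addCaret l i).numLeaves = j - l.numLeaves := by
            rw [numLeaves_addCaret]; omega
          simp only [addCaret, hi, hj, e1, e2, if_true, if_false] at h3 h4 ⊢
          cases s with
          | nil => exact h3.elim
          | node w a b => exact ⟨h3.1, h4.2⟩
      · have hj : ¬ j < l.numLeaves := by omega
        have e1 : ¬ j + 1 < l.numLeaves := by omega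
        have e2 : j + 1 - l.numLeaves = j - l.numLeaves + 1 := by omega
        simp only [addCaret, hi, hj, e1, e2, if_false] at h3 h4 ⊢
        cases s with
        | nil => exact h3.elim
        | node w a b => exact ⟨h3.1, hr (by omega) (by omega) h3.2 h4.2⟩
  intro s i j hij hi hj h1 h2
  rcases lt_or_gt_of_ne hij with h | h
  · rw [skip, if_neg (by omega)]
    exact key t h hj h1 h2
  · rw [addCaret_addCaret t i j hij hi hj, skip, if_neg (by omega)]
    exact key t h hi h2 h1

/-- A tree-braid-tree diagram `(T₊, br, T₋)` whose trees have `n` carets: the leaf number `i` of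
the domain tree `T₊` is joined by a strand of `br` to the leaf number `strandEnd br i` of the range
tree `T₋`. -/
@[ext]
structure TreeBraidTree (n : ℕ) where
  /-- the domain tree -/
  domain : BinaryTree Unit
  /-- the range tree -/
  range : BinaryTree Unit
  numNodes_domain : domain.numNodes = n
  numNodes_range : range.numNodes = n
  /-- the braid joining the leaves -/
  braid : BraidGroup (n + 1)

namespace TreeBraidTree

variable {n m : ℕ}

/-- Splitting of the strand number `i`: the strand is doubled and a caret is attached to each of
the two leaves that it joins. -/
def split (D : TreeBraidTree n) (i : ℕ) : TreeBraidTree (n + 1) where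
  domain := addCaret D.domain i
  range := addCaret D.range (strandEnd D.braid i)
  numNodes_domain := by rw [numNodes_addCaret, D.numNodes_domain]
  numNodes_range := by rw [numNodes_addCaret, D.numNodes_range]
  braid := BraidedThompson.split D.braid i

/-- The inverse diagram `(T₋, br⁻¹, T₊)`. -/
def inv (D : TreeBraidTree n) : TreeBraidTree n where
  domain := D.range
  range := D.domain
  numNodes_domain := D.numNodes_range
  numNodes_range := D.numNodes_domain
  braid := D.braid⁻¹

/-- The diagram `(A₊, br_A br_B, B₋)` made from `A = (A₊, br_A, A₋)` and `B = (B₊, br_B, B₋)`; it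
is meaningful when `A₋ = B₊`. -/
def comp (A B : TreeBraidTree n) : TreeBraidTree n where
  domain := A.domain
  range := B.range
  numNodes_domain := A.numNodes_domain
  numNodes_range := B.numNodes_range
  braid := A.braid * B.braid

/-- The diagram `(t, Id, t)`. -/
def idOn (t : BinaryTree Unit) : TreeBraidTree t.numNodes where
  domain := t
  range := t
  numNodes_domain := rfl
  numNodes_range := rfl
  braid := 1

theorem numLeaves_domain (D : TreeBraidTree n) : D.domain.numLeaves = n + 1 := by
  rw [numLeaves_eq_numNodes_succ, D.numNodes_domain]

theorem numLeaves_range (D : TreeBraidTree n) : D.range.numLeaves = n + 1 := by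
  rw [numLeaves_eq_numNodes_succ, D.numNodes_range]

theorem split_split (D : TreeBraidTree n) {i j : ℕ} (hij : i ≠ j) (hi : i < n + 1)
    (hj : j < n + 1) : (D.split i).split (skip i j) = (D.split j).split (skip j i) := by
  ext1
  · exact addCaret_addCaret _ _ _ hij (by rwa [numLeaves_domain]) (by rwa [numLeaves_domain])
  · simp only [split]
    rw [(strandEnd_split D.braid i).2, (strandEnd_split D.braid j).2]
    exact addCaret_addCaret _ _ _ (fun h => hij (strandEnd_injective _ h))
      (by rw [numLeaves_range]; exact (strandEnd_lt _ _).2 hi)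
      (by rw [numLeaves_range]; exact (strandEnd_lt _ _).2 hj)
  · exact BraidedThompson.split_split _ _ _ hij

theorem inv_split (D : TreeBraidTree n) (i : ℕ) :
    (D.split i).inv = D.inv.split (strandEnd D.braid i) := by
  ext1
  · rfl
  · simp only [split, inv]; rw [strandEnd_inv_left]
  · simp only [split, inv]; rw [split_inv]

theorem comp_split (A B : TreeBraidTree n) (i : ℕ) :
    (A.comp B).split i = (A.split i).comp (B.split (strandEnd A.braid i)) := by
  ext1
  · rfl
  · simp only [split, comp]; rw [strandEnd_mul]
  · simp only [split, comp]; rw [split_mul]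

end TreeBraidTree

/-- Tree-braid-tree diagrams with any number of carets. -/
abbrev Diagram : Type := Σ n : ℕ, TreeBraidTree n

/-- `Step D E`: the diagram `E` arises from `D` by splitting one strand; equivalently, `D` arises
from `E` by the reduction of one pair of carets. -/
def Step (D E : Diagram) : Prop := ∃ i < D.1 + 1, E = ⟨D.1 + 1, D.2.split i⟩

/-- `E` arises from `D` by finitely many splittings. -/
abbrev Expands : Diagram → Diagram → Prop := Relation.ReflTransGen Step

theorem Step.diamond {D E F : Diagram} (h1 : Step D E) (h2 : Step D F) :
    E = F ∨ ∃ i j, i ≠ j ∧ i < D.1 + 1 ∧ j < D.1 + 1 ∧ E = ⟨D.1 + 1, D.2.split i⟩ ∧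
      F = ⟨D.1 + 1, D.2.split j⟩ ∧
      Step E ⟨D.1 + 1 + 1, (D.2.split i).split (skip i j)⟩ ∧
      Step F ⟨D.1 + 1 + 1, (D.2.split i).split (skip i j)⟩ := by
  obtain ⟨i, hi, rfl⟩ := h1
  obtain ⟨j, hj, rfl⟩ := h2
  by_cases hij : i = j
  · left; rw [hij]
  · right
    refine ⟨i, j, hij, hi, hj, rfl, rfl, ⟨skip i j, ?_, rfl⟩, ⟨skip j i, ?_, ?_⟩⟩
    · show skip i j < D.1 + 1 + 1
      unfold skip; split_ifs <;> omega
    · show skip j i < D.1 + 1 + 1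
      unfold skip; split_ifs <;> omega
    · rw [D.2.split_split hij hi hj]

/-- The equivalence relation on diagrams generated by splittings and reductions. -/
def diagramSetoid : Setoid Diagram := Relation.EqvGen.setoid Step

theorem equiv_iff_join {D E : Diagram} :
    diagramSetoid.r D E ↔ ∃ F, Expands D F ∧ Expands E F := by
  have hdia : ∀ a b c, Step a b → Step a c →
      ∃ d, Relation.ReflGen Step b d ∧ Relation.ReflTransGen Step c d := by
    intro a b c h1 h2
    rcases h1.diamond h2 with rfl | ⟨i, j, _, _, _, _, _, h3, h4⟩
    · exact ⟨b, Relation.ReflGen.refl, Relation.ReflTransGen.refl⟩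
    · exact ⟨_, Relation.ReflGen.single h3, Relation.ReflTransGen.single h4⟩
  constructor
  · intro h
    have heq := Relation.equivalence_join_reflTransGen hdia
    have h' : Relation.EqvGen Step D E := h
    clear h
    induction h' with
    | rel a b hab => exact ⟨b, Relation.ReflTransGen.single hab, Relation.ReflTransGen.refl⟩
    | refl a => exact heq.refl a
    | symm a b _ ih => exact heq.symm ih
    | trans a b c _ _ ih1 ih2 => exact heq.trans ih1 ih2
  · rintro ⟨F, h1, h2⟩
    have key : ∀ {a b}, Expands a b → Relation.EqvGen Step a b := by
      intro a b h
      induction h with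
      | refl => exact Relation.EqvGen.refl _
      | tail _ hs ih => exact Relation.EqvGen.trans _ _ _ ih (Relation.EqvGen.rel _ _ hs)
    exact Relation.EqvGen.trans _ _ _ (key h1) (Relation.EqvGen.symm _ _ (key h2))

theorem Expands.isTop_range {D E : Diagram} (h : Expands D E) : IsTop D.2.range E.2.range := by
  induction h with
  | refl => exact IsTop.refl _
  | tail _ hs ih =>
    obtain ⟨i, _, rfl⟩ := hs
    exact ih.trans (isTop_addCaret _ _)

theorem exists_expands_range (D : Diagram) (s : BinaryTree Unit) (h : IsTop D.2.range s) :
    ∃ E, Expands D E ∧ E.2.range = s := by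
  induction hk : s.numNodes - D.1 generalizing D with
  | zero =>
    refine ⟨D, Relation.ReflTransGen.refl, ?_⟩
    by_contra hne
    obtain ⟨i, _, h2⟩ := exists_addCaret_isTop _ h hne
    have := h2.numNodes_le
    rw [numNodes_addCaret, D.2.numNodes_range] at this
    omega
  | succ k ih =>
    have hne : D.2.range ≠ s := by
      intro he
      have := D.2.numNodes_range
      rw [he] at this
      omega
    obtain ⟨j, hj, h2⟩ := exists_addCaret_isTop _ h hne
    rw [D.2.numLeaves_range] at hj
    obtain ⟨E, hE, hs⟩ := ih ⟨D.1 + 1, D.2.split (strandEnd D.2.braid⁻¹ j)⟩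
      (by simpa only [TreeBraidTree.split, strandEnd_inv_right] using h2) (by simp only; omega)
    exact ⟨E, Relation.ReflTransGen.head ⟨_, (strandEnd_lt _ _).2 hj, rfl⟩ hE, hs⟩

theorem Expands.eq_of_range {D E F : Diagram} (h1 : Expands D E) (h2 : Expands D F)
    (h : E.2.range = F.2.range) : E = F := by
  induction hk : E.1 - D.1 using Nat.strong_induction_on generalizing D E F with
  | _ k ih =>
    have size : ∀ {A B : Diagram}, Expands A B → A.1 ≤ B.1 := by
      intro A B hAB
      have := hAB.isTop_range.numNodes_le
      rwa [A.2.numNodes_range, B.2.numNodes_range] at this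
    have hEF : E.1 = F.1 := by rw [← E.2.numNodes_range, ← F.2.numNodes_range, h]
    rcases Relation.ReflTransGen.cases_head h1 with rfl | ⟨D1, hs1, h1'⟩
    · rcases Relation.ReflTransGen.cases_head h2 with rfl | ⟨D2, ⟨i, _, rfl⟩, h2'⟩
      · rfl
      · have := size h2'
        simp only at this
        omega
    · rcases Relation.ReflTransGen.cases_head h2 with rfl | ⟨D2, hs2, h2'⟩
      · obtain ⟨i, _, rfl⟩ := hs1
        have := size h1'
        simp only at this
        omega
      · have d1 : D1.1 = D.1 + 1 := by obtain ⟨i, _, rfl⟩ := hs1; rfl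
        have d2 : D2.1 = D.1 + 1 := by obtain ⟨i, _, rfl⟩ := hs2; rfl
        have z1 := size h1'
        have z2 := size h2'
        rcases hs1.diamond hs2 with rfl | ⟨i, j, hij, hi, hj, e1, e2, h3, h4⟩
        · exact ih (E.1 - D1.1) (by omega) h1' h2' h rfl
        · have t1 := Expands.isTop_range h1'
          have t2 := Expands.isTop_range h2'
          rw [← h] at t2
          have t3 : IsTop ((D.2.split i).split (skip i j)).range E.2.range := by
            subst e1 e2
            simp only [TreeBraidTree.split] at t1 t2 ⊢
            rw [(strandEnd_split D.2.braid i).2]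
            exact isTop_addCaret_addCaret _ (fun h => hij (strandEnd_injective _ h))
              (by rw [TreeBraidTree.numLeaves_range]; exact (strandEnd_lt _ _).2 hi)
              (by rw [TreeBraidTree.numLeaves_range]; exact (strandEnd_lt _ _).2 hj) t1 t2
          obtain ⟨G, hG, hGr⟩ := exists_expands_range
            ⟨D.1 + 1 + 1, (D.2.split i).split (skip i j)⟩ E.2.range t3
          have g1 : E = G := ih (E.1 - D1.1) (by omega) h1' (Relation.ReflTransGen.head h3 hG)
            hGr.symm rfl
          have g2 : F = G := ih (F.1 - D2.1) (by omega) h2' (Relation.ReflTransGen.head h4 hG)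
            (h.symm.trans hGr.symm) rfl
          rw [g1, g2]

/-- The inverse of a diagram. -/
def Diagram.inv (D : Diagram) : Diagram := ⟨D.1, D.2.inv⟩

theorem Diagram.inv_inv (D : Diagram) : D.inv.inv = D := by
  obtain ⟨n, D⟩ := D
  simp only [Diagram.inv, TreeBraidTree.inv]
  congr 2
  exact _root_.inv_inv D.braid

theorem Expands.inv {D E : Diagram} (h : Expands D E) : Expands D.inv E.inv := by
  induction h with
  | refl => exact Relation.ReflTransGen.refl
  | @tail B _ _ hs ih =>
    obtain ⟨i, hi, rfl⟩ := hs
    refine ih.tail ⟨strandEnd B.2.braid i, (strandEnd_lt _ _).2 hi, ?_⟩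
    simp only [Diagram.inv]
    rw [TreeBraidTree.inv_split]

theorem exists_expands_domain (D : Diagram) (s : BinaryTree Unit) (h : IsTop D.2.domain s) :
    ∃ E, Expands D E ∧ E.2.domain = s := by
  obtain ⟨E, hE, hs⟩ := exists_expands_range D.inv s h
  refine ⟨E.inv, ?_, hs⟩
  have := hE.inv
  rwa [Diagram.inv_inv] at this

theorem Expands.eq_of_domain {D E F : Diagram} (h1 : Expands D E) (h2 : Expands D F)
    (h : E.2.domain = F.2.domain) : E = F := by
  have := h1.inv.eq_of_range h2.inv h
  rw [← E.inv_inv, this, F.inv_inv]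

theorem Expands.comp {n : ℕ} {A B : TreeBraidTree n} (hAB : A.range = B.domain) {E : Diagram}
    (h : Expands ⟨n, A⟩ E) : ∃ B' : TreeBraidTree E.1, E.2.range = B'.domain ∧
      Expands ⟨n, B⟩ ⟨E.1, B'⟩ ∧ Expands ⟨n, A.comp B⟩ ⟨E.1, E.2.comp B'⟩ := by
  induction h with
  | refl => exact ⟨B, hAB, Relation.ReflTransGen.refl, Relation.ReflTransGen.refl⟩
  | @tail C _ _ hs ih =>
    obtain ⟨B', h1, h2, h3⟩ := ih
    obtain ⟨i, hi, rfl⟩ := hs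
    refine ⟨B'.split (strandEnd C.2.braid i), ?_,
      h2.tail ⟨strandEnd C.2.braid i, (strandEnd_lt _ _).2 hi, rfl⟩, h3.tail ⟨i, hi, ?_⟩⟩
    · simp only [TreeBraidTree.split, h1]
    · simp only; rw [TreeBraidTree.comp_split]

theorem comp_equiv {n m : ℕ} {A B : TreeBraidTree n} {A' B' : TreeBraidTree m}
    (hAB : A.range = B.domain) (hAB' : A'.range = B'.domain)
    (hA : diagramSetoid.r ⟨n, A⟩ ⟨m, A'⟩) (hB : diagramSetoid.r ⟨n, B⟩ ⟨m, B'⟩) :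
    diagramSetoid.r ⟨n, A.comp B⟩ ⟨m, A'.comp B'⟩ := by
  obtain ⟨F, hF, hF'⟩ := equiv_iff_join.1 hA
  obtain ⟨G, hG, hG'⟩ := equiv_iff_join.1 hB
  obtain ⟨s, hs1, hs2⟩ := exists_isTop_isTop F.2.range G.2.domain
  obtain ⟨F1, hF1, hF1s⟩ := exists_expands_range F s hs1
  obtain ⟨G1, hG1, hG1s⟩ := exists_expands_domain G s hs2
  obtain ⟨B1, hb1, hb2, hb3⟩ := Expands.comp hAB (hF.trans hF1)
  obtain ⟨B2, hc1, hc2, hc3⟩ := Expands.comp hAB' (hF'.trans hF1)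
  have e1 := Expands.eq_of_domain hb2 (hG.trans hG1) (hb1.symm.trans (hF1s.trans hG1s.symm))
  have e2 := Expands.eq_of_domain hc2 (hG'.trans hG1) (hc1.symm.trans (hF1s.trans hG1s.symm))
  have e3 : B1 = B2 := by
    have := e1.trans e2.symm
    simpa using this
  subst e3
  exact equiv_iff_join.2 ⟨_, hb3, hc3⟩

/-- The braided Thompson group: equivalence classes of tree-braid-tree diagrams. -/
def BV : Type := Quotient diagramSetoid

namespace BV

/-- The element of `BV` represented by a diagram. -/
def mk {n : ℕ} (D : TreeBraidTree n) : BV := Quotient.mk diagramSetoid ⟨n, D⟩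

theorem mk_eq_mk {n m : ℕ} {D : TreeBraidTree n} {E : TreeBraidTree m} :
    mk D = mk E ↔ diagramSetoid.r ⟨n, D⟩ ⟨m, E⟩ := Quotient.eq

theorem mk_eq_of_expands {n : ℕ} {D : TreeBraidTree n} {E : Diagram} (h : Expands ⟨n, D⟩ E) :
    mk D = mk E.2 := mk_eq_mk.2 (equiv_iff_join.2 ⟨E, h, Relation.ReflTransGen.refl⟩)

theorem exists_rep (g : BV) : ∃ (n : ℕ) (D : TreeBraidTree n), mk D = g := by
  obtain ⟨⟨n, D⟩, h⟩ := Quotient.exists_rep g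
  exact ⟨n, D, h⟩

theorem exists_rep_domain (g : BV) (t : BinaryTree Unit) :
    ∃ (n : ℕ) (D : TreeBraidTree n), mk D = g ∧ IsTop t D.domain := by
  obtain ⟨n, D, rfl⟩ := exists_rep g
  obtain ⟨s, hs1, hs2⟩ := exists_isTop_isTop t D.domain
  obtain ⟨E, hE, hEs⟩ := exists_expands_domain ⟨n, D⟩ s hs2
  exact ⟨E.1, E.2, (mk_eq_of_expands hE).symm, by rwa [hEs]⟩

/-- Any two elements have diagrams in which the range tree of the first is the domain tree of the
second. -/
theorem exists_composable (g h : BV) : ∃ (n : ℕ) (A B : TreeBraidTree n),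
    mk A = g ∧ mk B = h ∧ A.range = B.domain := by
  obtain ⟨n, A, rfl⟩ := exists_rep g
  obtain ⟨m, B, hB, ht⟩ := exists_rep_domain h A.range
  obtain ⟨E, hE, hEs⟩ := exists_expands_range ⟨n, A⟩ B.domain ht
  obtain ⟨k, E⟩ := E
  simp only at hEs
  have : k = m := by rw [← E.numNodes_range, ← B.numNodes_domain, hEs]
  subst this
  exact ⟨k, E, B, (mk_eq_of_expands hE).symm, hB, hEs⟩

/-- The product of `g` and `h` is represented by `(A₊, br_A br_B, B₋)` for diagrams
`(A₊, br_A, A₋)` of `g` and `(B₊, br_B, B₋)` of `h` with `A₋ = B₊`; by `mk_mul_mk` the choice of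
the diagrams does not matter. -/
noncomputable instance : Mul BV where
  mul g h :=
    mk ((exists_composable g h).choose_spec.choose.comp
      (exists_composable g h).choose_spec.choose_spec.choose)

theorem mk_mul_mk {n : ℕ} {A B : TreeBraidTree n} (h : A.range = B.domain) :
    mk A * mk B = mk (A.comp B) := by
  obtain ⟨h1, h2, h3⟩ := (exists_composable (mk A) (mk B)).choose_spec.choose_spec.choose_spec
  exact mk_eq_mk.2 (comp_equiv h3 h (mk_eq_mk.1 h1) (mk_eq_mk.1 h2))

/-- The identity, represented by the diagram without carets. -/
instance : One BV := ⟨mk (TreeBraidTree.idOn .nil)⟩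

theorem mk_idOn (t : BinaryTree Unit) : mk (TreeBraidTree.idOn t) = 1 := by
  obtain ⟨E, hE, hEs⟩ := exists_expands_range ⟨0, TreeBraidTree.idOn .nil⟩ t trivial
  have key : ∀ {E : Diagram}, Expands ⟨0, TreeBraidTree.idOn .nil⟩ E →
      E.2.domain = E.2.range ∧ E.2.braid = 1 := by
    intro E h
    induction h with
    | refl => exact ⟨rfl, rfl⟩
    | tail _ hs ih =>
      obtain ⟨i, hi, rfl⟩ := hs
      simp only [TreeBraidTree.split, ih.2, strandEnd_one, split_one, ih.1, and_self]
  obtain ⟨h1, h2⟩ := key hE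
  refine (Eq.trans (mk_eq_of_expands hE) ?_).symm
  subst hEs
  obtain ⟨k, E⟩ := E
  have hk : k = E.range.numNodes := E.numNodes_range.symm
  obtain ⟨d, r, hd, hr, b⟩ := E
  simp only at h1 hk ⊢
  change b = 1 at h2
  subst h1 h2 hk
  rfl

theorem mk_eq_one {n : ℕ} {D : TreeBraidTree n} (h1 : D.domain = D.range) (h2 : D.braid = 1) :
    mk D = 1 := by
  obtain ⟨d, r, hd, hr, b⟩ := D
  simp only at h1 h2
  subst h1 h2 hd
  exact mk_idOn d

/-- The inverse is represented by the inverse diagram. -/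
instance : Inv BV where
  inv := Quotient.map (sa := diagramSetoid) (sb := diagramSetoid) Diagram.inv (by
    intro D E h
    obtain ⟨F, h1, h2⟩ := equiv_iff_join.1 h
    exact equiv_iff_join.2 ⟨F.inv, h1.inv, h2.inv⟩)

theorem inv_mk {n : ℕ} (D : TreeBraidTree n) : (mk D)⁻¹ = mk D.inv := rfl

noncomputable instance : Group BV :=
  Group.ofLeftAxioms
    (by
      intro a b c
      obtain ⟨n, A, B, rfl, rfl, hAB⟩ := exists_composable a b
      obtain ⟨m, C, rfl, hC⟩ := exists_rep_domain c B.range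
      obtain ⟨⟨k, B1⟩, hB1, hB1s⟩ := exists_expands_range ⟨n, B⟩ C.domain hC
      simp only at hB1s
      have hkm : k = m := by rw [← B1.numNodes_range, ← C.numNodes_domain, hB1s]
      subst hkm
      have ht : IsTop A.range B1.domain := by
        rw [hAB]; exact hB1.inv.isTop_range
      obtain ⟨⟨l, A1⟩, hA1, hA1s⟩ := exists_expands_range ⟨n, A⟩ B1.domain ht
      simp only at hA1s
      have hlk : l = k := by rw [← A1.numNodes_range, ← B1.numNodes_domain, hA1s]
      subst hlk
      rw [mk_eq_of_expands hA1, mk_eq_of_expands hB1, mk_mul_mk hA1s, mk_mul_mk hB1s,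
        mk_mul_mk (A := A1.comp B1) (B := C) hB1s, mk_mul_mk (A := A1) (B := B1.comp C) hA1s]
      simp only [TreeBraidTree.comp, mul_assoc])
    (by
      intro a
      obtain ⟨n, D, rfl⟩ := exists_rep a
      have h := mk_idOn D.domain
      obtain ⟨d, r, hd, hr, b⟩ := D
      subst hd
      rw [← h, mk_mul_mk rfl]
      simp [TreeBraidTree.comp, TreeBraidTree.idOn])
    (by
      intro a
      obtain ⟨n, D, rfl⟩ := exists_rep a
      rw [inv_mk, mk_mul_mk rfl]
      exact mk_eq_one rfl (inv_mul_cancel _))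

/-- Every element has a diagram with the least possible number of carets. -/
theorem exists_reduced (g : BV) :
    ∃ D : Diagram, mk D.2 = g ∧ ∀ E : Diagram, mk E.2 = g → D.1 ≤ E.1 := by
  classical
  have h : ∃ n, ∃ D : TreeBraidTree n, mk D = g := exists_rep g
  obtain ⟨D, hD⟩ := Nat.find_spec h
  exact ⟨⟨_, D⟩, hD, fun E hE => Nat.find_min' h ⟨E.2, hE⟩⟩

/-- The reduced diagram `(T₊(g), br, T₋(g))` of `g`: its representative with the least number of
carets. -/
noncomputable def reduced (g : BV) : Diagram := (exists_reduced g).choose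

/-- `N(g)`: the number of carets of each of the trees of the reduced diagram of `g`. -/
noncomputable def numCarets (g : BV) : ℕ := (reduced g).1

end BV

/-- The all-right tree with `n` carets. -/
def allRight : ℕ → BinaryTree Unit
  | 0 => .nil
  | n + 1 => .node () .nil (allRight n)

/-- The letters `x₀, x₁, σ₁, τ₁`. -/
inductive Letter
  | x₀
  | x₁
  | σ₁
  | τ₁

/-- The generators of `BV` denoted by the letters. -/
def Letter.toBV : Letter → BV
  | .x₀ => BV.mk (n := 2) ⟨.node () (.node () .nil .nil) .nil, allRight 2, rfl, rfl, 1⟩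
  | .x₁ => BV.mk (n := 3)
      ⟨.node () .nil (.node () (.node () .nil .nil) .nil), allRight 3, rfl, rfl, 1⟩
  | .σ₁ => BV.mk (n := 2) ⟨allRight 2, allRight 2, rfl, rfl, artin 3 0⟩
  | .τ₁ => BV.mk (n := 1) ⟨allRight 1, allRight 1, rfl, rfl, artin 2 0⟩

/-- The standard generating set `X = {x₀, x₁, σ₁, τ₁}` of `BV`. -/
def X : Set BV := Set.range Letter.toBV

/-- Words over `X ∪ X⁻¹`: the pair `(a, true)` is the letter `a`, and `(a, false)` is `a⁻¹`. -/
abbrev Word : Type := List (Letter × Bool)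

/-- The element of `BV` that a word represents. -/
noncomputable def Word.eval (w : Word) : BV :=
  (w.map fun a => if a.2 then a.1.toBV else a.1.toBV⁻¹).prod

/-- The word length `|g|` of `g` with respect to `X`. -/
noncomputable def wordLength (g : BV) : ℕ :=
  sInf {k | ∃ w : Word, w.eval = g ∧ w.length = k}

/-- `w` is a word of minimal length among those that represent `g`. -/
def IsMinimalWord (w : Word) (g : BV) : Prop := w.eval = g ∧ w.length = wordLength g

/-- The binary words labelling the paths from the root to the leaves of a tree, where left edges
are labelled `0 = false` and right edges `1 = true`. -/
def branches : BinaryTree Unit → List (List Bool)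
  | .nil => [[]]
  | .node _ l r => (branches l).map (false :: ·) ++ (branches r).map (true :: ·)

/-- The word `x₀² x₁⁻¹ x₀⁻¹` if `0` is a branch of `T₋(g)`, and the empty word otherwise. -/
noncomputable def firstWord (g : BV) : Word :=
  if [false] ∈ branches (BV.reduced g).2.range then
    [(.x₀, true), (.x₀, true), (.x₁, false), (.x₀, false)]
  else []

/-- The word `x₀^{-M(N(g)+1)} x₁ x₀^{M(N(g)+1)}`. -/
noncomputable def secondWord (M : ℕ) (g : BV) : Word :=
  List.replicate (M * (g.numCarets + 1)) (.x₀, false) ++ [(.x₁, true)] ++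
    List.replicate (M * (g.numCarets + 1)) (.x₀, true)

/-- The braid `σ_{k-1} ⋯ σ_1 σ_0` on `m` strands (trivial for `k = 0`): the strand number `k` passes
over the strands `k-1, …, 0`, in this order, to position `0`, and there are no other crossings. -/
def pullBraid (m k : ℕ) : BraidGroup m := ((List.range k).reverse.map (artin m)).prod

/-- The element represented by `(T₋(g), pullBraid k, T₊(g))`, where the strand of the braid of `g`
that starts at the leaf number `0` of `T₊(g)` ends at the leaf number `k` of `T₋(g)`. -/
noncomputable def connector (g : BV) : BV :=
  BV.mk (n := (BV.reduced g).1)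
    { domain := (BV.reduced g).2.range
      range := (BV.reduced g).2.domain
      numNodes_domain := (BV.reduced g).2.numNodes_range
      numNodes_range := (BV.reduced g).2.numNodes_domain
      braid := pullBraid _ (strandEnd (BV.reduced g).2.braid 0) }

/-- The word `x₀^L x₁⁻¹ x₀^{-L+1}`, for `L ≥ 1`. -/
def terminalWord (L : ℕ) : Word :=
  List.replicate L (.x₀, true) ++ [(.x₁, false)] ++ List.replicate (L - 1) (.x₀, false)

/-- The element `x₀^L x₁⁻¹ x₀^{-L+1}` of `BV`. -/
noncomputable def terminal (L : ℕ) : BV :=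
  Letter.x₀.toBV ^ L * Letter.x₁.toBV⁻¹ * Letter.x₀.toBV ^ (-(L : ℤ) + 1)

end BraidedThompson

namespace BraidedThompson

open BinaryTree

/-! The element v acts as x₀ on the cone of words that begin with 0^(Q|g|-1) and is trivial
elsewhere. It therefore commutes with every element that carries a much larger cone 0^a to itself
with all strands over it parallel. The words w₁, w₂, w₃ turn g into such an element g₃ at a cost
linear in |g|; then w₄ multiplies by v, and w₅ cancels g₃ because g₃ v g₃⁻¹ = v.

The path has to stay away from the identity although |g| is not controlled by N(g), the braid being
arbitrary. Two lower bounds are combined: N(h) ≤ 3|h| (`numCarets_le_wordLength`) and |h| ≤ |hw| +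
‖w‖ (`wordLength_le_mul_eval`). Since w₂ and w₃ have length O(N(g₁)), it is enough that |g₁w| ≥ c
N(g₁) for each prefix w of w₂w₃: then |g₁| ≤ |g₁w| + ‖w‖ ≤ C|g₁w|. Powers of x₀⁻¹ lose no carets
once 0 is not a branch of T₋, which w₁ arranges; behind the letter x₁ of w₂ there are more than
(M-1)N(g₁) carets; and w₃ is too short to undo this. Along w₄ the power x₀^m forces m carets, which
balances the loss |g₃| - m, and behind its letter x₁⁻¹ there are at least Q|g| carets, too many for
w₅, of length |g₃| = O(|g|), to remove.

Carets are counted by means of the prefix replacement `BV.Maps`: if two subcones of the cone at u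
are stretched unequally, then u is an inner vertex of the domain tree, so N exceeds the length of u
(`BV.length_lt_numCarets`). This rests on the fact that every diagram is a splitting of the reduced
one (`BV.expands_reduced`), that is, on the confluence of reductions, for which deletion of strands
serves as a left inverse of splitting. The upper bounds on lengths are `close_of_numNodes_eq` for
Thompson's group F and `lengthLE_pullBraid` for the braid in w₃. -/

/-! ### Deleting a strand of a braid -/

/-- The braid obtained from `σ_k` by deleting the strand that starts in position `i`; by convention
`1` if there is no such strand. -/
def deleteArtin (m k i : ℕ) : BraidGroup m :=
  -- For `i > m` the value `artin m k` would not do: `artin m (m - 1)` is `1` by convention, so the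
  -- braid relation between `k = m - 2` and `m - 1` would fail.
  if m < i then 1
  else if i < k then artin m (k - 1)
  else if i ≤ k + 1 then 1
  else artin m k

theorem deleteArtin_of_lt {m k i : ℕ} (h : i < k) (hi : i ≤ m) :
    deleteArtin m k i = artin m (k - 1) := by
  rw [deleteArtin, if_neg (by omega), if_pos h]

theorem deleteArtin_of_mem (m : ℕ) {k i : ℕ} (h : k ≤ i) (h' : i ≤ k + 1) :
    deleteArtin m k i = 1 := by
  rw [deleteArtin]
  split_ifs <;> first | rfl | omega

theorem deleteArtin_of_gt {m k i : ℕ} (h : k + 1 < i) (hi : i ≤ m) :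
    deleteArtin m k i = artin m k := by
  rw [deleteArtin, if_neg (by omega), if_neg (by omega), if_neg (by omega)]

theorem deleteArtin_of_out {m k i : ℕ} (hi : m < i) : deleteArtin m k i = 1 := if_pos hi

/-- The value on `σ_k` of the homomorphism that records the underlying permutation of a braid
together with all its deletions of a strand. -/
def deleteGen (m k : ℕ) : (ℕ → BraidGroup m) ⋊[mulAutArrow] Equiv.Perm ℕ :=
  ⟨deleteArtin m k, Equiv.swap k (k + 1)⟩

theorem deleteGen_comm {m k l : ℕ} (h : k + 2 ≤ l) (hl : l < m) :
    deleteGen m k * deleteGen m l = deleteGen m l * deleteGen m k := by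
  refine SemidirectProduct.ext (funext fun i => ?_) (swap_far h)
  change deleteArtin m k i * deleteArtin m l (Equiv.swap k (k + 1) i) =
    deleteArtin m l i * deleteArtin m k (Equiv.swap l (l + 1) i)
  rw [Equiv.swap_apply_def, Equiv.swap_apply_def]
  have e1 : artin m k * artin m l = artin m l * artin m k := artin_comm h
  -- After a deletion between the two crossings their indices are `k` and `l - 1`. These are
  -- adjacent if `l = k + 2`, but then no strand lies strictly between them.
  have e2 : artin m k * artin m (l - 1) = artin m (l - 1) * artin m k ∨ l = k + 2 := by
    rcases (by omega : l = k + 2 ∨ k + 2 ≤ l - 1) with h | h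
    · exact Or.inr h
    · exact Or.inl (artin_comm h)
  have e3 : artin m (k - 1) * artin m (l - 1) = artin m (l - 1) * artin m (k - 1) ∨ k = 0 := by
    rcases (by omega : k = 0 ∨ k - 1 + 2 ≤ l - 1) with h | h
    · exact Or.inr h
    · exact Or.inl (artin_comm h)
  rcases (by omega : i < k ∨ i = k ∨ i = k + 1 ∨ (k + 1 < i ∧ i < l) ∨ i = l ∨ i = l + 1 ∨
    l + 1 < i) with hi | rfl | rfl | ⟨hi, hi2⟩ | rfl | rfl | hi
  · simp (disch := omega) only [if_neg, deleteArtin_of_lt]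
    exact e3.resolve_right (by omega)
  · simp (disch := omega) only [if_neg, if_true, deleteArtin_of_lt, deleteArtin_of_mem, one_mul,
      mul_one]
  · simp (disch := omega) only [if_neg, if_true, deleteArtin_of_lt, deleteArtin_of_mem, one_mul,
      mul_one]
  · simp (disch := omega) only [if_neg, deleteArtin_of_lt, deleteArtin_of_gt]
    exact e2.resolve_right (by omega)
  · simp (disch := omega) only [if_neg, if_true, deleteArtin_of_gt, deleteArtin_of_mem, one_mul,
      mul_one]
  · simp (disch := omega) only [if_neg, if_true, deleteArtin_of_gt, deleteArtin_of_mem, one_mul,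
      mul_one]
  · rcases lt_or_ge m i with hm | hm
    · simp (disch := omega) only [if_neg, deleteArtin_of_out]
    · simp (disch := omega) only [if_neg, deleteArtin_of_gt]
      exact e1

/-- If the deleted strand is one of the three that cross, a single crossing `artin m k` remains on
both sides. Otherwise the relation is a braid relation on the remaining strands. -/
theorem deleteGen_braid {m k : ℕ} (h : k + 1 < m) :
    deleteGen m k * deleteGen m (k + 1) * deleteGen m k =
      deleteGen m (k + 1) * deleteGen m k * deleteGen m (k + 1) := by
  refine SemidirectProduct.ext (funext fun i => ?_) (swap_near k)
  change deleteArtin m k i * deleteArtin m (k + 1) (Equiv.swap k (k + 1) i) *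
      deleteArtin m k (Equiv.swap (k + 1) (k + 1 + 1) (Equiv.swap k (k + 1) i)) =
    deleteArtin m (k + 1) i * deleteArtin m k (Equiv.swap (k + 1) (k + 1 + 1) i) *
      deleteArtin m (k + 1) (Equiv.swap k (k + 1) (Equiv.swap (k + 1) (k + 1 + 1) i))
  simp only [Equiv.swap_apply_def]
  rcases (by omega : i < k ∨ i = k ∨ i = k + 1 ∨ i = k + 1 + 1 ∨ k + 1 + 1 < i) with
    hi | rfl | rfl | rfl | hi
  · simp (disch := omega) only [if_neg, deleteArtin_of_lt]
    obtain ⟨k, rfl⟩ : ∃ l, k = l + 1 := ⟨k - 1, by omega⟩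
    exact artin_braid (by omega)
  · simp (disch := omega) only [if_neg, if_true, deleteArtin_of_lt, deleteArtin_of_mem,
      deleteArtin_of_gt, one_mul, mul_one, Nat.add_sub_cancel]
  · simp (disch := omega) only [if_neg, if_true, deleteArtin_of_lt, deleteArtin_of_mem,
      deleteArtin_of_gt, one_mul, mul_one, Nat.add_sub_cancel]
  · simp (disch := omega) only [if_neg, if_true, deleteArtin_of_lt, deleteArtin_of_mem,
      deleteArtin_of_gt, one_mul, mul_one, Nat.add_sub_cancel]
  · rcases lt_or_ge m i with hm | hm
    · simp (disch := omega) only [if_neg, deleteArtin_of_out]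
    · simp (disch := omega) only [if_neg, deleteArtin_of_gt]
      exact artin_braid (by omega)

/-- The homomorphism sending a braid to its deletions of a strand and its underlying
permutation. -/
def deleteHom (m : ℕ) : BraidGroup (m + 1) →* (ℕ → BraidGroup m) ⋊[mulAutArrow] Equiv.Perm ℕ :=
  PresentedGroup.toGroup (f := fun k => deleteGen m k.1) (by
    rintro r (⟨k, l, h, rfl⟩ | ⟨k, l, h, rfl⟩)
    · simp only [map_mul, map_inv, FreeGroup.lift_apply_of]
      rw [deleteGen_comm h (by have := l.2; omega), mul_inv_cancel]
    · simp only [map_mul, map_inv, FreeGroup.lift_apply_of, ← h]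
      rw [deleteGen_braid (by have := l.2; omega), mul_inv_cancel])

/-- The braid obtained from `b` by deleting the strand that starts in position `i`. -/
def delete {m : ℕ} (b : BraidGroup (m + 1)) (i : ℕ) : BraidGroup m := (deleteHom m b).left i

theorem deleteHom_artin {m k : ℕ} (h : k < m) :
    deleteHom m (artin (m + 1) k) = deleteGen m k := by
  rw [artin, dif_pos (by omega)]
  exact PresentedGroup.toGroup.of _

theorem deleteHom_right {m : ℕ} (b : BraidGroup (m + 1)) :
    (deleteHom m b).right = (splitHom (m + 1) b).right := by
  induction b using braid_induction with
  | one => simp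
  | gen k hk => rw [deleteHom_artin (by omega), splitHom_artin hk]; rfl
  | mul b c hb hc => simp [hb, hc]
  | inv b hb => simp [hb]

theorem delete_one {m : ℕ} (i : ℕ) : delete (1 : BraidGroup (m + 1)) i = 1 := by
  simp [delete]

theorem delete_mul {m : ℕ} (b c : BraidGroup (m + 1)) (i : ℕ) :
    delete (b * c) i = delete b i * delete c (strandEnd b i) := by
  simp only [delete, strandEnd, map_mul, SemidirectProduct.mul_left, ← deleteHom_right]
  rfl

theorem delete_inv {m : ℕ} (b : BraidGroup (m + 1)) (i : ℕ) :
    delete b⁻¹ (strandEnd b i) = (delete b i)⁻¹ := by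
  have h := delete_mul b b⁻¹ i
  rw [mul_inv_cancel, delete_one] at h
  exact eq_inv_of_mul_eq_one_right h.symm

theorem delete_artin {m k : ℕ} (h : k < m) (i : ℕ) :
    delete (artin (m + 1) k) i = deleteArtin m k i := by
  rw [delete, deleteHom_artin h, deleteGen]

/-- Deleting one of the two parallel strands undoes a splitting. -/
theorem delete_split_self {m : ℕ} (b : BraidGroup m) :
    ∀ i < m, delete (split b i) (i + 1) = b := by
  induction b using braid_induction with
  | one => intro i _; rw [split_one, delete_one]
  | gen k hk =>
    intro i hi
    rw [split_artin hk]
    rcases (by omega : i < k ∨ i = k ∨ i = k + 1 ∨ k + 1 < i) with h | rfl | rfl | h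
    · rw [splitArtin_of_lt h, delete_artin (by omega)]
      rw [deleteArtin_of_lt (by omega) (by omega), Nat.add_sub_cancel]
    · rw [splitArtin_self, delete_mul, delete_artin (by omega), delete_artin (by omega),
        strandEnd_artin (by omega)]
      simp (disch := omega) only [if_neg, if_true, deleteArtin_of_mem, deleteArtin_of_gt, one_mul]
    · rw [splitArtin_succ, delete_mul, delete_artin (by omega), delete_artin (by omega),
        strandEnd_artin (by omega)]
      simp (disch := omega) only [if_neg, deleteArtin_of_mem, deleteArtin_of_gt, mul_one]
    · rw [splitArtin_of_gt h, delete_artin (by omega), deleteArtin_of_gt (by omega) (by omega)]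
  | mul b c hb hc =>
    intro i hi
    rw [split_mul, delete_mul, hb i hi, (strandEnd_split b i).1, hc _ ((strandEnd_lt _ _).2 hi)]
  | inv b hb =>
    intro i hi
    have hj : strandEnd b⁻¹ i < m := (strandEnd_lt _ _).2 hi
    have h1 := split_inv b (strandEnd b⁻¹ i)
    have h2 := delete_inv (split b (strandEnd b⁻¹ i)) (strandEnd b⁻¹ i + 1)
    rw [(strandEnd_split b _).1, hb _ hj] at h2
    rw [strandEnd_inv_right] at h1 h2
    rw [h1, h2]

/-- The position after the deletion in position `i` of the object that was in position `j`. -/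
def drop (i j : ℕ) : ℕ := if j ≤ i then j else j - 1

theorem strandEnd_delete {m : ℕ} (b : BraidGroup (m + 1)) : ∀ i j, i ≤ m → j ≠ i →
    strandEnd (delete b i) (drop i j) = drop (strandEnd b i) (strandEnd b j) := by
  induction b using braid_induction with
  | one => intro i j _ _; rw [delete_one, strandEnd_one, strandEnd_one, strandEnd_one]
  | gen k hk =>
    intro i j hi hj
    rw [delete_artin (by omega), strandEnd_artin hk, strandEnd_artin hk, drop, drop]
    rcases (by omega : i < k ∨ (k ≤ i ∧ i ≤ k + 1) ∨ k + 1 < i) with h | h | h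
    · rw [deleteArtin_of_lt h hi, strandEnd_artin (by omega)]
      split_ifs <;> omega
    · rw [deleteArtin_of_mem m h.1 h.2, strandEnd_one]
      split_ifs <;> omega
    · rw [deleteArtin_of_gt h hi, strandEnd_artin (by omega)]
      split_ifs <;> omega
  | mul b c hb hc =>
    intro i j hi hj
    have h1 : strandEnd b i ≤ m := by have := (strandEnd_lt b i).2 (by omega); omega
    rw [delete_mul, strandEnd_mul, strandEnd_mul, strandEnd_mul, hb i j hi hj,
      hc _ _ h1 fun h => hj (strandEnd_injective b h)]
  | inv b hb =>
    intro i j hi hj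
    have h1 : strandEnd b⁻¹ i ≤ m := by have := (strandEnd_lt b⁻¹ i).2 (by omega); omega
    have h2 := hb _ _ h1 (fun h => hj (strandEnd_injective b⁻¹ h))
    have h3 := delete_inv b (strandEnd b⁻¹ i)
    rw [strandEnd_inv_right] at h2 h3
    rw [strandEnd_inv_right] at h2
    rw [h3, ← h2, strandEnd_inv_left]

theorem splitArtin_of_eq (m : ℕ) {k i : ℕ} (h : i = k) :
    splitArtin m k i = artin (m + 1) (k + 1) * artin (m + 1) k := by
  rw [h, splitArtin_self]

theorem splitArtin_of_eq_succ (m : ℕ) {k i : ℕ} (h : i = k + 1) :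
    splitArtin m k i = artin (m + 1) k * artin (m + 1) (k + 1) := by
  rw [h, splitArtin_succ]

/-- Splitting a strand commutes with the deletion of another one. -/
theorem delete_split {m : ℕ} (b : BraidGroup (m + 1)) : ∀ i j, i ≤ m → j ≤ m → j ≠ i →
    delete (split b j) (skip j i) = split (delete b i) (drop i j) := by
  induction b using braid_induction with
  | one => intro i j _ _ _; rw [split_one, delete_one, delete_one, split_one]
  | gen k hk =>
    intro i j hi hj hij
    have d1 := fun i => delete_artin (m := m + 1) (k := k) (by omega) i
    have d2 := fun i => delete_artin (m := m + 1) (k := k + 1) (by omega) i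
    have t1 := fun i => strandEnd_artin (m := m + 1 + 1) (k := k) (by omega) i
    have t2 := fun i => strandEnd_artin (m := m + 1 + 1) (k := k + 1) (by omega) i
    rw [delete_artin (by omega), split_artin hk, skip, drop]
    -- The claim for a generator depends only on the places of `i` and `j` relative to the crossing
    -- and to each other; both sides are computed in each configuration.
    rcases (by omega : j < k ∨ j = k ∨ j = k + 1 ∨ k + 1 < j) with h | h | h | h <;>
    rcases (by omega : i < k ∨ i = k ∨ i = k + 1 ∨ k + 1 < i) with h' | h' | h' | h' <;>
    rcases (by omega : i < j ∨ j < i) with g | g <;>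
    first
    | omega
    | (simp (disch := omega) only [splitArtin_of_lt, splitArtin_of_eq, splitArtin_of_eq_succ,
        splitArtin_of_gt, delete_mul, d1, d2, t1, t2, if_pos, if_neg, deleteArtin_of_lt,
        deleteArtin_of_mem, deleteArtin_of_gt, split_one, mul_one, split_artin,
        Nat.add_sub_cancel, Nat.sub_add_cancel])
  | mul b c hb hc =>
    intro i j hi hj hij
    have h1 : strandEnd b i ≤ m := by have := (strandEnd_lt b i).2 (by omega); omega
    have h2 : strandEnd b j ≤ m := by have := (strandEnd_lt b j).2 (by omega); omega
    rw [split_mul, delete_mul, delete_mul, split_mul, hb i j hi hj hij, (strandEnd_split b j).2,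
      strandEnd_delete b i j hi hij, hc _ _ h1 h2 fun h => hij (strandEnd_injective b h)]
  | inv b hb =>
    intro i j hi hj hij
    have h1 : strandEnd b⁻¹ i ≤ m := by have := (strandEnd_lt b⁻¹ i).2 (by omega); omega
    have h2 : strandEnd b⁻¹ j ≤ m := by have := (strandEnd_lt b⁻¹ j).2 (by omega); omega
    have hne : strandEnd b⁻¹ j ≠ strandEnd b⁻¹ i := fun h => hij (strandEnd_injective b⁻¹ h)
    have h3 := hb _ _ h1 h2 hne
    have h4 := split_inv b (strandEnd b⁻¹ j)
    have h5 := delete_inv b (strandEnd b⁻¹ i)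
    have h6 := delete_inv (split b (strandEnd b⁻¹ j)) (skip (strandEnd b⁻¹ j) (strandEnd b⁻¹ i))
    have h7 := split_inv (delete b (strandEnd b⁻¹ i)) (drop (strandEnd b⁻¹ i) (strandEnd b⁻¹ j))
    rw [(strandEnd_split b _).2] at h6
    rw [strandEnd_delete b _ _ h1 hne] at h7
    simp only [strandEnd_inv_right] at h4 h5 h6 h7
    rw [h4, h5, h6, h7, h3]

/-! ### Confluence of reductions and uniqueness of the reduced diagram -/

theorem addCaret_injective (t : BinaryTree Unit) : ∀ {s i}, i < t.numLeaves → i < s.numLeaves →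
    addCaret t i = addCaret s i → t = s := by
  induction t with
  | nil =>
    intro s i _ _ h
    have h1 := congrArg numNodes h
    rw [numNodes_addCaret, numNodes_addCaret] at h1
    cases s with
    | nil => rfl
    | node v l r => simp only [numNodes] at h1; omega
  | node v l r hl hr =>
    intro s i h1 h2 h
    cases s with
    | nil =>
      have h1 := congrArg numNodes h
      rw [numNodes_addCaret, numNodes_addCaret] at h1
      simp only [numNodes] at h1; omega
    | node w l' r' =>
      simp only [numLeaves] at h1 h2
      simp only [addCaret] at h
      split_ifs at h with h3 h4 h4
      · obtain ⟨-, e1, e2⟩ := BinaryTree.node.inj h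
        rw [hl h3 h4 e1, e2]
      · obtain ⟨-, e1, e2⟩ := BinaryTree.node.inj h
        have := congrArg numLeaves e1
        rw [numLeaves_addCaret] at this
        omega
      · obtain ⟨-, e1, e2⟩ := BinaryTree.node.inj h
        have := congrArg numLeaves e1
        rw [numLeaves_addCaret] at this
        omega
      · obtain ⟨-, e1, e2⟩ := BinaryTree.node.inj h
        subst e1
        rw [hr (by omega) (by omega) e2]

/-- Different exposed carets of a tree have no leaf in common, whereas the pairs of leaves `i, i+1`
and `i+1, i+2` overlap. -/
theorem addCaret_ne_addCaret_succ (t : BinaryTree Unit) : ∀ {s i}, i < t.numLeaves →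
    i + 1 < s.numLeaves → addCaret t i ≠ addCaret s (i + 1) := by
  induction t with
  | nil =>
    intro s i _ h2 h
    have h1 := congrArg numLeaves h
    rw [numLeaves_addCaret, numLeaves_addCaret] at h1
    simp only [numLeaves] at h1
    omega
  | node v l r hl hr =>
    intro s i h1 h2 h
    cases s with
    | nil => simp only [numLeaves] at h2; omega
    | node w l' r' =>
      simp only [numLeaves] at h1 h2
      simp only [addCaret] at h
      split_ifs at h with h3 h4 h4
      · exact hl h3 h4 (BinaryTree.node.inj h).2.1
      · have := congrArg numLeaves (BinaryTree.node.inj h).2.1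
        rw [numLeaves_addCaret] at this
        omega
      · have := congrArg numLeaves (BinaryTree.node.inj h).2.1
        rw [numLeaves_addCaret] at this
        omega
      · obtain ⟨-, e1, e2⟩ := BinaryTree.node.inj h
        subst e1
        rw [show i + 1 - l.numLeaves = i - l.numLeaves + 1 by omega] at e2
        exact hr (by omega) (by omega) e2

/-- The common tree has exposed carets at the leaves `x, x+1` and `y+1, y+2`, and `u` is what
remains when both are removed. Carets in the same subtree of the root are handled by recursion;
otherwise `u` takes one subtree from `t` and the other from `s`. -/
theorem exists_addCaret_addCaret_of_lt (t : BinaryTree Unit) : ∀ {s x y}, x < y →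
    y + 1 < t.numLeaves → addCaret t x = addCaret s (y + 1) →
    ∃ u, t = addCaret u y ∧ s = addCaret u x := by
  induction t with
  | nil => intro s x y _ h; simp only [numLeaves] at h; omega
  | node v l r hl hr =>
    intro s x y hxy hy h
    have hn := congrArg numLeaves h
    rw [numLeaves_addCaret, numLeaves_addCaret] at hn
    cases s with
    | nil => rw [numLeaves] at hn; rw [numLeaves] at hn hy; omega
    | node w l' r' =>
      simp only [numLeaves] at hy hn
      simp only [addCaret] at h
      split_ifs at h with h3 h4 h4
      · obtain ⟨-, e1, e2⟩ := BinaryTree.node.inj h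
        have := congrArg numLeaves e1
        rw [numLeaves_addCaret, numLeaves_addCaret] at this
        obtain ⟨u, hu1, hu2⟩ := hl hxy (by omega) e1
        have hu3 := congrArg numLeaves hu1
        rw [numLeaves_addCaret] at hu3
        refine ⟨.node () u r, ?_, ?_⟩
        · rw [addCaret, if_pos (by omega), ← hu1]
        · rw [addCaret, if_pos (by omega), ← hu2, e2]
      · obtain ⟨-, e1, e2⟩ := BinaryTree.node.inj h
        have := congrArg numLeaves e1
        rw [numLeaves_addCaret] at this
        refine ⟨.node () l r', ?_, ?_⟩
        · rw [addCaret, if_neg (by omega), e2, show y + 1 - l'.numLeaves = y - l.numLeaves by omega]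
        · rw [addCaret, if_pos h3, ← e1]
      · have := congrArg numLeaves (BinaryTree.node.inj h).2.1
        rw [numLeaves_addCaret] at this
        omega
      · obtain ⟨-, e1, e2⟩ := BinaryTree.node.inj h
        subst e1
        rw [show y + 1 - l.numLeaves = y - l.numLeaves + 1 by omega] at e2
        obtain ⟨u, hu1, hu2⟩ := hr (by omega) (by omega) e2
        refine ⟨.node () l u, ?_, ?_⟩
        · rw [addCaret, if_neg (by omega), ← hu1]
        · rw [addCaret, if_neg (by omega), ← hu2]

/-- If two carets can be removed from a tree, then they can be removed together. -/
theorem exists_addCaret_addCaret {t s : BinaryTree Unit} {x y : ℕ} (hxy : x ≠ y)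
    (hx : x + 1 < t.numLeaves) (hy : y + 1 < t.numLeaves)
    (h : addCaret t (skip y x) = addCaret s (skip x y)) :
    ∃ u, t = addCaret u y ∧ s = addCaret u x := by
  have hn := congrArg numLeaves h
  rw [numLeaves_addCaret, numLeaves_addCaret] at hn
  rcases lt_or_gt_of_ne hxy with g | g
  · rw [skip, skip, if_pos (by omega), if_neg (by omega)] at h
    exact exists_addCaret_addCaret_of_lt t g hy h
  · rw [skip, skip, if_neg (by omega), if_pos (by omega)] at h
    obtain ⟨u, h1, h2⟩ := exists_addCaret_addCaret_of_lt s g (by omega) h.symm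
    exact ⟨u, h2, h1⟩

/-- The braid is recovered by deleting one of the two copies of the split strand; then the leaf of
the range tree that got the caret is known as well. -/
theorem eq_of_split_eq_split {n : ℕ} {A B : TreeBraidTree n} {i : ℕ} (hi : i < n + 1)
    (h : A.split i = B.split i) : A = B := by
  have hb : A.braid = B.braid := by
    have := congrArg (fun D => delete (TreeBraidTree.braid D) (i + 1)) h
    simpa only [TreeBraidTree.split, delete_split_self _ _ hi] using this
  have hr := congrArg TreeBraidTree.range h
  simp only [TreeBraidTree.split, hb] at hr
  have hj : strandEnd B.braid i < n + 1 := (strandEnd_lt _ _).2 hi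
  ext1
  · exact addCaret_injective _ (by rwa [A.numLeaves_domain]) (by rwa [B.numLeaves_domain])
      (congrArg TreeBraidTree.domain h)
  · exact addCaret_injective _ (by rwa [A.numLeaves_range]) (by rwa [B.numLeaves_range]) hr
  · exact hb

/-- The common reduction undoes both splittings. Its trees come from removing two disjoint carets,
its braid from deleting one strand of each doubled pair. -/
theorem exists_split_eq {n : ℕ} {A B : TreeBraidTree n} {i j : ℕ} (hij : i < j) (hj : j < n + 1)
    (h : A.split i = B.split j) :
    ∃ C, Step C ⟨n, A⟩ ∧ Step C ⟨n, B⟩ := by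
  have hd : addCaret A.domain i = addCaret B.domain j := congrArg TreeBraidTree.domain h
  have hij' : i + 1 < j := by
    by_contra hc
    obtain rfl : j = i + 1 := by omega
    exact addCaret_ne_addCaret_succ _ (by rw [A.numLeaves_domain]; omega)
      (by rwa [B.numLeaves_domain]) hd
  obtain ⟨y, rfl⟩ : ∃ y, j = y + 1 := ⟨j - 1, by omega⟩
  obtain ⟨n, rfl⟩ : ∃ m, n = m + 1 := ⟨n - 1, by omega⟩
  have hb : split A.braid i = split B.braid (y + 1) := congrArg TreeBraidTree.braid h
  -- Deleting strand `i + 1` of the common splitting leaves the braid of `A`. That splitting also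
  -- doubles strand `y + 1` of `B`, and the deletion commutes with this doubling.
  have ha : A.braid = split (delete B.braid (i + 1)) y := by
    have h1 := delete_split B.braid (i + 1) (y + 1) (by omega) (by omega) (by omega)
    rw [skip, drop, if_pos (by omega), if_neg (by omega), ← hb,
      delete_split_self _ _ (by omega)] at h1
    exact h1
  have hb' : B.braid = split (delete A.braid (y + 1)) i := by
    have h1 := delete_split A.braid (y + 1) i (by omega) (by omega) (by omega)
    rw [skip, drop, if_neg (by omega), if_pos (by omega), hb,
      delete_split_self _ _ (by omega)] at h1
    exact h1
  have hc : delete A.braid (y + 1) = delete B.braid (i + 1) := by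
    rw [hb', delete_split_self _ _ (by omega)]
  rw [hc] at hb'
  set c := delete B.braid (i + 1) with hcdef
  have hiy : i ≠ y := by omega
  -- In the range tree the two strands may arrive in the opposite order, so the positions are
  -- expressed with `skip` instead of a fixed order.
  have hr : addCaret A.range (skip (strandEnd c y) (strandEnd c i)) =
      addCaret B.range (skip (strandEnd c i) (strandEnd c y)) := by
    have h1 := congrArg TreeBraidTree.range h
    simp only [TreeBraidTree.split] at h1
    have h2 := (strandEnd_split c y).2 i
    have h3 := (strandEnd_split c i).2 y
    rw [skip, if_pos (by omega), ← ha] at h2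
    rw [skip, if_neg (by omega), ← hb'] at h3
    rwa [h2, h3] at h1
  have hd' : addCaret A.domain (skip y i) = addCaret B.domain (skip i y) := by
    rwa [skip, skip, if_pos (by omega), if_neg (by omega)]
  have l1 : strandEnd c i < n + 1 := (strandEnd_lt _ _).2 (by omega)
  have l2 : strandEnd c y < n + 1 := (strandEnd_lt _ _).2 (by omega)
  obtain ⟨u, hu1, hu2⟩ := exists_addCaret_addCaret hiy (by rw [A.numLeaves_domain]; omega)
    (by rw [A.numLeaves_domain]; omega) hd'
  obtain ⟨v, hv1, hv2⟩ := exists_addCaret_addCaret (fun h => hiy (strandEnd_injective c h))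
    (by rw [A.numLeaves_range]; omega) (by rw [A.numLeaves_range]; omega) hr
  have nu : u.numNodes = n := by
    have := A.numNodes_domain
    rw [hu1, numNodes_addCaret] at this
    omega
  have nv : v.numNodes = n := by
    have := A.numNodes_range
    rw [hv1, numNodes_addCaret] at this
    omega
  refine ⟨⟨n, ⟨u, v, nu, nv, c⟩⟩, ⟨y, by simp only; omega, ?_⟩, ⟨i, by simp only; omega, ?_⟩⟩
  · simp only
    congr 1
    ext1
    · exact hu1
    · exact hv1
    · exact ha
  · simp only
    congr 1
    ext1
    · exact hu2
    · exact hv2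
    · exact hb'

/-- Two reductions of a diagram have a common reduction. -/
theorem Step.diamond_down {A B D : Diagram} (h1 : Step A D) (h2 : Step B D) :
    A = B ∨ ∃ C, Step C A ∧ Step C B := by
  obtain ⟨n, A⟩ := A
  obtain ⟨m, B⟩ := B
  obtain ⟨i, hi, rfl⟩ := h1
  obtain ⟨j, hj, h⟩ := h2
  obtain rfl : n = m := by
    have := congrArg Sigma.fst h
    simpa using this
  simp only at hi hj
  have h' : A.split i = B.split j := by simpa using h
  rcases lt_trichotomy i j with g | g | g
  · exact Or.inr (exists_split_eq g hj h')
  · subst g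
    exact Or.inl (by rw [eq_of_split_eq_split hi h'])
  · obtain ⟨C, h3, h4⟩ := exists_split_eq g hi h'.symm
    exact Or.inr ⟨C, h4, h3⟩

/-- Equivalent diagrams have a common splitting; from there the two chains of reductions are joined
by Church–Rosser for the reversed relation. -/
theorem exists_expands_of_equiv {D E : Diagram} (h : diagramSetoid.r D E) :
    ∃ C, Expands C D ∧ Expands C E := by
  have hdia : ∀ a b c, flip Step a b → flip Step a c →
      ∃ d, Relation.ReflGen (flip Step) b d ∧ Relation.ReflTransGen (flip Step) c d := by
    intro a b c h1 h2
    rcases Step.diamond_down h1 h2 with rfl | ⟨C, h3, h4⟩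
    · exact ⟨b, Relation.ReflGen.refl, Relation.ReflTransGen.refl⟩
    · exact ⟨C, Relation.ReflGen.single h3, Relation.ReflTransGen.single h4⟩
  obtain ⟨F, h1, h2⟩ := equiv_iff_join.1 h
  obtain ⟨C, h3, h4⟩ := Relation.church_rosser hdia (Relation.reflTransGen_swap.2 h1)
    (Relation.reflTransGen_swap.2 h2)
  exact ⟨C, Relation.reflTransGen_swap.1 h3, Relation.reflTransGen_swap.1 h4⟩

namespace BV

theorem mk_reduced (g : BV) : mk (reduced g).2 = g := (exists_reduced g).choose_spec.1

theorem numCarets_le {n : ℕ} {D : TreeBraidTree n} {g : BV} (h : mk D = g) : g.numCarets ≤ n :=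
  (exists_reduced g).choose_spec.2 ⟨n, D⟩ h

/-- Every diagram of `g` arises from the reduced one by splittings. -/
theorem expands_reduced {n : ℕ} {D : TreeBraidTree n} {g : BV} (h : mk D = g) :
    Expands (reduced g) ⟨n, D⟩ := by
  obtain ⟨C, h1, h2⟩ := exists_expands_of_equiv
    (D := reduced g) (E := ⟨n, D⟩) (mk_eq_mk.1 ((mk_reduced g).trans h.symm))
  have h3 : mk C.2 = g := (mk_eq_of_expands h1).trans (mk_reduced g)
  have h4 : (reduced g).1 ≤ C.1 := numCarets_le h3
  -- The common reduction `C` also represents `g`, so by minimality it has at least as many carets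
  -- as the reduced diagram and no reduction was performed there.
  rcases Relation.ReflTransGen.cases_tail h1 with h5 | ⟨E, hE, i, _, h5⟩
  · rwa [h5]
  · have h6 := (Expands.isTop_range hE).numNodes_le
    rw [C.2.numNodes_range, E.2.numNodes_range] at h6
    rw [h5] at h4
    simp only at h4
    omega

end BV

/-! ### Action of diagrams on cones of binary words -/

/-- Reading a binary word from the root of a tree: `cut t u = some (i, w)` if `u` is the branch
that ends at the leaf number `i`, followed by `w`. -/
def cut : BinaryTree Unit → List Bool → Option (ℕ × List Bool)
  | .nil, u => some (0, u)
  | .node _ _ _, [] => none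
  | .node _ l _, false :: u => cut l u
  | .node _ l r, true :: u => (cut r u).map fun p => (l.numLeaves + p.1, p.2)

theorem cut_lt (t : BinaryTree Unit) : ∀ {u i w}, cut t u = some (i, w) → i < t.numLeaves := by
  induction t with
  | nil => intro u i w h; simp only [cut, Option.some.injEq, Prod.mk.injEq] at h; simp [← h.1]
  | node v l r hl hr =>
    intro u i w h
    match u with
    | [] => simp [cut] at h
    | false :: u => have := hl h; simp only [numLeaves]; omega
    | true :: u =>
      simp only [cut, Option.map_eq_some_iff, Prod.exists, Prod.mk.injEq] at h
      obtain ⟨j, w', h1, h2, -⟩ := h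
      have := hr h1
      simp only [numLeaves]; omega

theorem cut_append (t : BinaryTree Unit) : ∀ {u i w} (p : List Bool), cut t u = some (i, w) →
    cut t (u ++ p) = some (i, w ++ p) := by
  induction t with
  | nil =>
    intro u i w p h
    simp only [cut, Option.some.injEq, Prod.mk.injEq] at h
    simp [cut, h.1, h.2]
  | node v l r hl hr =>
    intro u i w p h
    match u with
    | [] => simp [cut] at h
    | false :: u => exact hl p h
    | true :: u =>
      simp only [cut, Option.map_eq_some_iff, Prod.exists, Prod.mk.injEq] at h
      obtain ⟨j, w', h1, h2, rfl⟩ := h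
      simp only [List.cons_append, cut, hr p h1, Option.map_some, h2]

theorem cut_injective (t : BinaryTree Unit) : ∀ {u v x}, cut t u = some x → cut t v = some x →
    u = v := by
  induction t with
  | nil =>
    intro u v x h1 h2
    simp only [cut, Option.some.injEq] at h1 h2
    rw [← h2] at h1
    exact (Prod.mk.inj h1).2
  | node a l r hl hr =>
    intro u v x h1 h2
    match u, v with
    | [], _ => simp [cut] at h1
    | _, [] => simp [cut] at h2
    | false :: u, false :: v => rw [hl h1 h2]
    | true :: u, true :: v =>
      simp only [cut, Option.map_eq_some_iff, Prod.exists] at h1 h2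
      obtain ⟨j, w, h1, rfl⟩ := h1
      obtain ⟨j', w', h2, h3⟩ := h2
      simp only [Prod.mk.injEq] at h3
      obtain ⟨rfl, rfl⟩ : j' = j ∧ w' = w := ⟨by omega, h3.2⟩
      rw [hr h1 h2]
    | false :: u, true :: v =>
      simp only [cut, Option.map_eq_some_iff, Prod.exists] at h1 h2
      obtain ⟨j', w', h2, rfl⟩ := h2
      have := cut_lt l h1
      omega
    | true :: u, false :: v =>
      simp only [cut, Option.map_eq_some_iff, Prod.exists] at h1 h2
      obtain ⟨j', w', h1, rfl⟩ := h1
      have := cut_lt l h2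
      omega

theorem exists_cut_eq (t : BinaryTree Unit) : ∀ {i} (w : List Bool), i < t.numLeaves →
    ∃ u, cut t u = some (i, w) ∧ u.length ≤ t.numNodes + w.length := by
  induction t with
  | nil =>
    intro i w h
    simp only [numLeaves] at h
    exact ⟨w, by simp only [cut, show i = 0 by omega], by simp⟩
  | node v l r hl hr =>
    intro i w h
    simp only [numLeaves] at h
    by_cases hi : i < l.numLeaves
    · obtain ⟨u, h1, h2⟩ := hl w hi
      exact ⟨false :: u, h1, by simp only [List.length_cons, numNodes]; omega⟩
    · obtain ⟨u, h1, h2⟩ := hr w (i := i - l.numLeaves) (by omega)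
      refine ⟨true :: u, ?_, by simp only [List.length_cons, numNodes]; omega⟩
      simp only [cut, h1, Option.map_some, show l.numLeaves + (i - l.numLeaves) = i by omega]

theorem cut_length (t : BinaryTree Unit) : ∀ {u i w}, cut t u = some (i, w) →
    w.length ≤ u.length ∧ u.length ≤ t.numNodes + w.length := by
  induction t with
  | nil =>
    intro u i w h
    simp only [cut, Option.some.injEq, Prod.mk.injEq] at h
    simp [h.2]
  | node v l r hl hr =>
    intro u i w h
    match u with
    | [] => simp [cut] at h
    | false :: u =>
      have := hl h
      simp only [List.length_cons, numNodes]; omega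
    | true :: u =>
      simp only [cut, Option.map_eq_some_iff, Prod.exists, Prod.mk.injEq] at h
      obtain ⟨j, w', h1, h2, rfl⟩ := h
      have := hr h1
      simp only [List.length_cons, numNodes]; omega

theorem exists_cut (t : BinaryTree Unit) : ∀ {u : List Bool}, t.numNodes ≤ u.length →
    ∃ x, cut t u = some x := by
  induction t with
  | nil => intro u _; exact ⟨_, rfl⟩
  | node v l r hl hr =>
    intro u h
    simp only [numNodes] at h
    match u with
    | [] => simp at h
    | false :: u =>
      simp only [List.length_cons] at h
      exact hl (u := u) (by omega)
    | true :: u =>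
      simp only [List.length_cons] at h
      obtain ⟨x, hx⟩ := hr (u := u) (by omega)
      simp [cut, hx]

/-- The effect of `addCaret t j` on the word `w` that remains after the leaf number `i` of `t`. -/
def cutCaret (j i : ℕ) (w : List Bool) : Option (ℕ × List Bool) :=
  if i = j then
    match w with
    | [] => none
    | false :: w => some (j, w)
    | true :: w => some (j + 1, w)
  else some (skip j i, w)

theorem cut_addCaret (t : BinaryTree Unit) : ∀ {u j}, j < t.numLeaves →
    cut (addCaret t j) u = (cut t u).bind fun x => cutCaret j x.1 x.2 := by
  induction t with
  | nil =>
    intro u j hj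
    simp only [numLeaves] at hj
    obtain rfl : j = 0 := by omega
    match u with
    | [] => rfl
    | false :: u => rfl
    | true :: u => rfl
  | node v l r hl hr =>
    intro u j hj
    simp only [numLeaves] at hj
    by_cases h : j < l.numLeaves
    · simp only [addCaret, h, if_true]
      match u with
      | [] => rfl
      | false :: u => exact hl h
      | true :: u =>
        simp only [cut]
        cases hc : cut r u with
        | none => rfl
        | some x =>
          simp only [Option.map_some, Option.bind_some, cutCaret, skip, numLeaves_addCaret]
          rw [if_neg (by omega), if_neg (by omega)]
          congr 2; omega
    · simp only [addCaret, h, if_false]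
      match u with
      | [] => rfl
      | false :: u =>
        simp only [cut]
        cases hc : cut l u with
        | none => rfl
        | some x =>
          have := cut_lt l hc
          simp only [Option.bind_some, cutCaret, skip]
          rw [if_neg (by omega), if_pos (by omega)]
      | true :: u =>
        simp only [cut]
        rw [hr (by omega)]
        cases hc : cut r u with
        | none => rfl
        | some x =>
          simp only [Option.map_some, Option.bind_some, cutCaret, skip]
          by_cases hx : x.1 = j - l.numLeaves
          · rw [if_pos hx, if_pos (by omega)]
            split
            · rfl
            · simp only [Option.map_some]; congr 2; omega
            · simp only [Option.map_some]; congr 2; omega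
          · rw [if_neg hx, if_neg (show ¬ l.numLeaves + x.1 = j by omega), Option.map_some]
            by_cases hx' : x.1 ≤ j - l.numLeaves
            · rw [if_pos hx', if_pos (show l.numLeaves + x.1 ≤ j by omega)]
            · rw [if_neg hx', if_neg (show ¬ l.numLeaves + x.1 ≤ j by omega)]
              rfl

/-- `D.Maps u v`: the cone of words with the prefix `u` is contained in the cone at a leaf of the
domain tree, and the diagram carries `u` to `v`. -/
def TreeBraidTree.Maps {n : ℕ} (D : TreeBraidTree n) (u v : List Bool) : Prop :=
  ∃ i w, cut D.domain u = some (i, w) ∧ cut D.range v = some (strandEnd D.braid i, w)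

namespace TreeBraidTree

variable {n : ℕ} {D : TreeBraidTree n} {u v : List Bool}

theorem Maps.append (h : D.Maps u v) (p : List Bool) : D.Maps (u ++ p) (v ++ p) := by
  obtain ⟨i, w, h1, h2⟩ := h
  exact ⟨i, w ++ p, cut_append _ p h1, cut_append _ p h2⟩

theorem Maps.inv (h : D.Maps u v) : D.inv.Maps v u := by
  obtain ⟨i, w, h1, h2⟩ := h
  exact ⟨_, w, h2, by simpa only [TreeBraidTree.inv, strandEnd_inv_left] using h1⟩

theorem Maps.unique {v' : List Bool} (h : D.Maps u v) (h' : D.Maps u v') : v = v' := by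
  obtain ⟨i, w, h1, h2⟩ := h
  obtain ⟨i', w', h3, h4⟩ := h'
  rw [h1, Option.some.injEq, Prod.mk.injEq] at h3
  obtain ⟨rfl, rfl⟩ := h3
  exact cut_injective _ h2 h4

theorem exists_maps_of_cut_range {x : ℕ × List Bool} (h : cut D.range v = some x) :
    ∃ u, D.Maps u v := by
  have hx := cut_lt _ h
  rw [D.numLeaves_range] at hx
  obtain ⟨u, hu, -⟩ := exists_cut_eq D.domain (i := strandEnd D.braid⁻¹ x.1) x.2
    (by rw [D.numLeaves_domain]; exact (strandEnd_lt _ _).2 hx)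
  exact ⟨u, _, _, hu, by rw [strandEnd_inv_right]; exact h⟩

theorem exists_maps_of_cut_domain {x : ℕ × List Bool} (h : cut D.domain u = some x) :
    ∃ v, D.Maps u v := by
  have hx := cut_lt _ h
  rw [D.numLeaves_domain] at hx
  obtain ⟨v, hv, -⟩ := exists_cut_eq D.range (i := strandEnd D.braid x.1) x.2
    (by rw [D.numLeaves_range]; exact (strandEnd_lt _ _).2 hx)
  exact ⟨v, _, _, h, hv⟩

/-- The two copies of the split strand end side by side in their original order. Thus the letter
that selects a copy in the domain selects the same copy in the range, and putting it back in front
of the remainder undoes the splitting. A splitting can only destroy pairs `u, v`, never create them.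
-/
theorem Maps.of_split {i : ℕ} (hi : i < n + 1) (h : (D.split i).Maps u v) : D.Maps u v := by
  obtain ⟨a, w, h1, h2⟩ := h
  simp only [split] at h1 h2
  rw [cut_addCaret _ (by rwa [D.numLeaves_domain]), Option.bind_eq_some_iff] at h1
  rw [cut_addCaret _ (by rw [D.numLeaves_range]; exact (strandEnd_lt _ _).2 hi),
    Option.bind_eq_some_iff] at h2
  obtain ⟨⟨x, p⟩, h1, h3⟩ := h1
  obtain ⟨⟨y, q⟩, h2, h4⟩ := h2
  have hs := strandEnd_split D.braid i
  have h5 := cut_lt _ h1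
  refine ⟨x, p, h1, ?_⟩
  rw [h2]
  simp only [cutCaret] at h3 h4
  have key : ∀ x y : ℕ, skip x y ≠ x + 1 ∧ (skip x y = x → y = x) := by
    intro x y
    unfold skip
    split_ifs <;> omega
  have key2 : ∀ x y z : ℕ, skip x y = skip x z → y = z := by
    intro x y z
    unfold skip
    split_ifs <;> omega
  have self : skip i i = i := by simp [skip]
  have self2 : skip (strandEnd D.braid i) (strandEnd D.braid i) = strandEnd D.braid i := by
    simp [skip]
  by_cases hx : x = i
  · subst hx
    have hs' := hs.2 x
    rw [self, self2] at hs'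
    rw [if_pos rfl] at h3
    match p, h3 with
    | false :: p, h3 =>
      simp only [Option.some.injEq, Prod.mk.injEq] at h3
      obtain ⟨rfl, rfl⟩ := h3
      rw [hs'] at h4
      split_ifs at h4 with hy
      · match q, h4 with
        | false :: q, h4 =>
          simp only [Option.some.injEq, Prod.mk.injEq, true_and] at h4
          rw [hy, h4]
        | true :: q, h4 =>
          simp only [Option.some.injEq, Prod.mk.injEq] at h4
          omega
      · simp only [Option.some.injEq, Prod.mk.injEq] at h4
        exact absurd ((key _ _).2 h4.1) hy
    | true :: p, h3 =>
      simp only [Option.some.injEq, Prod.mk.injEq] at h3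
      obtain ⟨rfl, rfl⟩ := h3
      rw [hs.1] at h4
      split_ifs at h4 with hy
      · match q, h4 with
        | false :: q, h4 =>
          simp only [Option.some.injEq, Prod.mk.injEq] at h4
          omega
        | true :: q, h4 =>
          simp only [Option.some.injEq, Prod.mk.injEq, true_and] at h4
          rw [hy, h4]
      · simp only [Option.some.injEq, Prod.mk.injEq] at h4
        exact absurd h4.1 (key _ _).1
  · rw [if_neg hx] at h3
    simp only [Option.some.injEq, Prod.mk.injEq] at h3
    obtain ⟨rfl, rfl⟩ := h3
    rw [hs.2] at h4
    have hx' : strandEnd D.braid x ≠ strandEnd D.braid i := fun h => hx (strandEnd_injective _ h)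
    split_ifs at h4 with hy
    · match q, h4 with
      | false :: q, h4 =>
        simp only [Option.some.injEq, Prod.mk.injEq] at h4
        exact absurd ((key _ _).2 h4.1.symm) hx'
      | true :: q, h4 =>
        simp only [Option.some.injEq, Prod.mk.injEq] at h4
        exact absurd h4.1.symm (key _ _).1
    · simp only [Option.some.injEq, Prod.mk.injEq] at h4
      rw [key2 _ _ _ h4.1, h4.2]

end TreeBraidTree

theorem Expands.maps {D E : Diagram} (h : Expands D E) {u v : List Bool} (hm : E.2.Maps u v) :
    D.2.Maps u v := by
  induction h with
  | refl => exact hm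
  | tail _ hs ih =>
    obtain ⟨i, hi, rfl⟩ := hs
    exact ih (hm.of_split hi)

/-! ### Products, prefix replacement and the number of carets -/

/-- The least common expansion of two trees. -/
def treeJoin : BinaryTree Unit → BinaryTree Unit → BinaryTree Unit
  | .nil, s => s
  | .node _ l r, .nil => .node () l r
  | .node _ l r, .node _ l' r' => .node () (treeJoin l l') (treeJoin r r')

theorem isTop_treeJoin_left (t : BinaryTree Unit) : ∀ s, IsTop t (treeJoin t s) := by
  induction t with
  | nil => intro s; trivial
  | node v l r hl hr =>
    intro s
    cases s with
    | nil => exact IsTop.refl _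
    | node w a b => exact ⟨hl a, hr b⟩

theorem isTop_treeJoin_right (t : BinaryTree Unit) : ∀ s, IsTop s (treeJoin t s) := by
  induction t with
  | nil => intro s; exact IsTop.refl _
  | node v l r hl hr =>
    intro s
    cases s with
    | nil => trivial
    | node w a b => exact ⟨hl a, hr b⟩

theorem numNodes_treeJoin_le (t : BinaryTree Unit) : ∀ s,
    (treeJoin t s).numNodes ≤ t.numNodes + s.numNodes := by
  induction t with
  | nil => intro s; simp [treeJoin]
  | node v l r hl hr =>
    intro s
    cases s with
    | nil => simp [treeJoin]
    | node w a b =>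
      have := hl a
      have := hr b
      simp only [treeJoin, numNodes]; omega

/-- The least common expansion does not subdivide a cone that neither tree subdivides. This is why
`Maps` composes without shrinking the cone. -/
theorem exists_cut_treeJoin (t : BinaryTree Unit) : ∀ {s v x y}, cut t v = some x →
    cut s v = some y → ∃ z, cut (treeJoin t s) v = some z := by
  induction t with
  | nil => intro s v x y _ h; exact ⟨y, h⟩
  | node a l r hl hr =>
    intro s v x y h1 h2
    cases s with
    | nil => exact ⟨x, h1⟩
    | node b l' r' =>
      match v with
      | [] => simp [cut] at h1
      | false :: v => exact hl (v := v) h1 h2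
      | true :: v =>
        simp only [cut, Option.map_eq_some_iff] at h1 h2
        obtain ⟨x, h1, -⟩ := h1
        obtain ⟨y, h2, -⟩ := h2
        obtain ⟨z, hz⟩ := hr h1 h2
        exact ⟨_, by simp only [treeJoin, cut, hz, Option.map_some]; rfl⟩

namespace BV

/-- `g.Maps u v`: the element `g` carries the cone of words with the prefix `u` to the cone of words
with the prefix `v`, replacing `u` by `v`, in such a way that all strands over the cone are
parallel. -/
def Maps (g : BV) (u v : List Bool) : Prop := (reduced g).2.Maps u v

/-- The reduced diagram realizes the most pairs `u, v`, so any diagram of the element may serve as a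
certificate. -/
theorem maps_mk {n : ℕ} {D : TreeBraidTree n} {u v : List Bool} (h : D.Maps u v) :
    (mk D).Maps u v := (expands_reduced (rfl : mk D = mk D)).maps h

variable {g h : BV} {u v w : List Bool}

theorem Maps.append (hg : g.Maps u v) (p : List Bool) : g.Maps (u ++ p) (v ++ p) :=
  TreeBraidTree.Maps.append hg p

theorem Maps.inv (hg : g.Maps u v) : g⁻¹.Maps v u := by
  have := maps_mk (TreeBraidTree.Maps.inv hg)
  rwa [← inv_mk, mk_reduced] at this

theorem Maps.unique {v' : List Bool} (hg : g.Maps u v) (hg' : g.Maps u v') : v = v' :=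
  TreeBraidTree.Maps.unique hg hg'

theorem Maps.unique_left {u' : List Bool} (hg : g.Maps u v) (hg' : g.Maps u' v) : u = u' :=
  hg.inv.unique hg'.inv

theorem exists_composable_le (g h : BV) : ∃ (n : ℕ) (A B : TreeBraidTree n),
    mk A = g ∧ mk B = h ∧ A.range = B.domain ∧
    A.range = treeJoin (reduced g).2.range (reduced h).2.domain := by
  obtain ⟨⟨a, A⟩, hA, hAs⟩ := exists_expands_range (reduced g) _
    (isTop_treeJoin_left (reduced g).2.range (reduced h).2.domain)
  obtain ⟨⟨b, B⟩, hB, hBs⟩ := exists_expands_domain (reduced h) _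
    (isTop_treeJoin_right (reduced g).2.range (reduced h).2.domain)
  simp only at hAs hBs
  obtain rfl : a = b := by rw [← A.numNodes_range, ← B.numNodes_domain, hAs, hBs]
  exact ⟨a, A, B, (mk_eq_of_expands hA).symm.trans (mk_reduced g),
    (mk_eq_of_expands hB).symm.trans (mk_reduced h), hAs.trans hBs.symm, hAs⟩

theorem Maps.mul (hg : g.Maps u v) (hh : h.Maps v w) : (g * h).Maps u w := by
  obtain ⟨n, A, B, hA, hB, hAB, hJ⟩ := exists_composable_le g h
  obtain ⟨_, _, _, c1⟩ := id hg
  obtain ⟨_, _, c2, _⟩ := id hh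
  obtain ⟨z, hz⟩ := exists_cut_treeJoin _ c1 c2
  rw [← hJ] at hz
  obtain ⟨u', hu'⟩ := TreeBraidTree.exists_maps_of_cut_range hz
  rw [hAB] at hz
  obtain ⟨w', hw'⟩ := TreeBraidTree.exists_maps_of_cut_domain hz
  have e1 := maps_mk hu'
  have e2 := maps_mk hw'
  rw [hA] at e1
  rw [hB] at e2
  -- The words obtained from the expanded diagrams agree with the given ones, since `Maps`
  -- determines each word of a pair from the other.
  obtain rfl := hg.unique_left e1
  obtain rfl := hh.unique e2
  rw [← hA, ← hB, mk_mul_mk hAB]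
  apply maps_mk
  obtain ⟨i, p, h1, h2⟩ := hu'
  obtain ⟨j, q, h3, h4⟩ := hw'
  rw [← hAB, h2, Option.some.injEq, Prod.mk.injEq] at h3
  obtain ⟨rfl, rfl⟩ := h3
  exact ⟨i, p, h1, by simpa only [TreeBraidTree.comp, strandEnd_mul] using h4⟩

theorem maps_one (u : List Bool) : (1 : BV).Maps u u :=
  maps_mk (D := TreeBraidTree.idOn .nil) ⟨0, u, rfl, by
    simp only [TreeBraidTree.idOn, strandEnd_one, cut]⟩

theorem exists_maps (h : g.numCarets ≤ u.length) : ∃ v, g.Maps u v := by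
  obtain ⟨x, hx⟩ := exists_cut (reduced g).2.domain (u := u)
    (by rwa [(reduced g).2.numNodes_domain])
  exact TreeBraidTree.exists_maps_of_cut_domain hx

theorem Maps.length_le (hg : g.Maps u v) : u.length ≤ v.length + g.numCarets := by
  obtain ⟨i, w, h1, h2⟩ := hg
  have h3 := cut_length _ h1
  have h4 := cut_length _ h2
  rw [(reduced g).2.numNodes_domain] at h3
  have : (reduced g).1 = g.numCarets := rfl
  omega

/-- If `g` does not stretch the two words `u ++ p` and `u ++ q` equally, then it does not carry the
cone at `u` to a cone. -/
theorem not_maps {p q a b : List Bool} (hp : g.Maps (u ++ p) a) (hq : g.Maps (u ++ q) b)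
    (hab : a.length + q.length ≠ b.length + p.length) : ¬ g.Maps u v := by
  intro hv
  have e1 := congrArg List.length (hp.unique (hv.append p))
  have e2 := congrArg List.length (hq.unique (hv.append q))
  simp only [List.length_append] at e1 e2
  omega

/-- Any word at least as long as the number of carets runs to a leaf of the domain tree, and the
cone there is stretched uniformly. All lower bounds for `numCarets` that come from unequal
stretching use this. -/
theorem length_lt_numCarets {p q a b : List Bool} (hp : g.Maps (u ++ p) a)
    (hq : g.Maps (u ++ q) b) (hab : a.length + q.length ≠ b.length + p.length) :
    u.length < g.numCarets := by
  by_contra hc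
  obtain ⟨v, hv⟩ := exists_maps (g := g) (u := u) (by omega)
  exact not_maps hp hq hab hv

theorem numCarets_mul_le (g h : BV) : (g * h).numCarets ≤ g.numCarets + h.numCarets := by
  obtain ⟨n, A, B, hA, hB, hAB, hJ⟩ := exists_composable_le g h
  have h1 : (g * h).numCarets ≤ n := numCarets_le (D := A.comp B) (by rw [← mk_mul_mk hAB, hA, hB])
  have h2 := numNodes_treeJoin_le (reduced g).2.range (reduced h).2.domain
  rw [← hJ, A.numNodes_range, (reduced g).2.numNodes_range, (reduced h).2.numNodes_domain] at h2
  exact h1.trans h2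

theorem numCarets_inv_le (g : BV) : g⁻¹.numCarets ≤ g.numCarets :=
  numCarets_le (D := (reduced g).2.inv) (by rw [← inv_mk, mk_reduced])

end BV

/-! ### Words and upper bounds for lengths -/

theorem Word.eval_nil : Word.eval [] = 1 := rfl

theorem Word.eval_cons (a : Letter × Bool) (w : Word) :
    Word.eval (a :: w) = (if a.2 then a.1.toBV else a.1.toBV⁻¹) * Word.eval w := by
  simp [Word.eval]

theorem Word.eval_append (w w' : Word) : Word.eval (w ++ w') = w.eval * w'.eval := by
  simp [Word.eval]

theorem Word.eval_replicate_true (k : ℕ) (a : Letter) :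
    Word.eval (List.replicate k (a, true)) = a.toBV ^ k := by
  simp [Word.eval]

theorem Word.eval_replicate_false (k : ℕ) (a : Letter) :
    Word.eval (List.replicate k (a, false)) = a.toBV⁻¹ ^ k := by
  simp [Word.eval]

/-- The element `g` is represented by a word of length at most `k`. -/
def LengthLE (g : BV) (k : ℕ) : Prop := ∃ w : Word, w.eval = g ∧ w.length ≤ k

namespace LengthLE

variable {g h : BV} {k l : ℕ}

theorem one : LengthLE 1 0 := ⟨[], rfl, le_rfl⟩

theorem letter (a : Letter) : LengthLE a.toBV 1 :=
  ⟨[(a, true)], by simp [Word.eval], by simp⟩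

theorem mul (hg : LengthLE g k) (hh : LengthLE h l) : LengthLE (g * h) (k + l) := by
  obtain ⟨w, rfl, h1⟩ := hg
  obtain ⟨w', rfl, h2⟩ := hh
  exact ⟨w ++ w', Word.eval_append _ _, by simp only [List.length_append]; omega⟩

theorem mono (hg : LengthLE g k) (hkl : k ≤ l) : LengthLE g l := by
  obtain ⟨w, rfl, h1⟩ := hg
  exact ⟨w, rfl, h1.trans hkl⟩

theorem inv (hg : LengthLE g k) : LengthLE g⁻¹ k := by
  obtain ⟨w, rfl, h1⟩ := hg
  have key : ∀ w : Word, LengthLE w.eval⁻¹ w.length := by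
    intro w
    induction w with
    | nil => exact ⟨[], by simp [Word.eval_nil], le_rfl⟩
    | cons a w ih =>
      rw [Word.eval_cons, mul_inv_rev]
      refine ih.mul (l := 1) ⟨[(a.1, !a.2)], ?_, le_rfl⟩
      rcases a with ⟨a, _ | _⟩ <;> simp [Word.eval]
  exact (key w).mono h1

end LengthLE

/-! ### Pairs of trees: the length in Thompson's group F -/

theorem mk_split {n : ℕ} (D : TreeBraidTree n) {i : ℕ} (hi : i < n + 1) :
    BV.mk (D.split i) = BV.mk D :=
  (BV.mk_eq_of_expands (E := ⟨n + 1, D.split i⟩) (Relation.ReflTransGen.single ⟨i, hi, rfl⟩)).symm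

/-- The element represented by a pair of trees joined by the trivial braid. -/
def treePair (S T : BinaryTree Unit) (h : S.numNodes = T.numNodes) : BV :=
  BV.mk (n := T.numNodes) ⟨S, T, h, rfl, 1⟩

theorem mk_eq_treePair {n : ℕ} {S T : BinaryTree Unit} (hS : S.numNodes = n)
    (hT : T.numNodes = n) : BV.mk ⟨S, T, hS, hT, 1⟩ = treePair S T (hS.trans hT.symm) := by
  subst hT
  rfl

theorem treePair_mul_mk {n : ℕ} {S : BinaryTree Unit} (D : TreeBraidTree n)
    (h : S.numNodes = D.domain.numNodes) : treePair S D.domain h * BV.mk D =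
      BV.mk ⟨S, D.range, h.trans D.numNodes_domain, D.numNodes_range, D.braid⟩ := by
  rw [← mk_eq_treePair (h.trans D.numNodes_domain) D.numNodes_domain, BV.mk_mul_mk rfl]
  simp only [TreeBraidTree.comp, one_mul]

theorem mk_mul_treePair {n : ℕ} {T : BinaryTree Unit} (D : TreeBraidTree n)
    (h : D.range.numNodes = T.numNodes) : BV.mk D * treePair D.range T h =
      BV.mk ⟨D.domain, T, D.numNodes_domain, h.symm.trans D.numNodes_range, D.braid⟩ := by
  rw [← mk_eq_treePair D.numNodes_range (h.symm.trans D.numNodes_range), BV.mk_mul_mk rfl]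
  simp only [TreeBraidTree.comp, mul_one]

theorem treePair_mul_treePair {S T U : BinaryTree Unit} (h : S.numNodes = T.numNodes)
    (h' : T.numNodes = U.numNodes) :
    treePair S T h * treePair T U h' = treePair S U (h.trans h') :=
  treePair_mul_mk ⟨T, U, h', rfl, 1⟩ h

theorem treePair_inv {S T : BinaryTree Unit} (h : S.numNodes = T.numNodes) :
    (treePair S T h)⁻¹ = treePair T S h.symm := by
  rw [treePair, BV.inv_mk, TreeBraidTree.inv]
  simp only [inv_one]
  exact mk_eq_treePair rfl h

theorem treePair_addCaret {S T : BinaryTree Unit} (h : S.numNodes = T.numNodes) {i : ℕ}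
    (hi : i < S.numLeaves) :
    treePair (addCaret S i) (addCaret T i) (by rw [numNodes_addCaret, numNodes_addCaret, h]) =
      treePair S T h := by
  rw [numLeaves_eq_numNodes_succ, h] at hi
  refine Eq.trans ?_ (mk_split ⟨S, T, h, rfl, 1⟩ hi)
  simp only [TreeBraidTree.split, strandEnd_one, split_one]
  exact (mk_eq_treePair _ _).symm

/-- Attach the root of the tree `R` to the leaf number `i` of a tree. -/
def attach : BinaryTree Unit → ℕ → BinaryTree Unit → BinaryTree Unit
  | .nil, _, R => R
  | .node _ l r, i, R =>
    if i < l.numLeaves then .node () (attach l i R) r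
    else .node () l (attach r (i - l.numLeaves) R)

theorem attach_nil (t : BinaryTree Unit) : ∀ i, attach t i .nil = t := by
  induction t with
  | nil => intro i; rfl
  | node v l r hl hr => intro i; simp only [attach, hl, hr]; split_ifs <;> rfl

theorem numLeaves_attach (t : BinaryTree Unit) : ∀ {i} (R), i < t.numLeaves →
    (attach t i R).numLeaves + 1 = t.numLeaves + R.numLeaves := by
  induction t with
  | nil => intro i R h; simp only [attach, numLeaves]; omega
  | node v l r hl hr =>
    intro i R h
    simp only [numLeaves] at h
    simp only [attach]
    split_ifs with hi
    · have := hl R hi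
      simp only [numLeaves]; omega
    · have := hr R (i := i - l.numLeaves) (by omega)
      simp only [numLeaves]; omega

theorem attach_node (t : BinaryTree Unit) : ∀ {i} (l r), i < t.numLeaves →
    attach t i (.node () l r) = attach (attach (addCaret t i) (i + 1) r) i l := by
  induction t with
  | nil =>
    intro i l r hi
    simp only [numLeaves] at hi
    obtain rfl : i = 0 := by omega
    simp [attach, addCaret]
  | node v a b ha hb =>
    intro i l r hi
    simp only [numLeaves] at hi
    by_cases h : i < a.numLeaves
    · have h1 := numLeaves_attach (addCaret a i) (i := i + 1) r
        (by rw [numLeaves_addCaret]; omega)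
      have h2 := numLeaves_pos r
      rw [numLeaves_addCaret] at h1
      simp only [attach, addCaret, h, if_true]
      rw [if_pos (by rw [numLeaves_addCaret]; omega)]
      simp only [attach]
      rw [if_pos (by omega), ha l r h]
    · simp only [attach, addCaret, h, if_false]
      rw [if_neg (by omega)]
      simp only [attach]
      rw [if_neg h, show i + 1 - a.numLeaves = i - a.numLeaves + 1 by omega,
        hb l r (by omega)]

theorem numNodes_attach_eq {S T : BinaryTree Unit} (h : S.numNodes = T.numNodes) {i : ℕ}
    (hi : i < S.numLeaves) (R : BinaryTree Unit) :
    (attach S i R).numNodes = (attach T i R).numNodes := by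
  have h1 := numLeaves_attach S R hi
  have h2 := numLeaves_attach T (i := i) R
    (by rwa [numLeaves_eq_numNodes_succ, ← h, ← numLeaves_eq_numNodes_succ])
  simp only [numLeaves_eq_numNodes_succ] at h1 h2
  omega

/-- Attaching `R` to corresponding leaves of both trees amounts to a sequence of splittings of the
trivial braid. -/
theorem treePair_attach (R : BinaryTree Unit) : ∀ {S T : BinaryTree Unit}
    (h : S.numNodes = T.numNodes) {i : ℕ} (hi : i < S.numLeaves),
    treePair (attach S i R) (attach T i R) (numNodes_attach_eq h hi R) = treePair S T h := by
  induction R with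
  | nil => intro S T h i hi; simp only [attach_nil]
  | node v l r hl hr =>
    intro S T h i hi
    have hi' : i < T.numLeaves := by
      rwa [numLeaves_eq_numNodes_succ, ← h, ← numLeaves_eq_numNodes_succ]
    have h1 : i + 1 < (addCaret S i).numLeaves := by rw [numLeaves_addCaret]; omega
    have h2 := numLeaves_attach _ r h1
    have h3 := numLeaves_pos r
    rw [numLeaves_addCaret] at h2
    have e := hl (numNodes_attach_eq (S := addCaret S i) (T := addCaret T i)
      (by rw [numNodes_addCaret, numNodes_addCaret, h]) h1 r) (i := i) (by omega)
    rw [hr (S := addCaret S i) (T := addCaret T i)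
      (by rw [numNodes_addCaret, numNodes_addCaret, h]) h1, treePair_addCaret h hi] at e
    rw [← e]
    simp only [attach_node _ l r hi, attach_node _ l r hi']

/-- This makes `x₀` a rotation at the root of an arbitrary tree; likewise `x₁` below is a rotation
at the right child of the root. -/
theorem toBV_x₀ (X Y Z : BinaryTree Unit) : Letter.x₀.toBV =
    treePair (.node () (.node () X Y) Z) (.node () X (.node () Y Z))
      (by simp only [numNodes]; omega) := by
  have e0 : Letter.x₀.toBV = treePair (.node () (.node () .nil .nil) .nil)
      (.node () .nil (.node () .nil .nil)) (by rfl) := rfl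
  -- The trees are attached from right to left, so the numbers of the leaves still to be used do not
  -- shift.
  rw [e0, ← treePair_attach Z (i := 2) (by rfl) (by simp [numLeaves]),
    ← treePair_attach Y (i := 1) _ (by simp [attach, numLeaves]; omega),
    ← treePair_attach X (i := 0) _ (by simp [attach, numLeaves])]
  simp [attach, numLeaves]

theorem toBV_x₁ (W X Y Z : BinaryTree Unit) : Letter.x₁.toBV =
    treePair (.node () W (.node () (.node () X Y) Z)) (.node () W (.node () X (.node () Y Z)))
      (by simp only [numNodes]; omega) := by
  have e0 : Letter.x₁.toBV = treePair (.node () .nil (.node () (.node () .nil .nil) .nil))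
      (.node () .nil (.node () .nil (.node () .nil .nil))) (by rfl) := rfl
  rw [e0, ← treePair_attach Z (i := 3) (by rfl) (by simp [numLeaves]),
    ← treePair_attach Y (i := 2) _ (by simp [attach, numLeaves]; omega),
    ← treePair_attach X (i := 1) _ (by simp [attach, numLeaves]),
    ← treePair_attach W (i := 0) _ (by simp [attach, numLeaves])]
  simp [attach, numLeaves]

/-- The pair of trees `(S, T)` represents an element of length at most `k`. -/
def Close (k : ℕ) (S T : BinaryTree Unit) : Prop :=
  ∃ h : S.numNodes = T.numNodes, LengthLE (treePair S T h) k

namespace Close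

variable {k l : ℕ} {S T U : BinaryTree Unit}

theorem refl (S : BinaryTree Unit) : Close 0 S S :=
  ⟨rfl, by rw [treePair, BV.mk_eq_one rfl rfl]; exact LengthLE.one⟩

theorem trans (h : Close k S T) (h' : Close l T U) : Close (k + l) S U := by
  obtain ⟨e, h⟩ := h
  obtain ⟨e', h'⟩ := h'
  exact ⟨e.trans e', by rw [← treePair_mul_treePair e e']; exact h.mul h'⟩

theorem symm (h : Close k S T) : Close k T S := by
  obtain ⟨e, h⟩ := h
  exact ⟨e.symm, by rw [← treePair_inv e]; exact h.inv⟩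

theorem mono (h : Close k S T) (hkl : k ≤ l) : Close l S T := ⟨h.1, h.2.mono hkl⟩

theorem rotate_root (X Y Z : BinaryTree Unit) :
    Close 1 (.node () (.node () X Y) Z) (.node () X (.node () Y Z)) :=
  ⟨by simp only [numNodes]; omega, by rw [← toBV_x₀]; exact LengthLE.letter _⟩

theorem rotate_right (W X Y Z : BinaryTree Unit) :
    Close 1 (.node () W (.node () (.node () X Y) Z)) (.node () W (.node () X (.node () Y Z))) :=
  ⟨by simp only [numNodes]; omega, by rw [← toBV_x₁]; exact LengthLE.letter _⟩

end Close

/-- The number of rotations at the right child of the root, and of left rotations at the root, that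
move all carets of the right subtree `R` to the left subtree. -/
def rotationCount : BinaryTree Unit → ℕ
  | .nil => 0
  | .node _ l r => 1 + 2 * l.numNodes + rotationCount r

theorem rotationCount_le (R : BinaryTree Unit) : rotationCount R ≤ 2 * R.numNodes := by
  induction R with
  | nil => simp [rotationCount]
  | node v l r hl hr => simp only [rotationCount, numNodes]; omega

/-- The tree `L` with `k` carets added above its root, each with `L` on its left. -/
def leftComb (L : BinaryTree Unit) : ℕ → BinaryTree Unit
  | 0 => L
  | k + 1 => leftComb (.node () L .nil) k

/-- Every rotation lowers `rotationCount R` by exactly one. If the left child of `R` is a leaf, a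
rotation at the root moves the caret at the root of `R` to the left subtree; otherwise a rotation at
the right child makes the left part of `R` smaller. -/
theorem close_leftComb (k : ℕ) : ∀ L R : BinaryTree Unit, rotationCount R = k →
    Close k (.node () L R) (leftComb L (R.numNodes + 1)) := by
  induction k with
  | zero =>
    intro L R h
    cases R with
    | nil => exact Close.refl _
    | node v l r => simp only [rotationCount] at h; omega
  | succ k ih =>
    intro L R h
    match R with
    | .nil => simp only [rotationCount] at h; omega
    | .node _ .nil R =>
      simp only [rotationCount, numNodes] at h
      have h1 := (Close.rotate_root L .nil R).symm.trans (ih (.node () L .nil) R (by omega))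
      rw [add_comm 1 k] at h1
      have e : (node () nil R).numNodes + 1 = R.numNodes + 1 + 1 := by simp only [numNodes]; omega
      rw [e]
      exact h1
    | .node _ (.node _ X Y) Z =>
      simp only [rotationCount, numNodes] at h
      have h1 := (Close.rotate_right L X Y Z).trans (ih L (.node () X (.node () Y Z))
        (by simp only [rotationCount]; omega))
      rw [add_comm 1 k] at h1
      have e : (node () (node () X Y) Z).numNodes = (node () X (node () Y Z)).numNodes := by
        simp only [numNodes]; omega
      rw [e]
      exact h1

/-- Rotations at the root shorten the left spine one caret at a time. -/
theorem exists_close_node_nil (L : BinaryTree Unit) : ∀ R, ∃ R',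
    Close L.numNodes (.node () L R) (.node () .nil R') := by
  induction L with
  | nil => intro R; exact ⟨R, Close.refl _⟩
  | node v X Y hX _ =>
    intro R
    obtain ⟨R', h⟩ := hX (.node () Y R)
    exact ⟨R', ((Close.rotate_root X Y R).trans h).mono (by simp only [numNodes]; omega)⟩

theorem close_leftComb_nil (S : BinaryTree Unit) :
    Close (3 * S.numNodes) S (leftComb .nil S.numNodes) := by
  cases S with
  | nil => exact Close.refl _
  | node v L R =>
    obtain ⟨R', h⟩ := exists_close_node_nil L R
    have h1 := close_leftComb _ .nil R' rfl
    have h2 := rotationCount_le R'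
    have e := h.1
    rw [e]
    simp only [numNodes] at e
    have e' : (node () nil R').numNodes = R'.numNodes + 1 := by simp only [numNodes]; omega
    rw [e']
    -- The cost is at most `L.numNodes` for clearing the left subtree and `2 * R'.numNodes` for
    -- building the comb, where `R'` has one caret less than `S`.
    exact (h.trans h1).mono (by omega)

/-- The length of an element of Thompson's group `F` is at most linear in the number of carets. -/
theorem close_of_numNodes_eq {n : ℕ} {S T : BinaryTree Unit} (hS : S.numNodes = n)
    (hT : T.numNodes = n) : Close (6 * n) S T := by
  have h1 := close_leftComb_nil S
  have h2 := close_leftComb_nil T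
  rw [hS] at h1
  rw [hT] at h2
  exact (h1.trans h2.symm).mono (by omega)

/-- The trees are exchanged by multiplying on both sides by elements of F, each of length at most `6
* n`. Up to a linear error only the braid matters. -/
theorem lengthLE_change_trees {n k : ℕ} (D : TreeBraidTree n) (h : LengthLE (BV.mk D) k)
    {S T : BinaryTree Unit} (hS : S.numNodes = n) (hT : T.numNodes = n) :
    LengthLE (BV.mk ⟨S, T, hS, hT, D.braid⟩) (12 * n + k) := by
  obtain ⟨e1, h1⟩ := close_of_numNodes_eq hS D.numNodes_domain
  obtain ⟨e2, h2⟩ := close_of_numNodes_eq D.numNodes_range hT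
  have h3 := (h1.mul h).mul h2
  rw [treePair_mul_mk, mk_mul_treePair ⟨S, D.range, hS, D.numNodes_range, D.braid⟩ e2] at h3
  exact h3.mono (by omega)

/-! ### Braids that pull one strand to the left; generation by X -/

theorem pullBraid_zero (m : ℕ) : pullBraid m 0 = 1 := rfl

theorem pullBraid_succ (m k : ℕ) : pullBraid m (k + 1) = artin m k * pullBraid m k := by
  simp [pullBraid, List.range_succ]

/-- Strand `0` only passes under the pulled strand, and so do both of its copies. -/
theorem split_pullBraid_zero {m k : ℕ} (h : k + 1 < m) :
    split (pullBraid m (k + 1)) 0 = pullBraid (m + 1) (k + 1 + 1) := by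
  induction k with
  | zero =>
    rw [pullBraid_succ, pullBraid_zero, mul_one, split_artin (by omega), splitArtin_self,
      pullBraid_succ, pullBraid_succ, pullBraid_zero, mul_one]
  | succ k ih =>
    rw [pullBraid_succ, split_mul, split_artin h, splitArtin_of_lt (by omega), strandEnd_artin h,
      if_neg (by omega), if_neg (by omega), ih (by omega), ← pullBraid_succ]

theorem split_pullBraid_of_lt {m k j : ℕ} (h : k < m) (hj : k < j) :
    split (pullBraid m k) j = pullBraid (m + 1) k := by
  induction k with
  | zero => rw [pullBraid_zero, split_one, pullBraid_zero]
  | succ k ih =>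
    rw [pullBraid_succ, split_mul, split_artin h, splitArtin_of_gt (by omega), strandEnd_artin h,
      if_neg (by omega), if_neg (by omega), ih (by omega) (by omega), ← pullBraid_succ]

/-- On suitable trees the braid is a repeated splitting of a single generator: of τ₁ if the pulled
strand is the last one, of σ₁ otherwise. Splitting strand `0` adds strands to be crossed, splitting
strand `2` of σ₁ adds strands to the right that are not involved. -/
theorem exists_pullBraid {n k : ℕ} (hk : k < n) : ∃ D : TreeBraidTree n,
    D.braid = pullBraid (n + 1) (k + 1) ∧ LengthLE (BV.mk D) 1 := by
  have step : ∀ {n k : ℕ}, k < n → (∃ D : TreeBraidTree n,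
      D.braid = pullBraid (n + 1) (k + 1) ∧ LengthLE (BV.mk D) 1) →
      ∃ D : TreeBraidTree (n + 1),
        D.braid = pullBraid (n + 1 + 1) (k + 1 + 1) ∧ LengthLE (BV.mk D) 1 := by
    rintro n k hk ⟨D, h1, h2⟩
    refine ⟨D.split 0, ?_, by rwa [mk_split _ (by omega)]⟩
    change split D.braid 0 = _
    rw [h1, split_pullBraid_zero (by omega)]
  induction n generalizing k with
  | zero => omega
  | succ n ih =>
    match k with
    | k + 1 => exact step (by omega) (ih (by omega))
    | 0 =>
      match n with
      | 0 => exact ⟨⟨allRight 1, allRight 1, rfl, rfl, artin 2 0⟩, by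
          rw [pullBraid_succ, pullBraid_zero, mul_one], LengthLE.letter .τ₁⟩
      | 1 => exact ⟨⟨allRight 2, allRight 2, rfl, rfl, artin 3 0⟩, by
          rw [pullBraid_succ, pullBraid_zero, mul_one], LengthLE.letter .σ₁⟩
      | n + 2 =>
        obtain ⟨D, h1, h2⟩ := ih (k := 0) (by omega)
        refine ⟨D.split 2, ?_, by rwa [mk_split _ (by omega)]⟩
        change split D.braid 2 = _
        rw [h1, split_pullBraid_of_lt (by omega) (by omega)]

/-- The length of a diagram whose braid pulls one strand over to position `0` is at most linear in
the number of carets. -/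
theorem lengthLE_pullBraid {n k : ℕ} (hk : k ≤ n) {S T : BinaryTree Unit} (hS : S.numNodes = n)
    (hT : T.numNodes = n) : LengthLE (BV.mk ⟨S, T, hS, hT, pullBraid (n + 1) k⟩) (12 * n + 1) := by
  match k with
  | 0 =>
    rw [pullBraid_zero, mk_eq_treePair]
    exact (close_of_numNodes_eq hS hT).2.mono (by omega)
  | k + 1 =>
    obtain ⟨D, h1, h2⟩ := exists_pullBraid hk
    rw [← h1]
    exact lengthLE_change_trees D h2 hS hT

/-- The set `X` generates `BV`. -/
theorem exists_lengthLE (g : BV) : ∃ k, LengthLE g k := by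
  obtain ⟨n, ⟨S, T, hS, hT, b⟩, rfl⟩ := BV.exists_rep g
  have key : ∃ k, LengthLE (BV.mk ⟨S, S, hS, hS, b⟩) k := by
    clear hT T
    induction b using braid_induction with
    | one => exact ⟨0, by rw [BV.mk_eq_one rfl rfl]; exact LengthLE.one⟩
    | gen k hk =>
      -- An Artin generator is the quotient of two consecutive pulls: `pullBraid (k + 1) = artin k *
      -- pullBraid k`.
      refine ⟨_, (?_ : LengthLE _ ((12 * n + 1) + (12 * n + 1)))⟩
      have h := (lengthLE_pullBraid (k := k + 1) (by omega) hS hS).mul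
        (lengthLE_pullBraid (k := k) (by omega) hS hS).inv
      rw [BV.inv_mk, BV.mk_mul_mk rfl] at h
      simpa only [TreeBraidTree.comp, TreeBraidTree.inv, pullBraid_succ, mul_inv_cancel_right]
        using h
    | mul b c hb hc =>
      obtain ⟨k, hk⟩ := hb
      obtain ⟨l, hl⟩ := hc
      have h := hk.mul hl
      rw [BV.mk_mul_mk rfl] at h
      exact ⟨_, h⟩
    | inv b hb =>
      obtain ⟨k, hk⟩ := hb
      exact ⟨k, hk.inv⟩
  obtain ⟨k, hk⟩ := key
  exact ⟨_, lengthLE_change_trees _ hk hS hT⟩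

/-! ### Word length and its comparison with the number of carets -/

theorem exists_isMinimalWord (g : BV) : ∃ w : Word, IsMinimalWord w g := by
  obtain ⟨k, w, hw, -⟩ := exists_lengthLE g
  obtain ⟨w', h1, h2⟩ := Nat.sInf_mem (s := {k | ∃ w : Word, w.eval = g ∧ w.length = k})
    ⟨_, w, hw, rfl⟩
  exact ⟨w', h1, h2⟩

theorem wordLength_le_length (w : Word) : wordLength w.eval ≤ w.length := Nat.sInf_le ⟨w, rfl, rfl⟩

theorem LengthLE.wordLength_le {g : BV} {k : ℕ} (h : LengthLE g k) : wordLength g ≤ k := by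
  obtain ⟨w, rfl, h⟩ := h
  exact (wordLength_le_length w).trans h

theorem lengthLE_wordLength (g : BV) : LengthLE g (wordLength g) := by
  obtain ⟨w, h1, h2⟩ := exists_isMinimalWord g
  exact ⟨w, h1, h2.le⟩

theorem wordLength_mul_le (g h : BV) : wordLength (g * h) ≤ wordLength g + wordLength h :=
  ((lengthLE_wordLength g).mul (lengthLE_wordLength h)).wordLength_le

theorem wordLength_inv (g : BV) : wordLength g⁻¹ = wordLength g := by
  have key : ∀ g : BV, wordLength g⁻¹ ≤ wordLength g := fun g =>
    (lengthLE_wordLength g).inv.wordLength_le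
  exact le_antisymm (key g) (by simpa only [inv_inv] using key g⁻¹)

/-- Multiplication by a word changes the length by at most the length of the word. -/
theorem wordLength_le_mul_eval (g : BV) (w : Word) :
    wordLength g ≤ wordLength (g * w.eval) + w.length := by
  have h1 := wordLength_mul_le (g * w.eval) w.eval⁻¹
  rw [mul_inv_cancel_right, wordLength_inv] at h1
  have := wordLength_le_length w
  omega

theorem wordLength_pos {g : BV} (h : g ≠ 1) : 0 < wordLength g := by
  by_contra hc
  obtain ⟨w, rfl, h2⟩ := lengthLE_wordLength g
  have : w = [] := List.eq_nil_of_length_eq_zero (by omega)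
  exact h (by rw [this, Word.eval_nil])

theorem numCarets_one : (1 : BV).numCarets = 0 :=
  Nat.le_zero.1 (BV.numCarets_le (D := TreeBraidTree.idOn .nil) rfl)

theorem numCarets_toBV_le (a : Letter) : a.toBV.numCarets ≤ 3 := by
  cases a
  · exact (BV.numCarets_le rfl).trans (by omega)
  · exact BV.numCarets_le rfl
  · exact (BV.numCarets_le rfl).trans (by omega)
  · exact (BV.numCarets_le rfl).trans (by omega)

theorem numCarets_le_wordLength (g : BV) : g.numCarets ≤ 3 * wordLength g := by
  have key : ∀ w : Word, w.eval.numCarets ≤ 3 * w.length := by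
    intro w
    induction w with
    | nil => rw [Word.eval_nil, numCarets_one]; simp
    | cons a w ih =>
      rw [Word.eval_cons]
      have h1 := BV.numCarets_mul_le (if a.2 then a.1.toBV else a.1.toBV⁻¹) (Word.eval w)
      have h2 : BV.numCarets (if a.2 then a.1.toBV else a.1.toBV⁻¹) ≤ 3 := by
        split_ifs
        · exact numCarets_toBV_le _
        · exact (BV.numCarets_inv_le _).trans (numCarets_toBV_le _)
      simp only [List.length_cons]
      omega
  obtain ⟨w, rfl, h⟩ := lengthLE_wordLength g
  have := key w
  omega

/-! ### Commutation with the terminal elements -/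

/-- Splitting a strand twice, the result does not depend on which of the two copies is split. -/
theorem split_split_self {m : ℕ} (b : BraidGroup m) : ∀ i,
    split (split b i) i = split (split b i) (i + 1) := by
  have end_self : ∀ (b : BraidGroup m) i, strandEnd (split b i) i = strandEnd b i := by
    intro b i
    have := (strandEnd_split b i).2 i
    simpa [skip] using this
  induction b using braid_induction with
  | one => intro i; simp only [split_one]
  | gen k hk =>
    intro i
    have d1 := fun i => split_artin (m := m + 1) (k := k) (by omega) i
    have d2 := fun i => split_artin (m := m + 1) (k := k + 1) (by omega) i
    have t1 := fun i => strandEnd_artin (m := m + 1) (k := k) (by omega) i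
    have t2 := fun i => strandEnd_artin (m := m + 1) (k := k + 1) (by omega) i
    rw [split_artin hk]
    rcases (by omega : i < k ∨ i = k ∨ i = k + 1 ∨ k + 1 < i) with h | h | h | h <;>
    simp (disch := omega) only [splitArtin_of_lt, splitArtin_of_eq, splitArtin_of_eq_succ,
      splitArtin_of_gt, split_mul, d1, d2, t1, t2, if_pos, if_neg, mul_assoc]
  | mul b c hb hc =>
    intro i
    rw [split_mul, split_mul, split_mul, hb, end_self, hc, (strandEnd_split b i).1]
  | inv b hb =>
    intro i
    have h1 := split_inv b (strandEnd b⁻¹ i)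
    have h2 := split_inv (split b (strandEnd b⁻¹ i)) (strandEnd b⁻¹ i)
    have h3 := split_inv (split b (strandEnd b⁻¹ i)) (strandEnd b⁻¹ i + 1)
    rw [end_self] at h2
    rw [(strandEnd_split b _).1] at h3
    rw [strandEnd_inv_right] at h1 h2 h3
    rw [h1, h2, h3, hb]

/-- The depth of the leftmost leaf. -/
def leftDepth : BinaryTree Unit → ℕ
  | .nil => 0
  | .node _ l _ => leftDepth l + 1

theorem leftDepth_addCaret_zero (t : BinaryTree Unit) :
    leftDepth (addCaret t 0) = leftDepth t + 1 := by
  induction t with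
  | nil => rfl
  | node v l r hl _ => simp only [addCaret, numLeaves_pos, if_true, leftDepth, hl]

theorem IsTop.leftDepth_le {t : BinaryTree Unit} : ∀ {s}, IsTop t s →
    leftDepth t ≤ leftDepth s := by
  induction t with
  | nil => intro s _; simp [leftDepth]
  | node v l r hl _ =>
    intro s h
    cases s with
    | nil => exact h.elim
    | node w a b => simpa only [leftDepth, Nat.add_le_add_iff_right] using hl h.1

theorem leftDepth_treeJoin (t : BinaryTree Unit) : ∀ {s}, leftDepth t = leftDepth s →
    leftDepth (treeJoin t s) = leftDepth t := by
  induction t with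
  | nil => intro s h; exact h.symm
  | node v l r hl _ =>
    intro s h
    cases s with
    | nil => rfl
    | node w a b =>
      simp only [leftDepth, Nat.add_right_cancel_iff] at h
      simp only [treeJoin, leftDepth, hl h]

theorem cut_replicate_false (t : BinaryTree Unit) : ∀ {a i w},
    cut t (List.replicate a false) = some (i, w) → i = 0 ∧ leftDepth t + w.length = a := by
  induction t with
  | nil =>
    intro a i w h
    simp only [cut, Option.some.injEq, Prod.mk.injEq] at h
    simp [← h.1, ← h.2, leftDepth]
  | node v l r hl _ =>
    intro a i w h
    cases a with
    | zero => simp [cut] at h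
    | succ a =>
      rw [List.replicate_succ] at h
      have := hl h
      simp only [leftDepth]; omega

/-- The element that acts as `x₀` on the cone at the leftmost leaf of `S` and is trivial
elsewhere. -/
def coneShift (S : BinaryTree Unit) : BV :=
  treePair (addCaret (addCaret S 0) 0) (addCaret (addCaret S 0) 1)
    (by simp only [numNodes_addCaret])

/-- A caret on another leaf of `t` appears in both trees of `coneShift t` at the leaf `i + 2`, two
carets having been added to its left; it is therefore a splitting. -/
theorem coneShift_addCaret {t : BinaryTree Unit} {i : ℕ} (h0 : i ≠ 0) (hi : i < t.numLeaves) :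
    coneShift (addCaret t i) = coneShift t := by
  have e1 := addCaret_addCaret t 0 i h0.symm (numLeaves_pos t) hi
  have e2 := addCaret_addCaret (addCaret t 0) 0 (i + 1) (by omega)
    (by rw [numLeaves_addCaret]; omega) (by rw [numLeaves_addCaret]; omega)
  have e3 := addCaret_addCaret (addCaret t 0) 1 (i + 1) (by omega)
    (by rw [numLeaves_addCaret]; omega) (by rw [numLeaves_addCaret]; omega)
  have s1 : skip 0 i = i + 1 := by rw [skip, if_neg (by omega)]
  have s2 : skip i 0 = 0 := by rw [skip, if_pos (by omega)]
  have s3 : skip 0 (i + 1) = i + 2 := by rw [skip, if_neg (by omega)]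
  have s4 : skip (i + 1) 0 = 0 := by rw [skip, if_pos (by omega)]
  have s5 : skip 1 (i + 1) = i + 2 := by rw [skip, if_neg (by omega)]
  have s6 : skip (i + 1) 1 = 1 := by rw [skip, if_pos (by omega)]
  rw [s1, s2] at e1
  rw [s3, s4, e1] at e2
  rw [s5, s6, e1] at e3
  symm
  rw [coneShift, coneShift, ← treePair_addCaret _ (i := i + 2)
    (by rw [numLeaves_addCaret, numLeaves_addCaret]; omega)]
  simp only [e2, e3]

theorem coneShift_eq_of_isTop {t s : BinaryTree Unit} (h : IsTop t s)
    (hd : leftDepth t = leftDepth s) : coneShift t = coneShift s := by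
  induction hk : s.numNodes - t.numNodes generalizing t with
  | zero =>
    by_cases hts : t = s
    · rw [hts]
    · obtain ⟨i, _, h2⟩ := exists_addCaret_isTop t h hts
      have := h2.numNodes_le
      rw [numNodes_addCaret] at this
      omega
  | succ k ih =>
    by_cases hts : t = s
    · rw [hts]
    · obtain ⟨i, hi, h2⟩ := exists_addCaret_isTop t h hts
      have h3 := h2.leftDepth_le
      have h4 := (isTop_addCaret t i).leftDepth_le
      have h0 : i ≠ 0 := by
        rintro rfl
        rw [leftDepth_addCaret_zero] at h3
        omega
      rw [← ih h2 (by omega) (by rw [numNodes_addCaret]; omega), coneShift_addCaret h0 hi]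

/-- If the leftmost leaves are equally deep, the least common expansion adds carets only away from
leaf `0`. -/
theorem coneShift_congr {s t : BinaryTree Unit} (h : leftDepth s = leftDepth t) :
    coneShift s = coneShift t := by
  have h1 := leftDepth_treeJoin s h
  rw [coneShift_eq_of_isTop (isTop_treeJoin_left s t) h1.symm,
    coneShift_eq_of_isTop (isTop_treeJoin_right s t) (h.symm.trans h1.symm)]

theorem terminal_succ (L : ℕ) :
    terminal (L + 1) = Letter.x₀.toBV * terminal L * Letter.x₀.toBV⁻¹ := by
  simp only [terminal]
  rw [pow_succ', show (-((L + 1 : ℕ) : ℤ) + 1) = (-(L : ℤ) + 1) + -1 by push_cast; ring, zpow_add,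
    zpow_neg_one]
  group

theorem addCaret_addCaret_node (X Y : BinaryTree Unit) :
    addCaret (addCaret (.node () X Y) 0) 0 = .node () (addCaret (addCaret X 0) 0) Y ∧
    addCaret (addCaret (.node () X Y) 0) 1 = .node () (addCaret (addCaret X 0) 1) Y := by
  have h1 := numLeaves_pos X
  constructor
  · simp only [addCaret, numLeaves_pos, if_true]
  · simp only [addCaret, numLeaves_pos, if_true]
    rw [if_pos (by rw [numLeaves_addCaret]; omega)]

/-- For `L = 2` the word is multiplied out as pairs of trees. Passing from `L` to `L + 1` is
conjugation by x₀, which carries the cone at 00 to the cone at 0 and so makes the support one level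
deeper. -/
theorem coneShift_eq_terminal (a : ℕ) : ∀ S : BinaryTree Unit, leftDepth S = a + 1 →
    coneShift S = terminal (a + 2) := by
  induction a with
  | zero =>
    intro S h
    rw [coneShift_congr (t := .node () .nil .nil) h]
    have e : terminal (0 + 2) = Letter.x₀.toBV * Letter.x₀.toBV * Letter.x₁.toBV⁻¹ *
        Letter.x₀.toBV⁻¹ := by
      simp only [terminal]
      rw [zero_add, pow_two, show (-((2 : ℕ) : ℤ) + 1) = -1 by norm_num, zpow_neg_one]
    rw [e]
    nth_rewrite 1 [toBV_x₀ (.node () .nil .nil) .nil .nil]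
    nth_rewrite 1 [toBV_x₀ .nil .nil (.node () .nil .nil)]
    rw [toBV_x₀ .nil (.node () .nil .nil) .nil, toBV_x₁ .nil .nil .nil .nil, treePair_inv,
      treePair_inv, treePair_mul_treePair, treePair_mul_treePair, treePair_mul_treePair]
    rfl
  | succ a ih =>
    intro S h
    match S with
    | .nil => simp [leftDepth] at h
    | .node _ .nil _ => simp [leftDepth] at h
    | .node _ (.node _ X Y) Z =>
      have hX : leftDepth X = a := by simp only [leftDepth] at h; omega
      have e : coneShift (.node () (.node () X Y) Z) = coneShift (.node () (.node () X .nil) .nil) :=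
        coneShift_congr (by simp only [leftDepth])
      refine e.trans ?_
      rw [terminal_succ,
        ← ih (.node () X (.node () .nil .nil)) (by simp only [leftDepth, hX])]
      obtain ⟨e1, e2⟩ := addCaret_addCaret_node X (.node () .nil .nil)
      obtain ⟨e3, e4⟩ := addCaret_addCaret_node (.node () X .nil) .nil
      obtain ⟨e5, e6⟩ := addCaret_addCaret_node X .nil
      simp only [coneShift, e1, e2, e3, e4, e5, e6]
      nth_rewrite 1 [toBV_x₀ (addCaret (addCaret X 0) 0) .nil .nil]
      rw [toBV_x₀ (addCaret (addCaret X 0) 1) .nil .nil, treePair_inv, treePair_mul_treePair,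
        treePair_mul_treePair]

/-- Split strand `0`, then either its first or its second copy. The two diagrams represent the same
element and have the same braid by `split_split_self`; the cone shifts of the domain and of the
range exchange their trees. -/
theorem coneShift_mul_comm {n : ℕ} (D : TreeBraidTree n) (h : strandEnd D.braid 0 = 0) :
    coneShift D.domain * BV.mk D = BV.mk D * coneShift D.range := by
  have r1 : ((D.split 0).split 0).range = addCaret (addCaret D.range 0) 0 := by
    have := (strandEnd_split D.braid 0).2 0
    simp only [skip, le_refl, if_true, h, if_true] at this
    simp only [TreeBraidTree.split, h, this]
  have r2 : ((D.split 0).split 1).range = addCaret (addCaret D.range 0) 1 := by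
    have := (strandEnd_split D.braid 0).1
    simp only [h, zero_add] at this
    simp only [TreeBraidTree.split, h, this]
  have e1 := mk_split (D.split 0) (i := 0) (by omega)
  have e2 := mk_split (D.split 0) (i := 1) (by omega)
  rw [mk_split D (by omega)] at e1 e2
  have e3 : BV.mk D * coneShift D.range = BV.mk ((D.split 0).split 0) *
      treePair ((D.split 0).split 0).range ((D.split 0).split 1).range
        (by rw [TreeBraidTree.numNodes_range, TreeBraidTree.numNodes_range]) := by
    simp only [coneShift, r1, r2, e1]
  have e4 : coneShift D.domain * BV.mk D = treePair ((D.split 0).split 0).domain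
      ((D.split 0).split 1).domain
        (by rw [TreeBraidTree.numNodes_domain, TreeBraidTree.numNodes_domain]) *
      BV.mk ((D.split 0).split 1) := by
    rw [e2]; rfl
  rw [e3, e4, mk_mul_treePair, treePair_mul_mk]
  congr 2
  exact (split_split_self D.braid 0).symm

theorem exists_leftDepth_eq {n : ℕ} (D : TreeBraidTree n) (h : strandEnd D.braid 0 = 0) {a : ℕ}
    (h1 : leftDepth D.domain = a) (h2 : leftDepth D.range = a) {b : ℕ} (hab : a ≤ b) :
    ∃ (m : ℕ) (E : TreeBraidTree m), BV.mk E = BV.mk D ∧ strandEnd E.braid 0 = 0 ∧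
      leftDepth E.domain = b ∧ leftDepth E.range = b := by
  induction b, hab using Nat.le_induction with
  | base => exact ⟨n, D, rfl, h, h1, h2⟩
  | succ b _ ih =>
    obtain ⟨m, E, e1, e2, e3, e4⟩ := ih
    refine ⟨m + 1, E.split 0, by rw [mk_split _ (by omega), e1], ?_, ?_, ?_⟩
    · change strandEnd (split E.braid 0) 0 = 0
      have := (strandEnd_split E.braid 0).2 0
      simpa only [skip, le_refl, if_true, e2] using this
    · rw [TreeBraidTree.split, leftDepth_addCaret_zero, e3]
    · simp only [TreeBraidTree.split, e2, leftDepth_addCaret_zero, e4]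

/-- Strand `0` of the reduced diagram joins the leftmost leaves, which are equally deep. Splitting
it deepens both until the depth is `L - 1`, and then both cone shifts in `coneShift_mul_comm` equal
`terminal L`. -/
theorem commute_terminal {g : BV} {a L : ℕ}
    (hg : g.Maps (List.replicate a false) (List.replicate a false)) (hL : a + 2 ≤ L) :
    Commute g (terminal L) := by
  obtain ⟨i, w, h1, h2⟩ := hg
  obtain ⟨rfl, h3⟩ := cut_replicate_false _ h1
  obtain ⟨h4, h5⟩ := cut_replicate_false _ h2
  obtain ⟨m, E, e1, e2, e3, e4⟩ := exists_leftDepth_eq (BV.reduced g).2 h4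
    (a := leftDepth (BV.reduced g).2.domain) rfl (by omega) (b := L - 1) (by omega)
  rw [BV.mk_reduced] at e1
  have key := coneShift_mul_comm E e2
  obtain ⟨b, rfl⟩ : ∃ b, L = b + 2 := ⟨L - 2, by omega⟩
  rw [coneShift_eq_terminal b _ e3, coneShift_eq_terminal b _ e4, e1] at key
  exact key.symm

/-! ### Lower bounds for the number of carets along the path -/

namespace BV

theorem maps_x₀_left : Letter.x₀.toBV.Maps [false, false] [false] :=
  maps_mk ⟨0, [], rfl, by rw [strandEnd_one]; rfl⟩

theorem maps_x₀_middle : Letter.x₀.toBV.Maps [false, true] [true, false] :=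
  maps_mk ⟨1, [], rfl, by rw [strandEnd_one]; rfl⟩

theorem maps_x₀_right : Letter.x₀.toBV.Maps [true] [true, true] :=
  maps_mk ⟨2, [], rfl, by rw [strandEnd_one]; rfl⟩

theorem maps_x₁_left : Letter.x₁.toBV.Maps [false] [false] :=
  maps_mk ⟨0, [], rfl, by rw [strandEnd_one]; rfl⟩

theorem maps_x₁_middle : Letter.x₁.toBV.Maps [true, false, false] [true, false] :=
  maps_mk ⟨1, [], rfl, by rw [strandEnd_one]; rfl⟩

theorem maps_x₁_right : Letter.x₁.toBV.Maps [true, true] [true, true, true] :=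
  maps_mk ⟨3, [], rfl, by rw [strandEnd_one]; rfl⟩

theorem maps_x₀_pow_left (m : ℕ) :
    (Letter.x₀.toBV ^ m).Maps (List.replicate (m + 1) false) [false] := by
  induction m with
  | zero => rw [pow_zero]; exact maps_one _
  | succ m ih =>
    rw [pow_succ']
    exact (maps_x₀_left.append (List.replicate m false)).mul ih

theorem maps_x₀_inv_pow_left (m : ℕ) :
    (Letter.x₀.toBV⁻¹ ^ m).Maps [false] (List.replicate (m + 1) false) := by
  rw [inv_pow]
  exact (maps_x₀_pow_left m).inv

theorem maps_x₀_pow_right (m : ℕ) :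
    (Letter.x₀.toBV ^ m).Maps [true] (List.replicate (m + 1) true) := by
  induction m with
  | zero => rw [pow_zero]; exact maps_one _
  | succ m ih =>
    rw [pow_succ', List.replicate_succ']
    exact maps_x₀_right.mul (ih.append [true])

theorem maps_x₀_inv_pow_right (m : ℕ) :
    (Letter.x₀.toBV⁻¹ ^ m).Maps (List.replicate (m + 1) true) [true] := by
  rw [inv_pow]
  exact (maps_x₀_pow_right m).inv

/-- Each factor x₀⁻¹ shortens a prefix 11 to 1 and sends the cones at 0 and 10 into the cone at 0. A
word with at most `L` leading ones followed by 0 thus ends in the cone at 0 after `L` factors. -/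
theorem exists_maps_x₀_inv_pow (L : ℕ) : ∀ {u : List Bool}, u.length ≤ L →
    ∃ z, (Letter.x₀.toBV⁻¹ ^ L).Maps (u ++ [false]) (false :: z) := by
  induction L with
  | zero =>
    intro u hu
    rw [List.eq_nil_of_length_eq_zero (Nat.le_zero.1 hu), pow_zero]
    exact ⟨[], maps_one _⟩
  | succ L ih =>
    intro u hu
    obtain ⟨z, hz⟩ := ih (u := []) (by simp)
    rw [pow_succ']
    match u with
    | [] => exact ⟨_, maps_x₀_left.inv.mul (hz.append [false])⟩
    | false :: u =>
      exact ⟨_, (maps_x₀_left.inv.append (u ++ [false])).mul (hz.append (false :: (u ++ [false])))⟩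
    | [true] => exact ⟨_, maps_x₀_middle.inv.mul (hz.append [true])⟩
    | true :: false :: u =>
      exact ⟨_, (maps_x₀_middle.inv.append (u ++ [false])).mul (hz.append (true :: (u ++ [false])))⟩
    | true :: true :: u =>
      simp only [List.length_cons] at hu
      obtain ⟨z, hz⟩ := ih (u := true :: u) (by simp only [List.length_cons]; omega)
      exact ⟨z, (maps_x₀_right.inv.append (u ++ [false])).mul hz⟩

variable {g : BV}

/-- A rotation at the root of the range tree does not reduce the number of carets if the left child
of the root is not a leaf. -/
theorem numCarets_le_mul_x₀_inv (hg : ∀ u, ¬ g.Maps u [false]) :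
    g.numCarets ≤ (g * Letter.x₀.toBV⁻¹).numCarets := by
  set h := g * Letter.x₀.toBV⁻¹ with hh
  have hgh : g = h * Letter.x₀.toBV := by rw [hh, inv_mul_cancel_right]
  have key : ∀ u, ¬ h.Maps u [false, false] := by
    intro u hu
    have := hu.mul maps_x₀_left
    rw [← hgh] at this
    exact hg _ this
  have hr := mk_reduced h
  -- So 00 is an inner vertex of the range tree of `h`. Multiplication by x₀ is then a rotation of
  -- this tree that needs no splitting, and yields a diagram of `g` with as many carets as `h` has.
  have hm : ∀ x, cut (reduced h).2.range [false, false] ≠ some x := by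
    intro x hx
    obtain ⟨u, hu⟩ := TreeBraidTree.exists_maps_of_cut_range hx
    exact key u hu
  change _ ≤ (reduced h).1
  generalize reduced h = R at hr hm ⊢
  obtain ⟨n, S, T, hS, hT, b⟩ := R
  simp only at hr hm ⊢
  match T with
  | .nil => exact absurd rfl (hm _)
  | .node _ .nil _ => exact absurd rfl (hm _)
  | .node _ (.node _ X Y) Z =>
    refine numCarets_le (D := ⟨S, .node () X (.node () Y Z), hS, ?_, b⟩) ?_
    · simp only [numNodes] at hT ⊢; omega
    · rw [hgh, ← hr, toBV_x₀ X Y Z]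
      exact (mk_mul_treePair ⟨S, .node () (.node () X Y) Z, hS, hT, b⟩ _).symm

theorem numCarets_le_mul_x₀_inv_pow (hg : ∀ u, ¬ g.Maps u [false]) (m : ℕ) :
    g.numCarets ≤ (g * Letter.x₀.toBV⁻¹ ^ m).numCarets := by
  induction m generalizing g with
  | zero => rw [pow_zero, mul_one]
  | succ m ih =>
    rw [pow_succ', ← mul_assoc]
    -- The hypothesis survives the step: if the cone at `u` went to 0 under `g * x₀⁻¹`, the cone at
    -- `u` followed by 0 would go to 0 under `g`.
    refine (numCarets_le_mul_x₀_inv hg).trans (ih fun u hu => hg (u ++ [false]) ?_)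
    have := (hu.append [false]).mul maps_x₀_left
    rwa [inv_mul_cancel_right] at this

/-- Let `g` carry `u` to 1^(L+1); then `u` has length at least `L + 1 - N(g)`. The power of x₀⁻¹
brings this cone to 1, where x₁ stretches it unevenly. The closing power of x₀ stretches the cone at
1 evenly, so the estimate is uniform in `j`. -/
theorem le_numCarets_mul_second (g : BV) {L : ℕ} (hL : g.numCarets ≤ L) (j : ℕ) :
    L ≤ g.numCarets +
      (g * (Letter.x₀.toBV⁻¹ ^ L * Letter.x₁.toBV * Letter.x₀.toBV ^ j)).numCarets := by
  obtain ⟨u, hu⟩ := exists_maps (g := g⁻¹) (u := List.replicate (L + 1) true)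
    (by have := numCarets_inv_le g; rw [List.length_replicate]; omega)
  have h1 := hu.length_le
  have h2 := numCarets_inv_le g
  replace hu := hu.inv
  rw [inv_inv] at hu
  rw [List.length_replicate] at h1
  have e1 := (hu.append [false, false]).mul
    ((((maps_x₀_inv_pow_right L).append [false, false]).mul maps_x₁_middle).mul
      ((maps_x₀_pow_right j).append [false]))
  have e2 := (hu.append [true]).mul
    ((((maps_x₀_inv_pow_right L).append [true]).mul maps_x₁_right).mul
      ((maps_x₀_pow_right j).append [true, true]))
  have := length_lt_numCarets e1 e2 (by simp)
  omega

/-- A cone 0^(a+m+1) goes to 0^(a+1), and a word cannot lose more letters than there are carets. -/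
theorem le_numCarets_mul_x₀_pow {a : ℕ}
    (hg : g.Maps (List.replicate a false) (List.replicate a false)) (m : ℕ) :
    m ≤ (g * Letter.x₀.toBV ^ m).numCarets := by
  have h1 := hg.append (List.replicate (m + 1) false)
  rw [← List.replicate_add, add_comm a] at h1
  have h2 := (maps_x₀_pow_left m).append (List.replicate a false)
  rw [← List.replicate_add] at h2
  have := (h1.mul h2).length_le
  simp only [List.length_replicate, List.length_append, List.length_singleton] at this
  omega

/-- The subcones of 0^L at 0^L 00 and 0^L 01 are stretched unequally because of the letter x₁⁻¹, and
the remaining power of x₀⁻¹ does not repair this for any `j`. -/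
theorem lt_numCarets_mul_terminal {a L : ℕ}
    (hg : g.Maps (List.replicate a false) (List.replicate a false)) (hL : a ≤ L) (j : ℕ) :
    L < (g * (Letter.x₀.toBV ^ (L + 1) * Letter.x₁.toBV⁻¹ * Letter.x₀.toBV⁻¹ ^ j)).numCarets := by
  have h1 := hg.append (List.replicate (L - a) false)
  rw [← List.replicate_add, Nat.add_sub_cancel' hL] at h1
  have e1 : (Letter.x₀.toBV ^ (L + 1)).Maps (List.replicate L false ++ [false, false]) [false] := by
    have := maps_x₀_pow_left (L + 1)
    rwa [show L + 1 + 1 = L + 2 from rfl, List.replicate_add] at this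
  have e2 : (Letter.x₀.toBV ^ (L + 1)).Maps (List.replicate L false ++ [false, true])
      [true, false] := by
    have := (maps_x₀_pow_left L).append [true]
    rw [List.replicate_add, List.append_assoc] at this
    rw [pow_succ]
    exact this.mul maps_x₀_middle
  have f1 := (h1.append [false, false]).mul ((e1.mul maps_x₁_left.inv).mul (maps_x₀_inv_pow_left j))
  have f2 := (h1.append [false, true]).mul (e2.mul maps_x₁_middle.inv)
  -- Only the length of `z` matters: the other subcone ends at a word of length `j + 1`.
  have key : ∃ z : List Bool, z.length ≠ j + 1 ∧
      (Letter.x₀.toBV⁻¹ ^ j).Maps [true, false, false] z := by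
    match j with
    | 0 => exact ⟨[true, false, false], by simp, by rw [pow_zero]; exact maps_one _⟩
    | j + 1 =>
      refine ⟨List.replicate (j + 1) false ++ [true, false], by simp, ?_⟩
      rw [pow_succ']
      exact (maps_x₀_middle.inv.append [false]).mul ((maps_x₀_inv_pow_left j).append [true, false])
  obtain ⟨z, hz, hm⟩ := key
  have f3 := f2.mul hm
  rw [mul_assoc] at f3
  have := length_lt_numCarets f1 f3 (by simp; omega)
  simpa using this

end BV

/-! ### The first word -/

theorem exists_maps_of_mem_branches {g : BV} (h : [false] ∈ branches (BV.reduced g).2.range) :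
    ∃ u, g.Maps u [false] := by
  have key : ∀ t : BinaryTree Unit, [false] ∈ branches t → ∃ x, cut t [false] = some x := by
    intro t ht
    match t with
    | .nil => simp [branches] at ht
    | .node _ .nil r => exact ⟨_, rfl⟩
    | .node _ (.node _ a b) r => simp [branches] at ht
  obtain ⟨x, hx⟩ := key _ h
  exact TreeBraidTree.exists_maps_of_cut_range hx

theorem mem_branches_of_maps {g : BV} (hN : g.numCarets ≠ 0) {u : List Bool}
    (h : g.Maps u [false]) : [false] ∈ branches (BV.reduced g).2.range := by
  obtain ⟨i, w, -, h⟩ := h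
  have hn := (BV.reduced g).2.numNodes_range
  change _ = g.numCarets at hn
  match (BV.reduced g).2.range, h, hn with
  | .nil, _, hn => exact absurd hn.symm hN
  | .node _ .nil r, _, _ => simp [branches]
  | .node _ (.node _ a b) r, h, _ => simp [cut] at h

theorem prefix_append_cases {α : Type*} {w a b : List α} (h : w <+: a ++ b) :
    w <+: a ∨ ∃ b', b' <+: b ∧ w = a ++ b' := by
  rcases List.prefix_or_prefix_of_prefix h (List.prefix_append a b) with h1 | ⟨b', rfl⟩
  · exact Or.inl h1
  · exact Or.inr ⟨b', (List.prefix_append_right_inj a).1 h, rfl⟩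

theorem eq_replicate_of_prefix {α : Type*} {w : List α} {k : ℕ} {a : α}
    (h : w <+: List.replicate k a) : ∃ m ≤ k, w = List.replicate m a := by
  refine ⟨w.length, by simpa using h.length_le, ?_⟩
  exact List.eq_replicate_of_mem fun b hb => List.eq_of_mem_replicate (h.subset hb)

theorem Word.eval_singleton_true (a : Letter) : Word.eval [(a, true)] = a.toBV := by
  simp [Word.eval]

theorem Word.eval_singleton_false (a : Letter) : Word.eval [(a, false)] = a.toBV⁻¹ := by
  simp [Word.eval]

/-- No prefix of the first word leads to the identity. -/
theorem mul_eval_ne_one {g : BV} (hN : 3 ≤ g.numCarets) {w : Word} (hw : w <+: firstWord g) :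
    g * w.eval ≠ 1 := by
  intro h
  have hg : w.eval = g⁻¹ := eq_inv_of_mul_eq_one_right h
  have nil_case : w ≠ [] := by
    rintro rfl
    rw [Word.eval_nil, mul_one] at h
    rw [h, numCarets_one] at hN
    omega
  by_cases hb : [false] ∈ branches (BV.reduced g).2.range
  swap
  · rw [firstWord, if_neg hb] at hw
    exact nil_case (List.prefix_nil.1 hw)
  rw [firstWord, if_pos hb] at hw
  obtain ⟨u, hu⟩ := exists_maps_of_mem_branches hb
  replace hu := hu.inv
  rw [← hg] at hu
  have a1 := (BV.maps_x₀_left.append [false]).mul BV.maps_x₀_left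
  have a2 := (BV.maps_x₀_left.append [true]).mul BV.maps_x₀_middle
  have b1 := a1.mul BV.maps_x₁_left.inv
  have b2 := a2.mul BV.maps_x₁_middle.inv
  have c1 := b1.mul BV.maps_x₀_left.inv
  have c2 := b2.mul (BV.maps_x₀_middle.inv.append [false])
  rw [List.prefix_iff_eq_take] at hw
  have hl : w.length ≤ 4 := by rw [hw]; simp
  have hl0 : w.length ≠ 0 := fun h0 => nil_case (List.eq_nil_of_length_eq_zero h0)
  rcases (by omega : w.length = 1 ∨ w.length = 2 ∨ w.length = 3 ∨ w.length = 4) with e | e | e | e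
  · rw [e] at hw
    -- The prefix x₀ is excluded by counting carets: x₀⁻¹ has at most two.
    have hx : g = Letter.x₀.toBV⁻¹ := by
      rw [hw] at hg
      rw [eq_comm, inv_eq_iff_eq_inv, ← hg]
      simp [Word.eval]
    have h2 : Letter.x₀.toBV.numCarets ≤ 2 := BV.numCarets_le rfl
    have h3 := BV.numCarets_inv_le Letter.x₀.toBV
    rw [← hx] at h3
    omega
  -- For the longer prefixes: 0 is a leaf of T₋(g), so g⁻¹ stretches the cone at 0 uniformly,
  -- whereas x₀² and its two continuations stretch 00 and 01 below it unequally.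
  · rw [e] at hw
    have hx : w.eval = Letter.x₀.toBV * Letter.x₀.toBV := by rw [hw]; simp [Word.eval]
    rw [← hx] at a1 a2
    exact BV.not_maps (u := [false]) a1 a2 (by simp) hu
  · rw [e] at hw
    have hx : w.eval = Letter.x₀.toBV * Letter.x₀.toBV * Letter.x₁.toBV⁻¹ := by
      rw [hw]; simp [Word.eval, mul_assoc]
    rw [← hx] at b1 b2
    exact BV.not_maps (u := [false]) b1 b2 (by simp) hu
  · rw [e] at hw
    have hx : w.eval = Letter.x₀.toBV * Letter.x₀.toBV * Letter.x₁.toBV⁻¹ * Letter.x₀.toBV⁻¹ := by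
      rw [hw]; simp [Word.eval, mul_assoc]
    rw [← hx] at c1 c2
    exact BV.not_maps (u := [false]) c1 c2 (by simp) hu

/-- After multiplication by the first word, the left child of the root of the range tree is not a
leaf. -/
theorem not_maps_mul_firstWord {g : BV} (hN : 3 ≤ g.numCarets) (u : List Bool) :
    ¬ (g * (firstWord g).eval).Maps u [false] := by
  intro hu
  by_cases hb : [false] ∈ branches (BV.reduced g).2.range
  · rw [firstWord, if_pos hb] at hu
    obtain ⟨v, hv⟩ := exists_maps_of_mem_branches hb
    have e : Word.eval [(.x₀, true), (.x₀, true), (.x₁, false), (.x₀, false)] =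
        Letter.x₀.toBV * Letter.x₀.toBV * Letter.x₁.toBV⁻¹ * Letter.x₀.toBV⁻¹ := by
      simp [Word.eval, mul_assoc]
    rw [e] at hu
    have c1 := (hv.append [false, false]).mul
      ((((BV.maps_x₀_left.append [false]).mul BV.maps_x₀_left).mul BV.maps_x₁_left.inv).mul
        BV.maps_x₀_left.inv)
    have c2 := (hv.append [false, true]).mul
      ((((BV.maps_x₀_left.append [true]).mul BV.maps_x₀_middle).mul BV.maps_x₁_middle.inv).mul
        (BV.maps_x₀_middle.inv.append [false]))
    -- The words 00 and 010 come from `v` extended by 00 and 01, of equal length; if `u` went to 0,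
    -- they would come from `u` extended by 0 and 10.
    have l1 := congrArg List.length ((hu.append [false]).unique_left c1)
    have l2 := congrArg List.length ((hu.append [true, false]).unique_left c2)
    simp only [List.length_append, List.length_cons, List.length_nil] at l1 l2
    omega
  · rw [firstWord, if_neg hb, Word.eval_nil, mul_one] at hu
    exact hb (mem_branches_of_maps (by omega) hu)

/-! ### The connector -/

theorem cut_replicate_leftDepth (t : BinaryTree Unit) :
    cut t (List.replicate (leftDepth t) false) = some (0, []) := by
  induction t with
  | nil => rfl
  | node v l r hl _ => rw [leftDepth, List.replicate_succ]; exact hl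

theorem leftDepth_le_numNodes (t : BinaryTree Unit) : leftDepth t ≤ t.numNodes := by
  induction t with
  | nil => simp [leftDepth]
  | node v l r hl _ => simp only [leftDepth, numNodes]; omega

theorem strandEnd_pullBraid {m k : ℕ} (h : k < m) : strandEnd (pullBraid m k) k = 0 := by
  induction k with
  | zero => rw [pullBraid_zero, strandEnd_one]
  | succ k ih =>
    rw [pullBraid_succ, strandEnd_mul, strandEnd_artin h, if_neg (by omega), if_pos rfl,
      ih (by omega)]

/-- The product of `g`, an element that acts only near the right end, and the connector of `g`
fixes a neighbourhood of the left end. -/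
theorem exists_maps_mul_connector (g : BV) {L : ℕ} (hL : g.numCarets ≤ L) : ∃ a,
    a ≤ g.numCarets + 1 ∧
    (g * (Letter.x₀.toBV⁻¹ ^ L * Letter.x₁.toBV * Letter.x₀.toBV ^ L) * connector g).Maps
      (List.replicate a false) (List.replicate a false) := by
  set D := (BV.reduced g).2 with hD
  have hk : strandEnd D.braid 0 < g.numCarets + 1 := (strandEnd_lt _ _).2 (by omega)
  have hd := leftDepth_le_numNodes D.domain
  have hdn : D.domain.numNodes = g.numCarets := D.numNodes_domain
  have hrn : D.range.numNodes = g.numCarets := D.numNodes_range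
  have hc := cut_replicate_leftDepth D.domain
  obtain ⟨v, hv, hvl⟩ := exists_cut_eq D.range (i := strandEnd D.braid 0) []
    (by rw [numLeaves_eq_numNodes_succ, hrn]; exact hk)
  have h1 : g.Maps (List.replicate (leftDepth D.domain) false) v := ⟨0, [], hc, hv⟩
  have h2 : (connector g).Maps v (List.replicate (leftDepth D.domain) false) :=
    BV.maps_mk ⟨_, [], hv, by
      change _ = some (strandEnd (pullBraid (g.numCarets + 1) (strandEnd D.braid 0))
        (strandEnd D.braid 0), [])
      rw [strandEnd_pullBraid hk]
      exact hc⟩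
  -- The leaf `v` may be the rightmost one, where the conjugate of x₁ acts nontrivially. Followed by
  -- 0 it is carried by x₀^(-L) into the cone at 0, which x₁ fixes. This is why the exponent is
  -- `leftDepth + 1`.
  obtain ⟨z, hz⟩ := BV.exists_maps_x₀_inv_pow L (u := v)
    (by simp only [List.length_nil] at hvl; omega)
  have h3 := (hz.mul (BV.maps_x₁_left.append z)).mul hz.inv
  rw [inv_pow, inv_inv, ← inv_pow] at h3
  refine ⟨leftDepth D.domain + 1, by omega, ?_⟩
  rw [List.replicate_succ']
  exact ((h1.append [false]).mul h3).mul (h2.append [false])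

theorem wordLength_connector_le (g : BV) : wordLength (connector g) ≤ 12 * g.numCarets + 1 := by
  refine LengthLE.wordLength_le (lengthLE_pullBraid ?_ _ _)
  have := (strandEnd_lt (BV.reduced g).2.braid 0).2 (by omega)
  omega

/-! ### Prefixes of the words, and paths in the Cayley graph -/

theorem eval_secondWord (M : ℕ) (g : BV) : (secondWord M g).eval =
    Letter.x₀.toBV⁻¹ ^ (M * (g.numCarets + 1)) * Letter.x₁.toBV *
      Letter.x₀.toBV ^ (M * (g.numCarets + 1)) := by
  rw [secondWord, Word.eval_append, Word.eval_append, Word.eval_replicate_false,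
    Word.eval_singleton_true, Word.eval_replicate_true]

theorem eval_terminalWord {L : ℕ} (hL : 1 ≤ L) : (terminalWord L).eval = terminal L := by
  obtain ⟨L, rfl⟩ : ∃ l, L = l + 1 := ⟨L - 1, by omega⟩
  rw [terminalWord, Word.eval_append, Word.eval_append, Word.eval_replicate_false,
    Word.eval_singleton_false, Word.eval_replicate_true, terminal, Nat.add_sub_cancel,
    show (-((L + 1 : ℕ) : ℤ) + 1) = -(L : ℤ) by push_cast; ring, zpow_neg, zpow_natCast, inv_pow]

theorem eval_prefix_secondWord {M : ℕ} {g : BV} {w : Word} (h : w <+: secondWord M g) :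
    (∃ m, w.eval = Letter.x₀.toBV⁻¹ ^ m) ∨
    ∃ j, w.eval = Letter.x₀.toBV⁻¹ ^ (M * (g.numCarets + 1)) * Letter.x₁.toBV *
      Letter.x₀.toBV ^ j := by
  rw [secondWord, List.append_assoc] at h
  rcases prefix_append_cases h with h | ⟨w', h', rfl⟩
  · obtain ⟨m, -, rfl⟩ := eq_replicate_of_prefix h
    exact Or.inl ⟨m, Word.eval_replicate_false _ _⟩
  · rcases List.prefix_cons_iff.1 h' with rfl | ⟨t, rfl, ht⟩
    · exact Or.inl ⟨_, by rw [List.append_nil, Word.eval_replicate_false]⟩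
    · obtain ⟨j, -, rfl⟩ := eq_replicate_of_prefix ht
      refine Or.inr ⟨j, ?_⟩
      rw [Word.eval_append, Word.eval_cons, Word.eval_replicate_false, Word.eval_replicate_true,
        if_pos rfl, mul_assoc]

theorem eval_prefix_terminalWord {L : ℕ} {w : Word} (h : w <+: terminalWord L) :
    (∃ m, w.length = m ∧ w.eval = Letter.x₀.toBV ^ m) ∨
    ∃ j, w.eval = Letter.x₀.toBV ^ L * Letter.x₁.toBV⁻¹ * Letter.x₀.toBV⁻¹ ^ j := by
  rw [terminalWord, List.append_assoc] at h
  rcases prefix_append_cases h with h | ⟨w', h', rfl⟩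
  · obtain ⟨m, -, rfl⟩ := eq_replicate_of_prefix h
    exact Or.inl ⟨m, by simp, Word.eval_replicate_true _ _⟩
  · rcases List.prefix_cons_iff.1 h' with rfl | ⟨t, rfl, ht⟩
    · exact Or.inl ⟨L, by simp, by rw [List.append_nil, Word.eval_replicate_true]⟩
    · obtain ⟨j, -, rfl⟩ := eq_replicate_of_prefix ht
      refine Or.inr ⟨j, ?_⟩
      rw [Word.eval_append, Word.eval_cons, Word.eval_replicate_false, Word.eval_replicate_true,
        if_neg (by simp), mul_assoc]

theorem length_secondWord (M : ℕ) (g : BV) :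
    (secondWord M g).length = 2 * (M * (g.numCarets + 1)) + 1 := by
  simp [secondWord]; omega

theorem length_terminalWord {L : ℕ} (hL : 1 ≤ L) : (terminalWord L).length = 2 * L := by
  simp [terminalWord]; omega

theorem length_firstWord_le (g : BV) : (firstWord g).length ≤ 4 := by
  rw [firstWord]; split_ifs <;> simp

/-- A word is the label of a path in the Cayley graph. -/
theorem exists_walk (w : Word) : ∀ g : BV,
    ∃ p : (SimpleGraph.mulCayley X).Walk g (g * w.eval), p.length ≤ w.length ∧
      ∀ h ∈ p.support, ∃ w' : Word, w' <+: w ∧ h = g * w'.eval := by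
  induction w with
  | nil =>
    intro g
    rw [Word.eval_nil, mul_one]
    refine ⟨.nil, le_rfl, fun h hh => ⟨[], List.prefix_rfl, ?_⟩⟩
    rw [SimpleGraph.Walk.support_nil, List.mem_singleton] at hh
    rw [hh, Word.eval_nil, mul_one]
  | cons a w ih =>
    intro g
    rw [Word.eval_cons, ← mul_assoc]
    obtain ⟨p, h1, h2⟩ := ih (g * if a.2 then a.1.toBV else a.1.toBV⁻¹)
    have h3 : ∀ h ∈ p.support, ∃ w' : Word, w' <+: a :: w ∧ h = g * w'.eval := by
      intro h hh
      obtain ⟨w', hw', rfl⟩ := h2 h hh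
      exact ⟨a :: w', List.cons_prefix_cons.2 ⟨rfl, hw'⟩, by rw [Word.eval_cons, mul_assoc]⟩
    -- The Cayley graph is a simple graph without loops, so a letter that does not move the vertex
    -- is skipped.
    by_cases he : g = g * if a.2 then a.1.toBV else a.1.toBV⁻¹
    · refine ⟨p.copy he.symm rfl, ?_, ?_⟩
      · rw [SimpleGraph.Walk.length_copy, List.length_cons]; omega
      · rwa [SimpleGraph.Walk.support_copy]
    · have hadj : (SimpleGraph.mulCayley X).Adj g
          (g * if a.2 then a.1.toBV else a.1.toBV⁻¹) := by
        rw [SimpleGraph.mulCayley_adj']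
        refine ⟨he, a.1.toBV, ⟨a.1, rfl⟩, ?_⟩
        split_ifs
        · exact Or.inl rfl
        · exact Or.inr (by rw [inv_mul_cancel_right])
      refine ⟨.cons hadj p, ?_, ?_⟩
      · rw [SimpleGraph.Walk.length_cons, List.length_cons]; omega
      · intro h hh
        rw [SimpleGraph.Walk.support_cons, List.mem_cons] at hh
        rcases hh with rfl | hh
        · exact ⟨[], List.nil_prefix, by rw [Word.eval_nil, mul_one]⟩
        · exact h3 h hh

/-! ### Assembling the estimates -/

/-- Multiplication by prefixes of the second and the third word does not shorten an element much. -/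
theorem wordLength_le_of_prefix_second_third {g : BV} (hg : ∀ u, ¬ g.Maps u [false]) {w₃ w : Word}
    (h₃ : IsMinimalWord w₃ (connector g)) (hw : w <+: secondWord 38 g ++ w₃) :
    wordLength g ≤ 535 * wordLength (g * w.eval) := by
  -- Without carets every word, in particular 0, would be the image of a cone.
  have hn : 1 ≤ g.numCarets := by
    by_contra hc
    obtain ⟨v, hv⟩ := BV.exists_maps (g := g⁻¹) (u := [false])
      (by have := BV.numCarets_inv_le g; simp only [List.length_singleton]; omega)
    have := hv.inv
    rw [inv_inv] at this
    exact hg v this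
  have l3 : w₃.length ≤ 12 * g.numCarets + 1 := h₃.2.trans_le (wordLength_connector_le g)
  have l2 := length_secondWord 38 g
  have hl := hw.length_le
  rw [List.length_append] at hl
  have h1 := wordLength_le_mul_eval g w
  have second : ∀ j, 37 * (g.numCarets + 1) ≤ 3 * wordLength (g * (Letter.x₀.toBV⁻¹ ^
      (38 * (g.numCarets + 1)) * Letter.x₁.toBV * Letter.x₀.toBV ^ j)) := by
    intro j
    have h2 := BV.le_numCarets_mul_second g (L := 38 * (g.numCarets + 1)) (by omega) j
    have h3 := numCarets_le_wordLength (g * (Letter.x₀.toBV⁻¹ ^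
      (38 * (g.numCarets + 1)) * Letter.x₁.toBV * Letter.x₀.toBV ^ j))
    omega
  -- The choice M = 38: after the second word the length is at least 37(N+1)/3, and the third word
  -- has length at most 12N + 1. The slope 37/3 exceeds 12, so a linear amount is left; M = 37 would
  -- leave only a constant.
  have key : g.numCarets + 1 ≤ 6 * wordLength (g * w.eval) := by
    rcases prefix_append_cases hw with hw | ⟨w', hw', rfl⟩
    · rcases eval_prefix_secondWord hw with ⟨m, e⟩ | ⟨j, e⟩
      · have h2 := BV.numCarets_le_mul_x₀_inv_pow hg m
        have h3 := numCarets_le_wordLength (g * w.eval)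
        rw [e] at h3 ⊢
        omega
      · have h2 := second j
        rw [e]
        omega
    · have h2 := second (38 * (g.numCarets + 1))
      have h3 := wordLength_le_mul_eval (g * (secondWord 38 g).eval) w'
      have h4 := hw'.length_le
      rw [mul_assoc, ← Word.eval_append, eval_secondWord] at h3
      omega
  -- The prefix has length at most 88N + 78 < 88(N+1), which by `key` is at most 528 times the
  -- length of the product; the initial length is larger by no more than this.
  omega

end BraidedThompson

open BraidedThompson in
theorem mainTheorem2 :
    ∃ δ D : ℝ, 0 < δ ∧ 0 < D ∧ ∃ M Q : ℕ, 0 < M ∧ 0 < Q ∧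
      ∀ g : BV, 3 ≤ g.numCarets →
        (∃ p : (SimpleGraph.mulCayley X).Walk g (terminal (Q * wordLength g)),
          (p.length : ℝ) ≤ D * wordLength g ∧
          ∀ h ∈ p.support, δ * wordLength g < wordLength h) ∧
        ∃ w w₁ w₂ w₃ w₄ w₅ : Word, ∃ g₁ g₃ : BV,
          w = w₁ ++ w₂ ++ w₃ ++ w₄ ++ w₅ ∧
          g₁ = g * w₁.eval ∧
          g₃ = g₁ * w₂.eval * w₃.eval ∧
          w₁ = firstWord g ∧
          w₂ = secondWord M g₁ ∧
          IsMinimalWord w₃ (connector g₁) ∧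
          w₄ = terminalWord (Q * wordLength g) ∧
          IsMinimalWord w₅ g₃⁻¹ ∧
          Commute g₃ (terminal (Q * wordLength g)) ∧
          (w.length : ℝ) < D * wordLength g ∧
          (∀ w' : Word, w' <+: w → δ * wordLength g < wordLength (g * w'.eval)) ∧
          g * w.eval = terminal (Q * wordLength g) := by
  -- Q = 5000 makes 5000|g|/3, the lower bound for the length after w₄, larger than the bound
  -- 1429|g| for the length of w₅. The value 20000 leaves room: the proof gives the ratio 10700 and
  -- a total length below 13000|g|.
  refine ⟨1 / 20000, 20000, by norm_num, by norm_num, 38, 5000, by norm_num, by norm_num,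
    fun g hN => ?_⟩
  have hg : 0 < wordLength g := wordLength_pos (by
    rintro rfl
    rw [numCarets_one] at hN
    omega)
  set g₁ := g * (firstWord g).eval with hg₁
  have hK : ∀ u, ¬ g₁.Maps u [false] := not_maps_mul_firstWord hN
  have hg₁pos : 0 < wordLength g₁ := wordLength_pos (mul_eval_ne_one hN List.prefix_rfl)
  have l1 := length_firstWord_le g
  have d1 : wordLength g ≤ wordLength g₁ + 4 := by
    have h1 := wordLength_le_mul_eval g (firstWord g)
    rw [← hg₁] at h1
    omega
  have d2 : wordLength g₁ ≤ wordLength g + 4 := by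
    have h1 := wordLength_mul_le g (firstWord g).eval
    have h2 := wordLength_le_length (firstWord g)
    rw [← hg₁] at h1
    omega
  have d3 := numCarets_le_wordLength g₁
  obtain ⟨w₃, h₃⟩ := exists_isMinimalWord (connector g₁)
  have l2 := length_secondWord 38 g₁
  have l3 : w₃.length ≤ 12 * g₁.numCarets + 1 := h₃.2.trans_le (wordLength_connector_le g₁)
  set g₃ := g₁ * (secondWord 38 g₁).eval * w₃.eval with hg₃
  have d4 : wordLength g₃ ≤ 1429 * wordLength g := by
    have h1 := wordLength_mul_le g₁ ((secondWord 38 g₁ ++ w₃).eval)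
    have h2 := wordLength_le_length (secondWord 38 g₁ ++ w₃)
    rw [Word.eval_append, ← mul_assoc, ← hg₃] at h1
    rw [Word.eval_append, List.length_append] at h2
    omega
  have d5 : wordLength g₁ ≤ 535 * wordLength g₃ := by
    have h1 := wordLength_le_of_prefix_second_third hK h₃ List.prefix_rfl
    rwa [Word.eval_append, ← mul_assoc] at h1
  obtain ⟨w₅, h₅⟩ := exists_isMinimalWord g₃⁻¹
  have l5 : w₅.length = wordLength g₃ := h₅.2.trans (wordLength_inv g₃)
  -- The depth `a` is at most N(g₁) + 1, hence far below 5000|g|, as is needed for commutation.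
  obtain ⟨a, ha, hfix⟩ := exists_maps_mul_connector g₁ (L := 38 * (g₁.numCarets + 1)) (by omega)
  rw [← eval_secondWord, ← h₃.1, ← hg₃] at hfix
  have hcomm : Commute g₃ (terminal (5000 * wordLength g)) := commute_terminal hfix (by omega)
  have l4 := length_terminalWord (L := 5000 * wordLength g) (by omega)
  have hterm : g * (firstWord g ++ secondWord 38 g₁ ++ w₃ ++ terminalWord (5000 * wordLength g) ++
      w₅).eval = terminal (5000 * wordLength g) := by
    simp only [Word.eval_append, ← mul_assoc]
    rw [← hg₁, ← hg₃, eval_terminalWord (by omega), h₅.1, hcomm.eq, mul_inv_cancel_right]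
  have far : ∀ j, 5000 * wordLength g ≤ 3 * wordLength (g₃ * (Letter.x₀.toBV ^
      (5000 * wordLength g) * Letter.x₁.toBV⁻¹ * Letter.x₀.toBV⁻¹ ^ j)) := by
    intro j
    have h1 := BV.lt_numCarets_mul_terminal hfix (L := 5000 * wordLength g - 1) (by omega) j
    rw [Nat.sub_add_cancel (by omega)] at h1
    have h2 := numCarets_le_wordLength (g₃ * (Letter.x₀.toBV ^
      (5000 * wordLength g) * Letter.x₁.toBV⁻¹ * Letter.x₀.toBV⁻¹ ^ j))
    omega
  have bound : ∀ w' : Word, w' <+: firstWord g ++ secondWord 38 g₁ ++ w₃ ++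
      terminalWord (5000 * wordLength g) ++ w₅ →
      wordLength g ≤ 10700 * wordLength (g * w'.eval) := by
    intro w' hw'
    rw [List.append_assoc (firstWord g)] at hw'
    rcases prefix_append_cases hw' with hw' | ⟨b, hb, rfl⟩
    · rcases prefix_append_cases hw' with hw' | ⟨b, hb, rfl⟩
      · rcases prefix_append_cases hw' with hw' | ⟨b, hb, rfl⟩
        -- A prefix of w₁ has at most four letters and does not lead to the identity, so |g| ≤
        -- 5|gw'|.
        · have h1 := wordLength_le_mul_eval g w'
          have h2 := hw'.length_le
          have h3 := wordLength_pos (mul_eval_ne_one hN hw')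
          omega
        · have h1 := wordLength_le_of_prefix_second_third hK h₃ hb
          rw [Word.eval_append, ← mul_assoc, ← hg₁]
          omega
      · have e : g * (firstWord g ++ (secondWord 38 g₁ ++ w₃) ++ b).eval = g₃ * Word.eval b := by
          simp only [Word.eval_append, ← mul_assoc]
          rw [← hg₁, ← hg₃]
        rw [e]
        rcases eval_prefix_terminalWord hb with ⟨m, hm, e'⟩ | ⟨j, e'⟩
        -- The length here is at least m/3 and at least |g₃| - m, hence at least |g₃|/4. With |g| ≤
        -- 5|g₁| and |g₁| ≤ 535|g₃| this gives 5 · 535 · 4 = 10700.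
        · have h1 := BV.le_numCarets_mul_x₀_pow hfix m
          have h2 := numCarets_le_wordLength (g₃ * Word.eval b)
          have h3 := wordLength_le_mul_eval g₃ b
          rw [← e'] at h1
          omega
        · have h1 := far j
          rw [← e'] at h1
          omega
    · have e : g * (firstWord g ++ (secondWord 38 g₁ ++ w₃) ++
          terminalWord (5000 * wordLength g) ++ b).eval =
          g₃ * (terminalWord (5000 * wordLength g)).eval * Word.eval b := by
        simp only [Word.eval_append, ← mul_assoc]
        rw [← hg₁, ← hg₃]
      rw [e]
      -- A prefix of w₅ has length at most |g₃| ≤ 1429|g| and cannot use up the length 5000|g|/3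
      -- reached after w₄.
      have h1 := wordLength_le_mul_eval (g₃ * (terminalWord (5000 * wordLength g)).eval) b
      have h2 := hb.length_le
      have h3 : 5000 * wordLength g ≤
          3 * wordLength (g₃ * (terminalWord (5000 * wordLength g)).eval) := by
        rcases eval_prefix_terminalWord (List.prefix_refl (terminalWord (5000 * wordLength g)))
          with ⟨m, hm, e'⟩ | ⟨j, e'⟩
        · have h1 := BV.le_numCarets_mul_x₀_pow hfix m
          have h2 := numCarets_le_wordLength
            (g₃ * (terminalWord (5000 * wordLength g)).eval)
          rw [← e'] at h1
          omega
        · rw [e']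
          exact far j
      omega
  have lower : ∀ w' : Word, w' <+: firstWord g ++ secondWord 38 g₁ ++ w₃ ++
      terminalWord (5000 * wordLength g) ++ w₅ →
      (1 / 20000 : ℝ) * wordLength g < wordLength (g * w'.eval) := by
    intro w' hw'
    have h1 : (wordLength g : ℝ) ≤ 10700 * wordLength (g * w'.eval) := by
      exact_mod_cast bound w' hw'
    have h2 : (0 : ℝ) < wordLength g := by exact_mod_cast hg
    linarith
  have len : (firstWord g ++ secondWord 38 g₁ ++ w₃ ++ terminalWord (5000 * wordLength g) ++
      w₅).length < 20000 * wordLength g := by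
    simp only [List.length_append]
    omega
  have len' : ((firstWord g ++ secondWord 38 g₁ ++ w₃ ++ terminalWord (5000 * wordLength g) ++
      w₅).length : ℝ) < 20000 * wordLength g := by exact_mod_cast len
  refine ⟨?_, _, _, _, _, _, _, _, _, rfl, rfl, rfl, rfl, rfl, h₃, rfl, h₅, hcomm, len', lower,
    hterm⟩
  obtain ⟨p, hp1, hp2⟩ := exists_walk (firstWord g ++ secondWord 38 g₁ ++ w₃ ++
    terminalWord (5000 * wordLength g) ++ w₅) g
  refine ⟨p.copy rfl hterm, ?_, ?_⟩
  · rw [SimpleGraph.Walk.length_copy]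
    exact (by exact_mod_cast hp1.trans len.le)
  · intro h hh
    rw [SimpleGraph.Walk.support_copy] at hh
    obtain ⟨w', hw', rfl⟩ := hp2 h hh
    exact lower w' hw'
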